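/- Let $G\cong C_{n_1}\oplus\dots\oplus C_{n_r}$ be a finite abelian group with $r\ge 1$, $1<n_1\mid\dots\mid n_r$ and $\mathsf D(G)\ge 4$, where $\mathsf D(G)$ is the maximal length of a minimal zero-sum sequence over $G$. For a subset $G_0\subset G$ let $\mathcal B(G_0)$ be the monoid of zero-sum sequences (finite multisets with sum $0$) over $G_0$; its atoms are the minimal zero-sum sequences. For $B\in\mathcal B(G_0)$ let $\mathsf L(B)$ be the set of all $k$ such that $B$ is a product of $k$ atoms, with $\mathsf L(1)=\{0\}$. The elasticity of a set of lengths is $\rho(L)=\sup L/\min L$, with $\rho(\{0\})=1$, and $\rho(G_0)=\sup_{B\in\mathcal B(G_0)}\rho(\mathsf L(B))$. Let $\Delta(G_0)$ be the set of all differences of consecutive elements of sets $\mathsf L(B)$, $B\in\mathcal B(G_0)$; $G_0$ is half-factorial if $\Delta(G_0)=\emptyset$. The cross number of a sequence $S=g_1\cdots g_\ell$ is $\mathsf k(S)=\sum_{i}1/\mathrm{ord}(g_i)$, and $\mathsf K(G_0)$ is the maximum of $\mathsf k(A)$ over the atoms $A$ of $\mathcal B(G_0)$. Let $\Delta_1(G)$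 be the set of all positive integers $d$ such that for every $k\in\mathbb N$ there are $B\in\mathcal B(G)$, integers $\ell\ge k$, $M\ge 0$ and $y$, and sets $L'\subset[-M,-1]$, $L''\subset \ell d+[1,M]$ with $\mathsf L(B)=y+(L'\cup\{0,d,\dots,\ell d\}\cup L'')\subset y+d\mathbb Z$. For a positive integer $d$ let $\rho^*(G,d)$ and $\mathsf K(G,d)$ be the maximum of $\rho(G_0)$, respectively of $\mathsf K(G_0)$, over all non-half-factorial subsets $G_0\subset G$ such that $d$ divides $\min\Delta(G_0)$. Let $d\in\Delta_1(G)$ with $d\ge\max\{\lfloor n_r/2\rfloor,\lfloor (r+1)/2\rfloor\}$. Then there are such subsets $G_0$, so that the two maxima exist, and: 1. If $d\ge r$, then $d<n_r$ and $\rho^*(G,d)=\dfrac{n_r}{n_r-d}$. 2. If $d\ge n_r-1$, then $\rho^*(G,d)=\mathsf K(G,d)$. Moreover: 3. Suppose $r=n_r-1\ge 3$. Then subsets $G_0$ as above exist for $d=r-1$. If $n_1=n_r$ is a prime power, i.e. $n_1=n_r=p^k$ with $p$ prime and $k\ge 1$, then $\mathsf K(G,r-1)<\rho^*(G,r-1)=1+\dfrac{(r+1)(r-1)}{r+2}<r$.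 Otherwise, $\mathsf K(G,r-1)=\rho^*(G,r-1)$. -/

import Mathlib

open scoped ENNReal NNReal

/-! Sequences over an additive abelian group `G` are finite multisets of elements of `G`;
the product of sequences is the sum of multisets. -/

namespace ZeroSum

noncomputable section

variable {G : Type*} [AddCommGroup G]

/-- `S` belongs to the monoid `B(G₀)` of zero-sum sequences over `G₀`. -/
def IsZeroSumSeq (G₀ : Set G) (S : Multiset G) : Prop :=
  (∀ g ∈ S, g ∈ G₀) ∧ S.sum = 0

/-- `S` is a minimal zero-sum sequence over `G₀`, i.e. an atom of `B(G₀)`: it is a nontrivial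
zero-sum sequence no proper nontrivial subsequence of which has sum zero. -/
def IsAtom (G₀ : Set G) (S : Multiset G) : Prop :=
  IsZeroSumSeq G₀ S ∧ S ≠ 0 ∧ ∀ T : Multiset G, T < S → T ≠ 0 → T.sum ≠ 0

/-- The Davenport constant of `G₀`: the maximal length of an atom of `B(G₀)`. -/
def davenport (G₀ : Set G) : ℕ∞ :=
  ⨆ (S : Multiset G) (_ : IsAtom G₀ S), (Multiset.card S : ℕ∞)

/-- The set of lengths of `B` in `B(G₀)`: all `k` such that `B` is a product of `k` atoms of
`B(G₀)`. The empty sequence has set of lengths `{0}`. -/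
def lengthSet (G₀ : Set G) (B : Multiset G) : Set ℕ :=
  {k | ∃ F : Multiset (Multiset G), (∀ A ∈ F, IsAtom G₀ A) ∧ F.sum = B ∧ Multiset.card F = k}

/-- The system of sets of lengths of `B(G₀)`. -/
def lengthSystem (G₀ : Set G) : Set (Set ℕ) :=
  {L | ∃ B : Multiset G, IsZeroSumSeq G₀ B ∧ lengthSet G₀ B = L}

/-- The set of successive distances of a set `L` of nonnegative integers. -/
def distances (L : Set ℕ) : Set ℕ :=
  {d | ∃ a b : ℕ, a < b ∧ b = a + d ∧ Set.Icc a b ∩ L = {a, b}}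

/-- The set of distances `Δ(G₀)` of `B(G₀)`. -/
def Delta (G₀ : Set G) : Set ℕ :=
  ⋃ L ∈ lengthSystem G₀, distances L

/-- `min Δ(G₀)`, with the convention `min ∅ = 0`. -/
def minDelta (G₀ : Set G) : ℕ :=
  sInf (Delta G₀)

open Classical in
/-- The elasticity `sup L / min L` of a set of lengths, with the convention that `{0}` has
elasticity `1`. -/
def setElasticity (L : Set ℕ) : ℝ≥0∞ :=
  if L = {0} then 1 else (⨆ k ∈ L, (k : ℝ≥0∞)) / ((sInf L : ℕ) : ℝ≥0∞)

/-- The elasticity `ρ(G₀)` of `B(G₀)`. -/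
def elasticity (G₀ : Set G) : ℝ≥0∞ :=
  ⨆ L ∈ lengthSystem G₀, setElasticity L

/-- The cross number `k(S)` of a sequence `S`: the sum of the reciprocals of the orders of its
terms. -/
def seqCrossNumber (S : Multiset G) : ℝ≥0 :=
  (S.map fun g => ((addOrderOf g : ℝ≥0))⁻¹).sum

/-- The cross number `K(G₀)` of `G₀`: the maximal cross number of an atom of `B(G₀)`. -/
def crossNumber (G₀ : Set G) : ℝ≥0∞ :=
  ⨆ (A : Multiset G) (_ : IsAtom G₀ A), (seqCrossNumber A : ℝ≥0∞)

/-- `L` is an almost arithmetical progression with difference `d`, length `l` and bound `M`: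
`L = y + (L' ∪ {0, d, …, l d} ∪ L'') ⊆ y + d ℤ` with `L' ⊆ [-M, -1]` and
`L'' ⊆ l d + [1, M]`. -/
def IsAAP (d l M : ℕ) (L : Set ℤ) : Prop :=
  ∃ (y : ℤ) (L' L'' : Set ℤ),
    L' ⊆ Set.Icc (-(M : ℤ)) (-1) ∧
    L'' ⊆ Set.Icc ((l : ℤ) * d + 1) ((l : ℤ) * d + M) ∧
    L = (fun x => y + x) '' (L' ∪ {x | ∃ j : ℕ, j ≤ l ∧ x = (j : ℤ) * d} ∪ L'') ∧
    ∀ x ∈ L, (d : ℤ) ∣ x - y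

variable (G) in
/-- `Δ₁(G)`: the positive integers `d` such that for every `k` some set of lengths of `B(G)` is
an almost arithmetical progression with difference `d` and length at least `k`. -/
def DeltaOne : Set ℕ :=
  {d | 0 < d ∧ ∀ k : ℕ, ∃ L ∈ lengthSystem (Set.univ : Set G),
    ∃ l M : ℕ, k ≤ l ∧ IsAAP d l M ((fun m : ℕ => (m : ℤ)) '' L)}

/-- `G₀` is non-half-factorial and `d` divides `min Δ(G₀)`. -/
def Admissible (d : ℕ) (G₀ : Set G) : Prop :=
  (Delta G₀).Nonempty ∧ d ∣ minDelta G₀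

variable (G) in
/-- `ρ*(G, d)`: the maximum of `ρ(G₀)` over all non-half-factorial `G₀ ⊆ G` for which `d`
divides `min Δ(G₀)`. -/
def rhoStar (d : ℕ) : ℝ≥0∞ :=
  sSup {x | ∃ G₀ : Set G, Admissible d G₀ ∧ elasticity G₀ = x}

variable (G) in
/-- `K(G, d)`: the maximum of `K(G₀)` over all non-half-factorial `G₀ ⊆ G` for which `d`
divides `min Δ(G₀)`. -/
def crossK (d : ℕ) : ℝ≥0∞ :=
  sSup {x | ∃ G₀ : Set G, Admissible d G₀ ∧ crossNumber G₀ = x}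

/-- Over a finite group, the supremum that defines `ρ*(G, d)` is a maximum as soon as some
subset is admissible. -/
theorem rhoStar_attained [Finite G] {d : ℕ} (h : ∃ G₀ : Set G, Admissible d G₀) :
    IsGreatest {x | ∃ G₀ : Set G, Admissible d G₀ ∧ elasticity G₀ = x} (rhoStar G d) := by
  obtain ⟨G₀, h⟩ := h
  refine ⟨Set.Nonempty.csSup_mem ⟨_, G₀, h, rfl⟩ ?_, fun x hx => le_sSup hx⟩
  exact (Set.toFinite {G₀ : Set G | Admissible d G₀}).image elasticity

/-- Over a finite group, the supremum that defines `K(G, d)` is a maximum as soon as some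
subset is admissible. -/
theorem crossK_attained [Finite G] {d : ℕ} (h : ∃ G₀ : Set G, Admissible d G₀) :
    IsGreatest {x | ∃ G₀ : Set G, Admissible d G₀ ∧ crossNumber G₀ = x} (crossK G d) := by
  obtain ⟨G₀, h⟩ := h
  refine ⟨Set.Nonempty.csSup_mem ⟨_, G₀, h, rfl⟩ ?_, fun x hx => le_sSup hx⟩
  exact (Set.toFinite {G₀ : Set G | Admissible d G₀}).image crossNumber

end

end ZeroSum

set_option linter.unusedSectionVars false

namespace ZeroSum

variable {G : Type*} [AddCommGroup G]

/-! ### Atoms and factorizations -/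

/-! Let `n` be the exponent and let `wt n` be `n` times the cross number. The `n`-th power of a
sequence `B` is a product of `wt n B` atoms `strip g`. Hence, if `d` divides all differences of
lengths over `G₀` (`UniformLengths`, which follows from `Admissible`), every atom has weight
congruent to `n` modulo `d`; and `G₀` is half-factorial exactly when all atoms weigh `n`. Upper
bounds for elasticities come from functions on `G` whose sum over every atom lies in `[1, C]`, lower
bounds from explicit pairs of factorizations.

Admissible sets exist for `d ∈ Δ₁(G)`: take a maximal set `S` whose elements can all be made
arbitrarily frequent in sequences with long, `d`-periodic sets of lengths. Lengths over `S` are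
congruent modulo `d`, and if `S` were half-factorial, the boundedly many remaining terms could not
produce unbounded length differences.

If `d ≥ n - 1`, no atom weighs less than `n`, so the weight `1 / ord` gives elasticity equal to
cross number.

If `n ≤ 2d + 1`, an atom lighter than `n` weighs exactly `n - d` and is squarefree with terms of
order `n`, while an atom heavier than `n` has at least `d + 2` distinct terms. When also `d ≥ r`,
heavy atoms do not exist (`wt_le_of_rank_le`). On the support of a minimal heavy atom, a primitive
integral relation avoiding one element shows that all relations are differences of products of atoms
of weight `n`; so the heavy atom becomes such a product after adding powers `strip g`, which
`not_good_add_strip` forbids. All weights then lie in `[n - d, n]`, with `n - d` attained, and the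
elasticity is `n / (n - d)`.

For `r = n - 1` and `d = r - 1 = n - 2` the light atoms are pairs `{g, -g}` with `g` of order `n`.
Fixing such a pair, consider blocks, the minimal sequences over the other elements with sum in
`⟨g⟩`; their sums are `0`, `g` or `-g`. If all blocks for all pairs sum to zero, the elasticity is
at most `max (n / 2) (K(G₀))`. Otherwise a block of minimal support is a basis `Y` of `G ≅
C_n^(n-1)` with sum `±g`, and `G₀ ⊆ {0, g, -g} ∪ Y`; the atoms over this set are listed explicitly
and its elasticity is at most `(n² - n + 1) / (n + 1)`. This dichotomy is `elasticity_dichotomy`.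

It remains to compare with `K(G, n - 2)`. Independent elements together with their sum yield atoms
of large cross number: always at least `n / 2`, and at least `n - 1` for `C_n^(n-1)` with `n` not a
prime power. For prime powers an Olson-type argument in the group algebra over `ZMod p`, combined
with the congruence modulo `n - 2`, bounds `K` strictly below `(n² - n + 1) / (n + 1)`, which is
attained by `{g, -g} ∪ Y`. -/

theorem IsAtom.mem {G₀ : Set G} {A : Multiset G} (h : IsAtom G₀ A) {g : G} (hg : g ∈ A) :
    g ∈ G₀ := h.1.1 g hg

theorem IsAtom.sum_eq {G₀ : Set G} {A : Multiset G} (h : IsAtom G₀ A) : A.sum = 0 := h.1.2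

theorem IsAtom.ne_zero {G₀ : Set G} {A : Multiset G} (h : IsAtom G₀ A) : A ≠ 0 := h.2.1

theorem IsAtom.of_mem {G₀ G₁ : Set G} {A : Multiset G} (h : IsAtom G₀ A)
    (h' : ∀ g ∈ A, g ∈ G₁) : IsAtom G₁ A := ⟨⟨h', h.1.2⟩, h.2⟩

theorem IsAtom.eq_of_le {G₀ : Set G} {A T : Multiset G} (h : IsAtom G₀ A) (hT : T ≤ A)
    (h0 : T ≠ 0) (hs : T.sum = 0) : T = A := by
  by_contra hne
  exact h.2.2 T (lt_of_le_of_ne hT hne) h0 hs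

theorem isAtom_of_forall {G₀ : Set G} {A : Multiset G} (hm : ∀ g ∈ A, g ∈ G₀) (hs : A.sum = 0)
    (h0 : A ≠ 0) (h : ∀ T ≤ A, T ≠ 0 → T.sum = 0 → T = A) : IsAtom G₀ A :=
  ⟨⟨hm, hs⟩, h0, fun T hT hT0 hTs => hT.ne (h T hT.le hT0 hTs)⟩

theorem exists_isAtom_le {G₀ : Set G} {B : Multiset G} (hB : IsZeroSumSeq G₀ B) (h0 : B ≠ 0) :
    ∃ A, IsAtom G₀ A ∧ A ≤ B := by
  induction hc : Multiset.card B using Nat.strong_induction_on generalizing B with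
  | _ c ih =>
    by_cases h : ∀ T : Multiset G, T < B → T ≠ 0 → T.sum ≠ 0
    · exact ⟨B, ⟨hB, h0, h⟩, le_rfl⟩
    · push Not at h
      obtain ⟨T, hT, hT0, hTs⟩ := h
      obtain ⟨A, hA, hAT⟩ := ih _ (hc ▸ Multiset.card_lt_card hT)
        ⟨fun g hg => hB.1 g (Multiset.mem_of_le hT.le hg), hTs⟩ hT0 rfl
      exact ⟨A, hA, hAT.trans hT.le⟩

theorem sum_sub_eq {A B : Multiset G} [DecidableEq G] (h : A ≤ B) :
    (B - A).sum = B.sum - A.sum := by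
  have : (B - A + A).sum = B.sum := by rw [tsub_add_cancel_of_le h]
  rw [Multiset.sum_add] at this
  rw [← this]; abel

theorem IsZeroSumSeq.sub {G₀ : Set G} {A B : Multiset G} [DecidableEq G]
    (hB : IsZeroSumSeq G₀ B) (hA : A.sum = 0) (h : A ≤ B) : IsZeroSumSeq G₀ (B - A) :=
  ⟨fun g hg => hB.1 g (Multiset.mem_of_le (Multiset.sub_le_self _ _) hg), by
    rw [sum_sub_eq h, hB.2, hA, sub_zero]⟩

theorem exists_factorization {G₀ : Set G} {B : Multiset G} (hB : IsZeroSumSeq G₀ B) :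
    ∃ F : Multiset (Multiset G), (∀ A ∈ F, IsAtom G₀ A) ∧ F.sum = B := by
  classical
  induction hc : Multiset.card B using Nat.strong_induction_on generalizing B with
  | _ c ih =>
    by_cases h0 : B = 0
    · exact ⟨0, by simp, by simp [h0]⟩
    · obtain ⟨A, hA, hAB⟩ := exists_isAtom_le hB h0
      have hlt : Multiset.card (B - A) < c := by
        rw [Multiset.card_sub hAB, ← hc]
        have := Multiset.card_pos.2 hA.ne_zero
        have := Multiset.card_le_card hAB
        omega
      obtain ⟨F, hF, hFs⟩ := ih _ hlt (hB.sub hA.sum_eq hAB) rfl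
      refine ⟨A ::ₘ F, ?_, ?_⟩
      · intro C hC
        rcases Multiset.mem_cons.1 hC with rfl | hC
        exacts [hA, hF C hC]
      · rw [Multiset.sum_cons, hFs, add_tsub_cancel_of_le hAB]

theorem isZeroSumSeq_sum {G₀ : Set G} {F : Multiset (Multiset G)} (hF : ∀ A ∈ F, IsAtom G₀ A) :
    IsZeroSumSeq G₀ F.sum := by
  induction F using Multiset.induction with
  | empty => exact ⟨by simp, by simp⟩
  | cons A F ih =>
    have h1 := ih fun B hB => hF B (Multiset.mem_cons_of_mem hB)
    have h2 := hF A (Multiset.mem_cons_self A F)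
    rw [Multiset.sum_cons]
    refine ⟨fun g hg => ?_, by rw [Multiset.sum_add, h1.2, h2.1.2, add_zero]⟩
    rcases Multiset.mem_add.1 hg with h | h
    exacts [h2.1.1 g h, h1.1 g h]

theorem mem_sum_of_mem {F : Multiset (Multiset G)} {A : Multiset G} (hA : A ∈ F) : A ≤ F.sum :=
  Multiset.single_le_sum (fun _ _ => Multiset.zero_le _) A hA

theorem eq_zero_of_sum_eq_zero {G₀ : Set G} {F : Multiset (Multiset G)}
    (hF : ∀ A ∈ F, IsAtom G₀ A) (h : F.sum = 0) : F = 0 := by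
  by_contra hne
  obtain ⟨A, hA⟩ := Multiset.exists_mem_of_ne_zero hne
  have := mem_sum_of_mem hA
  rw [h] at this
  exact (hF A hA).ne_zero (Multiset.le_zero.1 this)

/-! ### Weights -/

theorem le_map_sum {M : Type*} [AddCommMonoid M] [PartialOrder M] [IsOrderedAddMonoid M]
    (φ : G → M) (c : M) (F : Multiset (Multiset G)) (h : ∀ A ∈ F, c ≤ (A.map φ).sum) :
    Multiset.card F • c ≤ (F.sum.map φ).sum := by
  induction F using Multiset.induction with
  | empty => simp
  | cons A F ih =>
    rw [Multiset.sum_cons, Multiset.map_add, Multiset.sum_add, Multiset.card_cons, succ_nsmul']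
    exact add_le_add (h A (Multiset.mem_cons_self _ _))
      (ih fun B hB => h B (Multiset.mem_cons_of_mem hB))

theorem map_sum_le {M : Type*} [AddCommMonoid M] [PartialOrder M] [IsOrderedAddMonoid M]
    (φ : G → M) (c : M) (F : Multiset (Multiset G)) (h : ∀ A ∈ F, (A.map φ).sum ≤ c) :
    (F.sum.map φ).sum ≤ Multiset.card F • c := by
  induction F using Multiset.induction with
  | empty => simp
  | cons A F ih =>
    rw [Multiset.sum_cons, Multiset.map_add, Multiset.sum_add, Multiset.card_cons, succ_nsmul']
    exact add_le_add (h A (Multiset.mem_cons_self _ _))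
      (ih fun B hB => h B (Multiset.mem_cons_of_mem hB))

/-! ### Sets of lengths and divisibility of distances -/

/-- Any two factorizations over `G₀` of the same sequence have lengths congruent modulo `d`. -/
def UniformLengths (d : ℕ) (G₀ : Set G) : Prop :=
  ∀ F F' : Multiset (Multiset G), (∀ A ∈ F, IsAtom G₀ A) → (∀ A ∈ F', IsAtom G₀ A) →
    F.sum = F'.sum → (d : ℤ) ∣ (Multiset.card F : ℤ) - Multiset.card F'

/-- Any two factorizations over `G₀` of the same sequence have the same length. -/
def HalfFactorial (G₀ : Set G) : Prop :=
  ∀ F F' : Multiset (Multiset G), (∀ A ∈ F, IsAtom G₀ A) → (∀ A ∈ F', IsAtom G₀ A) →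
    F.sum = F'.sum → Multiset.card F = Multiset.card F'

theorem exists_distance_le {L : Set ℕ} {x y : ℕ} (hx : x ∈ L) (hy : y ∈ L) (hxy : x < y) :
    ∃ e ∈ distances L, 0 < e ∧ e ≤ y - x := by
  classical
  have hex : ∃ z, x < z ∧ z ∈ L := ⟨y, hxy, hy⟩
  have hz := Nat.find_spec hex
  have hzy : Nat.find hex ≤ y := Nat.find_min' hex ⟨hxy, hy⟩
  refine ⟨Nat.find hex - x, ⟨x, Nat.find hex, hz.1, by omega, ?_⟩, by omega, by omega⟩
  ext w
  simp only [Set.mem_inter_iff, Set.mem_Icc, Set.mem_insert_iff, Set.mem_singleton_iff]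
  constructor
  · rintro ⟨⟨h1, h2⟩, h3⟩
    by_contra hcon
    push Not at hcon
    exact Nat.find_min hex (m := w) (by omega) ⟨by omega, h3⟩
  · rintro (rfl | rfl)
    · exact ⟨⟨le_rfl, hz.1.le⟩, hx⟩
    · exact ⟨⟨hz.1.le, le_rfl⟩, hz.2⟩

theorem mem_Delta_iff {G₀ : Set G} {e : ℕ} :
    e ∈ Delta G₀ ↔ ∃ B, IsZeroSumSeq G₀ B ∧ e ∈ distances (lengthSet G₀ B) := by
  simp only [Delta, lengthSystem, Set.mem_iUnion, Set.mem_ofPred_eq, exists_prop]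
  constructor
  · rintro ⟨L, ⟨B, hB, rfl⟩, h⟩
    exact ⟨B, hB, h⟩
  · rintro ⟨B, hB, h⟩
    exact ⟨_, ⟨B, hB, rfl⟩, h⟩

theorem exists_mem_Delta_le {G₀ : Set G} {F F' : Multiset (Multiset G)}
    (hF : ∀ A ∈ F, IsAtom G₀ A) (hF' : ∀ A ∈ F', IsAtom G₀ A) (hs : F.sum = F'.sum)
    (hlt : Multiset.card F < Multiset.card F') :
    ∃ e ∈ Delta G₀, 0 < e ∧ e ≤ Multiset.card F' - Multiset.card F := by
  obtain ⟨e, he, h⟩ := exists_distance_le (L := lengthSet G₀ F.sum) (x := Multiset.card F)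
    (y := Multiset.card F') ⟨F, hF, rfl, rfl⟩ ⟨F', hF', hs.symm, rfl⟩ hlt
  exact ⟨e, mem_Delta_iff.2 ⟨_, isZeroSumSeq_sum hF, he⟩, h⟩

theorem exists_of_mem_Delta {G₀ : Set G} {e : ℕ} (he : e ∈ Delta G₀) : 0 < e ∧
    ∃ F F' : Multiset (Multiset G), (∀ A ∈ F, IsAtom G₀ A) ∧ (∀ A ∈ F', IsAtom G₀ A) ∧
      F.sum = F'.sum ∧ Multiset.card F' = Multiset.card F + e := by
  obtain ⟨B, -, a, b, hab, hb, hL⟩ := mem_Delta_iff.1 he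
  have ha : a ∈ lengthSet G₀ B := by
    have : a ∈ Set.Icc a b ∩ lengthSet G₀ B := by rw [hL]; simp
    exact this.2
  have hb' : b ∈ lengthSet G₀ B := by
    have : b ∈ Set.Icc a b ∩ lengthSet G₀ B := by rw [hL]; simp
    exact this.2
  obtain ⟨F, hF, hFs, hFc⟩ := ha
  obtain ⟨F', hF', hFs', hFc'⟩ := hb'
  exact ⟨by omega, F, F', hF, hF', by rw [hFs, hFs'], by omega⟩

theorem forall_mem_add {G₀ : Set G} {F F' : Multiset (Multiset G)}
    (hF : ∀ A ∈ F, IsAtom G₀ A) (hF' : ∀ A ∈ F', IsAtom G₀ A) : ∀ A ∈ F + F', IsAtom G₀ A := by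
  intro A hA
  rcases Multiset.mem_add.1 hA with h | h
  exacts [hF A h, hF' A h]

theorem forall_mem_nsmul {G₀ : Set G} {F : Multiset (Multiset G)}
    (hF : ∀ A ∈ F, IsAtom G₀ A) (k : ℕ) : ∀ A ∈ k • F, IsAtom G₀ A :=
  fun A hA => hF A (Multiset.mem_of_mem_nsmul hA)

/-- The least distance divides every difference of lengths. Adjoin to the longer factorization
copies of the short side of a pair realizing `min Δ(G₀)`, and to the shorter one as many copies of
the long side: the difference drops to its remainder, and a nonzero remainder would produce a
smaller distance. -/
theorem Admissible.uniformLengths {d : ℕ} {G₀ : Set G} (h : Admissible d G₀) :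
    UniformLengths d G₀ := by
  obtain ⟨hne, hd⟩ := h
  have hmem : minDelta G₀ ∈ Delta G₀ := Nat.sInf_mem hne
  obtain ⟨hpos, E, E', hE, hE', hEs, hEc⟩ := exists_of_mem_Delta hmem
  set δ := minDelta G₀ with hδ
  have key : ∀ F F' : Multiset (Multiset G), (∀ A ∈ F, IsAtom G₀ A) → (∀ A ∈ F', IsAtom G₀ A) →
      F.sum = F'.sum → Multiset.card F ≤ Multiset.card F' →
      δ ∣ Multiset.card F' - Multiset.card F := by
    intro F F' hF hF' hs hle
    by_contra hnd
    set e := Multiset.card F' - Multiset.card F with he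
    have hr : 0 < e % δ := Nat.pos_of_ne_zero fun h0 => hnd (Nat.dvd_of_mod_eq_zero h0)
    have hr2 : e % δ < δ := Nat.mod_lt _ hpos
    have hdm : δ * (e / δ) + e % δ = e := Nat.div_add_mod e δ
    have c1 : Multiset.card (F + (e / δ) • E') =
        Multiset.card F + (e / δ) * Multiset.card E + δ * (e / δ) := by
      rw [Multiset.card_add, Multiset.card_nsmul, hEc]; ring
    have c2 : Multiset.card (F' + (e / δ) • E) =
        Multiset.card F' + (e / δ) * Multiset.card E := by
      rw [Multiset.card_add, Multiset.card_nsmul]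
    have hsum : (F + (e / δ) • E').sum = (F' + (e / δ) • E).sum := by
      rw [Multiset.sum_add, Multiset.sum_add, Multiset.sum_nsmul, Multiset.sum_nsmul, hs, hEs]
    obtain ⟨x, hx, hx0, hxle⟩ := exists_mem_Delta_le
      (forall_mem_add hF (forall_mem_nsmul hE' _)) (forall_mem_add hF' (forall_mem_nsmul hE _))
      hsum (by omega)
    have : δ ≤ x := Nat.sInf_le hx
    omega
  intro F F' hF hF' hs
  rcases le_total (Multiset.card F) (Multiset.card F') with hle | hle
  · have := hd.trans (key F F' hF hF' hs hle)
    rw [← Int.natCast_dvd_natCast, Nat.cast_sub hle] at this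
    rw [← neg_sub]
    exact (dvd_neg).2 this
  · have := hd.trans (key F' F hF' hF hs.symm hle)
    rwa [← Int.natCast_dvd_natCast, Nat.cast_sub hle] at this

theorem Admissible.not_halfFactorial {d : ℕ} {G₀ : Set G} (h : Admissible d G₀) :
    ¬ HalfFactorial G₀ := by
  obtain ⟨⟨e, he⟩, -⟩ := h
  obtain ⟨hpos, E, E', hE, hE', hEs, hEc⟩ := exists_of_mem_Delta he
  intro hh
  have := hh E E' hE hE' hEs
  omega

theorem admissible_of_uniformLengths {d : ℕ} {G₀ : Set G} (h : UniformLengths d G₀)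
    (hh : ¬ HalfFactorial G₀) : Admissible d G₀ := by
  have hne : (Delta G₀).Nonempty := by
    unfold HalfFactorial at hh
    push Not at hh
    obtain ⟨F, F', hF, hF', hs, hc⟩ := hh
    rcases lt_or_gt_of_ne hc with hlt | hlt
    · obtain ⟨e, he, -⟩ := exists_mem_Delta_le hF hF' hs hlt
      exact ⟨e, he⟩
    · obtain ⟨e, he, -⟩ := exists_mem_Delta_le hF' hF hs.symm hlt
      exact ⟨e, he⟩
  refine ⟨hne, ?_⟩
  obtain ⟨-, E, E', hE, hE', hEs, hEc⟩ := exists_of_mem_Delta (Nat.sInf_mem hne)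
  have := h E' E hE' hE hEs.symm
  rw [hEc] at this
  push_cast at this
  rw [add_sub_cancel_left] at this
  exact_mod_cast this

/-! ### Bounds for the elasticity -/

theorem mem_lengthSet_zero {G₀ : Set G} : lengthSet G₀ (0 : Multiset G) = {0} := by
  ext k
  simp only [lengthSet, Set.mem_ofPred_eq, Set.mem_singleton_iff]
  constructor
  · rintro ⟨F, hF, hs, rfl⟩
    simp [eq_zero_of_sum_eq_zero hF hs]
  · rintro rfl
    exact ⟨0, by simp, by simp, by simp⟩

/-- The total weight of a sequence bounds each of its lengths from above, and is at most `C` times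
its smallest length. -/
theorem elasticity_le_of_weight {G₀ : Set G} (φ : G → ℝ) (C : ℝ) (hC : 1 ≤ C)
    (h1 : ∀ A, IsAtom G₀ A → 1 ≤ (A.map φ).sum) (h2 : ∀ A, IsAtom G₀ A → (A.map φ).sum ≤ C) :
    elasticity G₀ ≤ ENNReal.ofReal C := by
  refine iSup₂_le fun L hL => ?_
  obtain ⟨B, hB, rfl⟩ := hL
  unfold setElasticity
  split_ifs with h0
  · exact_mod_cast ENNReal.one_le_ofReal.2 hC
  have hub : ∀ k ∈ lengthSet G₀ B, (k : ℝ) ≤ (B.map φ).sum := by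
    rintro k ⟨F, hF, rfl, rfl⟩
    simpa using le_map_sum φ 1 F fun A hA => h1 A (hF A hA)
  obtain ⟨F, hF, hFs⟩ := exists_factorization hB
  have hne : (lengthSet G₀ B).Nonempty := ⟨_, F, hF, hFs, rfl⟩
  obtain ⟨E, hE, hEs, hEc⟩ := Nat.sInf_mem hne
  have hlb : (B.map φ).sum ≤ (sInf (lengthSet G₀ B) : ℕ) * C := by
    have := map_sum_le φ C E fun A hA => h2 A (hE A hA)
    rw [hEs, hEc, nsmul_eq_mul] at this
    exact this
  rw [ENNReal.div_le_iff_le_mul]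
  · refine iSup₂_le fun k hk => ?_
    have : (k : ℝ) ≤ C * (sInf (lengthSet G₀ B) : ℕ) := by
      rw [mul_comm]; exact (hub k hk).trans hlb
    calc (k : ℝ≥0∞) = ENNReal.ofReal k := by simp
      _ ≤ ENNReal.ofReal (C * (sInf (lengthSet G₀ B) : ℕ)) := ENNReal.ofReal_le_ofReal this
      _ = _ := by rw [ENNReal.ofReal_mul (by linarith), ENNReal.ofReal_natCast]
  · left
    intro hz
    have hz' : Multiset.card E = 0 := by rw [hEc]; exact_mod_cast hz
    rw [Multiset.card_eq_zero] at hz'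
    apply h0
    rw [← hEs, hz', Multiset.sum_zero, mem_lengthSet_zero]
  · left; exact ENNReal.natCast_ne_top _

theorem le_elasticity {G₀ : Set G} {F F' : Multiset (Multiset G)}
    (hF : ∀ A ∈ F, IsAtom G₀ A) (hF' : ∀ A ∈ F', IsAtom G₀ A) (hs : F.sum = F'.sum)
    (hne : F ≠ 0) :
    (Multiset.card F' : ℝ≥0∞) / (Multiset.card F : ℝ≥0∞) ≤ elasticity G₀ := by
  have hL : lengthSet G₀ F.sum ∈ lengthSystem G₀ := ⟨_, isZeroSumSeq_sum hF, rfl⟩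
  refine le_trans ?_ (le_iSup₂ (f := fun L (_ : L ∈ lengthSystem G₀) => setElasticity L) _ hL)
  have hm : Multiset.card F ∈ lengthSet G₀ F.sum := ⟨F, hF, rfl, rfl⟩
  have hm' : Multiset.card F' ∈ lengthSet G₀ F.sum := ⟨F', hF', hs.symm, rfl⟩
  unfold setElasticity
  rw [if_neg]
  · refine ENNReal.div_le_div ?_ ?_
    · exact le_iSup₂ (f := fun k (_ : k ∈ lengthSet G₀ F.sum) => (k : ℝ≥0∞)) _ hm'
    · exact_mod_cast Nat.sInf_le hm
  · intro h
    rw [h, Set.mem_singleton_iff, Multiset.card_eq_zero] at hm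
    exact hne hm

theorem rhoStar_le {d : ℕ} {C : ℝ≥0∞} (h : ∀ G₀ : Set G, Admissible d G₀ → elasticity G₀ ≤ C) :
    rhoStar G d ≤ C := by
  refine sSup_le ?_
  rintro x ⟨G₀, hG₀, rfl⟩
  exact h G₀ hG₀

theorem le_rhoStar {d : ℕ} {G₀ : Set G} (h : Admissible d G₀) : elasticity G₀ ≤ rhoStar G d :=
  le_sSup ⟨G₀, h, rfl⟩

theorem le_crossK {d : ℕ} {G₀ : Set G} (h : Admissible d G₀) : crossNumber G₀ ≤ crossK G d :=
  le_sSup ⟨G₀, h, rfl⟩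

theorem crossK_le {d : ℕ} {C : ℝ≥0∞} (h : ∀ G₀ : Set G, Admissible d G₀ → crossNumber G₀ ≤ C) :
    crossK G d ≤ C := by
  refine sSup_le ?_
  rintro x ⟨G₀, hG₀, rfl⟩
  exact h G₀ hG₀

/-! ### Scaled cross numbers -/

/-- `n` times the cross number, for `n` a multiple of the exponent of the group. -/
noncomputable def wt (n : ℕ) (S : Multiset G) : ℕ := (S.map fun g => n / addOrderOf g).sum

/-- The atom `g ^ ord(g)`. -/
noncomputable def strip (g : G) : Multiset G := Multiset.replicate (addOrderOf g) g

@[simp] theorem wt_zero (n : ℕ) : wt n (0 : Multiset G) = 0 := rfl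

@[simp] theorem wt_add (n : ℕ) (S T : Multiset G) : wt n (S + T) = wt n S + wt n T := by
  simp [wt]

@[simp] theorem wt_nsmul (n k : ℕ) (S : Multiset G) : wt n (k • S) = k * wt n S := by
  simp [wt, Multiset.map_nsmul, Multiset.sum_nsmul]

@[simp] theorem wt_replicate (n k : ℕ) (g : G) :
    wt n (Multiset.replicate k g) = k * (n / addOrderOf g) := by
  simp [wt]

theorem wt_singleton (n : ℕ) (g : G) : wt n {g} = n / addOrderOf g := by
  simp [wt]

theorem wt_mono (n : ℕ) {S T : Multiset G} (h : S ≤ T) : wt n S ≤ wt n T := by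
  obtain ⟨R, rfl⟩ := Multiset.le_iff_exists_add.1 h
  simp

section exponent

variable {n : ℕ} (hn : 0 < n) (hexp : ∀ x : G, n • x = 0)

include hexp in
theorem order_dvd (g : G) : addOrderOf g ∣ n := addOrderOf_dvd_of_nsmul_eq_zero (hexp g)

include hn hexp in
theorem order_pos (g : G) : 0 < addOrderOf g := Nat.pos_of_dvd_of_pos (order_dvd hexp g) hn

include hn hexp in
theorem order_le (g : G) : addOrderOf g ≤ n := Nat.le_of_dvd hn (order_dvd hexp g)

include hn hexp in
theorem wt_strip (g : G) : wt n (strip g) = n := by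
  rw [strip, wt_replicate, Nat.mul_div_cancel' (order_dvd hexp g)]

include hn hexp in
theorem card_le_wt (S : Multiset G) : Multiset.card S ≤ wt n S := by
  induction S using Multiset.induction with
  | empty => simp
  | cons g S ih =>
    rw [← Multiset.singleton_add, wt_add, Multiset.card_add, Multiset.card_singleton, wt_singleton]
    have := Nat.div_pos (order_le hn hexp g) (order_pos hn hexp g)
    omega

theorem wt_le_mul_card (S : Multiset G) : wt n S ≤ n * Multiset.card S := by
  induction S using Multiset.induction with
  | empty => simp
  | cons g S ih =>
    rw [← Multiset.singleton_add, wt_add, Multiset.card_add, Multiset.card_singleton, wt_singleton]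
    have := Nat.div_le_self n (addOrderOf g)
    linarith

include hn hexp in
theorem isAtom_strip {G₀ : Set G} {g : G} (hg : g ∈ G₀) : IsAtom G₀ (strip g) := by
  refine isAtom_of_forall ?_ ?_ ?_ ?_
  · intro x hx
    rw [Multiset.eq_of_mem_replicate hx]; exact hg
  · rw [strip, Multiset.sum_replicate, addOrderOf_nsmul_eq_zero]
  · intro h
    have := congrArg Multiset.card h
    rw [strip, Multiset.card_replicate, Multiset.card_zero] at this
    exact (order_pos hn hexp g).ne' this
  · intro T hT h0 hs
    obtain ⟨k, hk, rfl⟩ := Multiset.le_replicate_iff.1 hT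
    rw [Multiset.sum_replicate] at hs
    have h1 := Nat.le_of_dvd (Nat.pos_of_ne_zero (by rintro rfl; exact h0 rfl))
      (addOrderOf_dvd_of_nsmul_eq_zero hs)
    rw [strip, le_antisymm hk h1]

include hn hexp in
theorem IsAtom.eq_strip {G₀ : Set G} {A : Multiset G} (hA : IsAtom G₀ A) [DecidableEq G] {g : G}
    (h : addOrderOf g ≤ A.count g) : A = strip g := by
  have := isAtom_strip hn hexp (Set.mem_univ g)
  exact (hA.eq_of_le (Multiset.le_count_iff_replicate_le.1 h) this.ne_zero this.sum_eq).symm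

include hn hexp in
theorem IsAtom.count_le {G₀ : Set G} {A : Multiset G} (hA : IsAtom G₀ A) [DecidableEq G] (g : G) :
    A.count g ≤ addOrderOf g := by
  by_contra h
  push Not at h
  have h1 := hA.eq_strip hn hexp h.le
  rw [h1, strip, Multiset.count_replicate_self] at h
  exact lt_irrefl _ h

include hn hexp in
/-- The `n`-th power of a sequence is a product of atoms `g ^ ord(g)`. -/
theorem exists_strips (B : Multiset G) : ∃ F : Multiset (Multiset G),
    (∀ A ∈ F, ∃ g ∈ B, A = strip g) ∧ F.sum = n • B ∧ Multiset.card F = wt n B := by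
  induction B using Multiset.induction with
  | empty => exact ⟨0, by simp, by simp, by simp⟩
  | cons g B ih =>
    obtain ⟨F, hF, hs, hc⟩ := ih
    refine ⟨Multiset.replicate (n / addOrderOf g) (strip g) + F, ?_, ?_, ?_⟩
    · intro A hA
      rcases Multiset.mem_add.1 hA with h | h
      · exact ⟨g, Multiset.mem_cons_self _ _, Multiset.eq_of_mem_replicate h⟩
      · obtain ⟨x, hx, rfl⟩ := hF A h
        exact ⟨x, Multiset.mem_cons_of_mem hx, rfl⟩
    · rw [Multiset.sum_add, hs, Multiset.sum_replicate, ← Multiset.singleton_add, nsmul_add, strip,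
        Multiset.nsmul_replicate, Nat.div_mul_cancel (order_dvd hexp g), Multiset.nsmul_singleton]
    · rw [Multiset.card_add, hc, Multiset.card_replicate, ← Multiset.singleton_add, wt_add,
        wt_singleton]

include hn hexp in
theorem exists_strip_factorization {G₀ : Set G} {B : Multiset G} (hB : ∀ g ∈ B, g ∈ G₀) :
    ∃ F : Multiset (Multiset G), (∀ A ∈ F, IsAtom G₀ A) ∧ F.sum = n • B ∧
      Multiset.card F = wt n B := by
  obtain ⟨F, hF, h⟩ := exists_strips hn hexp B
  refine ⟨F, fun A hA => ?_, h⟩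
  obtain ⟨g, hg, rfl⟩ := hF A hA
  exact isAtom_strip hn hexp (hB g hg)

include hn hexp in
-- The sequence `n • A` is a product of `n` copies of `A` and also of `wt n A` atoms `strip g`.
theorem UniformLengths.dvd_wt_sub {d : ℕ} {G₀ : Set G} (h : UniformLengths d G₀) {A : Multiset G}
    (hA : IsAtom G₀ A) : (d : ℤ) ∣ (wt n A : ℤ) - n := by
  obtain ⟨F, hF, hs, hc⟩ := exists_strip_factorization hn hexp (G₀ := G₀) (B := A)
    fun g hg => hA.mem hg
  have := h F (Multiset.replicate n A) hF
    (fun C hC => (Multiset.eq_of_mem_replicate hC) ▸ hA) (by rw [hs, Multiset.sum_replicate])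
  rwa [hc, Multiset.card_replicate] at this

include hn hexp in
theorem HalfFactorial.wt_eq {G₀ : Set G} (h : HalfFactorial G₀) {A : Multiset G}
    (hA : IsAtom G₀ A) : wt n A = n := by
  obtain ⟨F, hF, hs, hc⟩ := exists_strip_factorization hn hexp (G₀ := G₀) (B := A)
    fun g hg => hA.mem hg
  have := h F (Multiset.replicate n A) hF
    (fun C hC => (Multiset.eq_of_mem_replicate hC) ▸ hA) (by rw [hs, Multiset.sum_replicate])
  rwa [hc, Multiset.card_replicate] at this

theorem wt_sum_eq {F : Multiset (Multiset G)} (h : ∀ A ∈ F, wt n A = n) :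
    wt n F.sum = n * Multiset.card F := by
  induction F using Multiset.induction with
  | empty => simp
  | cons A F ih =>
    rw [Multiset.sum_cons, wt_add, h A (Multiset.mem_cons_self _ _),
      ih fun B hB => h B (Multiset.mem_cons_of_mem hB), Multiset.card_cons]
    ring

theorem mul_card_le_wt_sum {m : ℕ} {F : Multiset (Multiset G)} (h : ∀ A ∈ F, m ≤ wt n A) :
    m * Multiset.card F ≤ wt n F.sum := by
  have := le_map_sum (fun g : G => n / addOrderOf g) m F h
  simpa [mul_comm, wt] using this

include hn in
theorem halfFactorial_of_wt_eq {G₀ : Set G} (h : ∀ A, IsAtom G₀ A → wt n A = n) :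
    HalfFactorial G₀ := by
  intro F F' hF hF' hs
  have h1 := wt_sum_eq (n := n) fun A hA => h A (hF A hA)
  have h2 := wt_sum_eq (n := n) fun A hA => h A (hF' A hA)
  rw [hs, h2] at h1
  exact (Nat.eq_of_mul_eq_mul_left hn h1).symm

include hn hexp in
-- An atom with a single term is `{0}`, which weighs `n`; longer atoms weigh at least their length.
theorem IsAtom.two_le_wt {G₀ : Set G} {A : Multiset G} (hA : IsAtom G₀ A) (h : wt n A < n) :
    2 ≤ wt n A := by
  refine le_trans ?_ (card_le_wt hn hexp A)
  by_contra hc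
  have hc1 : Multiset.card A = 1 := by
    have := Multiset.card_pos.2 hA.ne_zero
    omega
  obtain ⟨g, rfl⟩ := Multiset.card_eq_one.1 hc1
  have hg : g = 0 := by simpa using hA.sum_eq
  rw [wt_singleton, hg, addOrderOf_zero, Nat.div_one] at h
  exact lt_irrefl _ h

/-! ### Cross number and elasticity -/

include hn hexp in
theorem real_weight_eq (S : Multiset G) :
    (S.map fun g => ((addOrderOf g : ℝ))⁻¹).sum = (wt n S : ℝ) / n := by
  induction S using Multiset.induction with
  | empty => simp
  | cons g S ih =>
    rw [Multiset.map_cons, Multiset.sum_cons, ih, ← Multiset.singleton_add, wt_add, wt_singleton]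
    have h1 : (addOrderOf g : ℝ) ≠ 0 := by exact_mod_cast (order_pos hn hexp g).ne'
    have h2 : (n : ℝ) ≠ 0 := by exact_mod_cast hn.ne'
    rw [Nat.cast_add, Nat.cast_div (order_dvd hexp g) h1]
    field_simp

include hn hexp in
theorem coe_seqCrossNumber (S : Multiset G) : (seqCrossNumber S : ℝ) = (wt n S : ℝ) / n := by
  rw [← real_weight_eq hn hexp]
  unfold seqCrossNumber
  induction S using Multiset.induction with
  | empty => simp
  | cons g S ih => simp [ih]

include hn hexp in
theorem seqCrossNumber_eq (S : Multiset G) :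
    (seqCrossNumber S : ℝ≥0∞) = (wt n S : ℝ≥0∞) / n := by
  have hn' : ((n : ℝ≥0)) ≠ 0 := by exact_mod_cast hn.ne'
  have h : seqCrossNumber S = (wt n S : ℝ≥0) / n := by
    apply NNReal.coe_injective
    rw [coe_seqCrossNumber hn hexp]
    simp
  rw [h, ENNReal.coe_div hn']
  simp

include hn hexp in
theorem seqCrossNumber_eq_ofReal (S : Multiset G) :
    (seqCrossNumber S : ℝ≥0∞) = ENNReal.ofReal ((wt n S : ℝ) / n) := by
  rw [← coe_seqCrossNumber hn hexp, ENNReal.ofReal_coe_nnreal]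

theorem le_crossNumber {G₀ : Set G} {A : Multiset G} (hA : IsAtom G₀ A) :
    (seqCrossNumber A : ℝ≥0∞) ≤ crossNumber G₀ :=
  le_iSup₂ (f := fun A (_ : IsAtom G₀ A) => (seqCrossNumber A : ℝ≥0∞)) A hA

include hn hexp in
theorem crossNumber_le_elasticity (G₀ : Set G) : crossNumber G₀ ≤ elasticity G₀ := by
  refine iSup₂_le fun A hA => ?_
  rw [seqCrossNumber_eq hn hexp]
  obtain ⟨F, hF, hs, hc⟩ := exists_strip_factorization hn hexp (G₀ := G₀) (B := A)
    fun g hg => hA.mem hg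
  have := le_elasticity (F := Multiset.replicate n A) (F' := F)
    (fun C hC => (Multiset.eq_of_mem_replicate hC) ▸ hA) hF
    (by rw [hs, Multiset.sum_replicate])
    (by
      intro h
      have := congrArg Multiset.card h
      rw [Multiset.card_replicate, Multiset.card_zero] at this
      exact hn.ne' this)
  rwa [hc, Multiset.card_replicate] at this

include hn hexp in
/-- Bounding the elasticity by `max (K(G₀)) c` with the help of a weight. -/
theorem elasticity_le_max {G₀ : Set G} (φ : G → ℝ) (c : ℝ) (hc : 1 ≤ c)
    (h1 : ∀ A, IsAtom G₀ A → 1 ≤ (A.map φ).sum)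
    (h2 : ∀ A, IsAtom G₀ A → (A.map φ).sum ≤ max c ((wt n A : ℝ) / n)) :
    elasticity G₀ ≤ max (ENNReal.ofReal c) (crossNumber G₀) := by
  by_cases hK : crossNumber G₀ = ⊤
  · rw [hK]; simp
  have hK' : crossNumber G₀ = ENNReal.ofReal (crossNumber G₀).toReal :=
    (ENNReal.ofReal_toReal hK).symm
  rw [hK', ← ENNReal.ofReal_max]
  refine elasticity_le_of_weight φ _ (hc.trans (le_max_left _ _)) h1 fun A hA => ?_
  refine (h2 A hA).trans (max_le_max le_rfl ?_)
  have := le_crossNumber hA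
  rw [seqCrossNumber_eq_ofReal hn hexp, ENNReal.ofReal_le_iff_le_toReal hK] at this
  exact this

include hn hexp in
-- Here `1 / ord` is itself an admissible weight: its sum over an atom is the cross number, at least
-- `1` by hypothesis.
theorem elasticity_eq_crossNumber {G₀ : Set G} (hne : G₀.Nonempty)
    (h : ∀ A, IsAtom G₀ A → n ≤ wt n A) : elasticity G₀ = crossNumber G₀ := by
  refine le_antisymm ?_ (crossNumber_le_elasticity hn hexp G₀)
  have hn' : (0 : ℝ) < n := by exact_mod_cast hn
  have h1 : ENNReal.ofReal 1 ≤ crossNumber G₀ := by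
    obtain ⟨g, hg⟩ := hne
    have := le_crossNumber (isAtom_strip hn hexp hg)
    rwa [seqCrossNumber_eq_ofReal hn hexp, wt_strip hn hexp, div_self hn'.ne'] at this
  refine (elasticity_le_max hn hexp (fun g => ((addOrderOf g : ℝ))⁻¹) 1 le_rfl ?_ ?_).trans
    (max_le h1 le_rfl)
  · intro A hA
    rw [real_weight_eq hn hexp, le_div_iff₀ hn', one_mul]
    exact_mod_cast h A hA
  · intro A hA
    rw [real_weight_eq hn hexp]
    exact le_max_right _ _

theorem nonempty_of_not_halfFactorial {G₀ : Set G} (h : ¬ HalfFactorial G₀) : G₀.Nonempty := by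
  by_contra hne
  rw [Set.not_nonempty_iff_eq_empty] at hne
  have hz : ∀ F : Multiset (Multiset G), (∀ A ∈ F, IsAtom G₀ A) → F = 0 := by
    intro F hF
    by_contra h0
    obtain ⟨A, hA⟩ := Multiset.exists_mem_of_ne_zero h0
    obtain ⟨g, hg⟩ := Multiset.exists_mem_of_ne_zero (hF A hA).ne_zero
    have := (hF A hA).mem hg
    simp [hne] at this
  exact h fun F F' hF hF' _ => by rw [hz F hF, hz F' hF']

include hn hexp in
theorem exists_wt_ne {G₀ : Set G} (h : ¬ HalfFactorial G₀) : ∃ A, IsAtom G₀ A ∧ wt n A ≠ n := by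
  by_contra hcon
  push Not at hcon
  exact h (halfFactorial_of_wt_eq hn hcon)

include hn hexp in
-- For a lighter atom, `n - wt n A` would be a positive multiple of `d` not exceeding `n - 2`.
theorem UniformLengths.le_wt {d : ℕ} {G₀ : Set G} (h : UniformLengths d G₀) (hd : n ≤ d + 1)
    {A : Multiset G} (hA : IsAtom G₀ A) : n ≤ wt n A := by
  by_contra hlt
  push Not at hlt
  have h2 := hA.two_le_wt hn hexp hlt
  have hdvd := h.dvd_wt_sub hn hexp hA
  rw [← dvd_neg, neg_sub] at hdvd
  have := Int.le_of_dvd (by omega) hdvd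
  omega

include hn hexp in
theorem rhoStar_eq_crossK {d : ℕ} (hd : n ≤ d + 1) : rhoStar G d = crossK G d := by
  have key : ∀ G₀ : Set G, Admissible d G₀ → elasticity G₀ = crossNumber G₀ := fun G₀ h =>
    elasticity_eq_crossNumber hn hexp (nonempty_of_not_halfFactorial h.not_halfFactorial)
      fun A hA => h.uniformLengths.le_wt hn hexp hd hA
  apply le_antisymm
  · exact rhoStar_le fun G₀ h => (key G₀ h).trans_le (le_crossK h)
  · exact crossK_le fun G₀ h => (key G₀ h).symm.trans_le (le_rhoStar h)

end exponent

/-! ### Differences in `Δ₁(G)` -/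

section deltaOne

variable [Finite G]

/-- There are zero-sum sequences containing every element of `S` arbitrarily often, with all
lengths congruent modulo `d`, and with arbitrarily large differences of lengths. -/
def Spread (d : ℕ) (S : Set G) : Prop :=
  ∀ N : ℕ, ∃ B : Multiset G,
    (∃ F F' : Multiset (Multiset G), (∀ A ∈ F, IsAtom Set.univ A) ∧
      (∀ A ∈ F', IsAtom Set.univ A) ∧ F.sum = B ∧ F'.sum = B ∧
      Multiset.card F + N ≤ Multiset.card F') ∧
    (∀ F F' : Multiset (Multiset G), (∀ A ∈ F, IsAtom Set.univ A) →
      (∀ A ∈ F', IsAtom Set.univ A) → F.sum = B → F'.sum = B →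
      (d : ℤ) ∣ (Multiset.card F : ℤ) - Multiset.card F') ∧
    ∀ g ∈ S, Multiset.replicate N g ≤ B

theorem spread_empty {d : ℕ} (hd : d ∈ DeltaOne G) : Spread d (∅ : Set G) := by
  intro N
  obtain ⟨hd0, h⟩ := hd
  obtain ⟨L, ⟨B, hB, rfl⟩, l, M, hl, y, L', L'', hL', hL'', hL, hdvd⟩ := h N
  have hmem : ∀ j : ℕ, j ≤ l → ∃ F : Multiset (Multiset G), (∀ A ∈ F, IsAtom Set.univ A) ∧
      F.sum = B ∧ (Multiset.card F : ℤ) = y + j * d := by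
    intro j hj
    have : y + (j : ℤ) * d ∈ (fun m : ℕ => (m : ℤ)) '' lengthSet Set.univ B := by
      rw [hL]
      exact ⟨_, Or.inl (Or.inr ⟨j, hj, rfl⟩), rfl⟩
    obtain ⟨k, ⟨F, hF, hFs, rfl⟩, hk⟩ := this
    exact ⟨F, hF, hFs, hk⟩
  refine ⟨B, ?_, ?_, by simp⟩
  · obtain ⟨F, hF, hFs, hFc⟩ := hmem 0 (Nat.zero_le _)
    obtain ⟨F', hF', hFs', hFc'⟩ := hmem l le_rfl
    refine ⟨F, F', hF, hF', hFs, hFs', ?_⟩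
    have : (N : ℤ) ≤ l * d := by
      have : N ≤ l * d := hl.trans (Nat.le_mul_of_pos_right _ hd0)
      exact_mod_cast this
    push_cast at hFc
    have : (Multiset.card F : ℤ) + N ≤ Multiset.card F' := by linarith
    exact_mod_cast this
  · intro F F' hF hF' hs hs'
    have h1 := hdvd (Multiset.card F) ⟨_, ⟨F, hF, hs, rfl⟩, rfl⟩
    have h2 := hdvd (Multiset.card F') ⟨_, ⟨F', hF', hs', rfl⟩, rfl⟩
    have := dvd_sub h1 h2
    simpa using this

/-- A sequence over `S` divides one of the long sequences `B`. Completing two of its factorizations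
by the same factorization of the cofactor gives two factorizations of `B`. -/
theorem Spread.uniformLengths {d : ℕ} {S : Set G} (h : Spread d S) : UniformLengths d S := by
  classical
  intro F F' hF hF' hs
  obtain ⟨B, ⟨E, -, hE, -, hEs, -⟩, hB, hle⟩ := h (Multiset.card F.sum)
  have hFB : F.sum ≤ B := by
    rw [Multiset.le_iff_count]
    intro g
    by_cases hg : g ∈ F.sum
    · have := Multiset.le_count_iff_replicate_le.2 (hle g ((isZeroSumSeq_sum hF).1 g hg))
      exact (Multiset.count_le_card _ _).trans this
    · rw [Multiset.count_eq_zero_of_notMem hg]; exact Nat.zero_le _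
  have huniv : ∀ {F : Multiset (Multiset G)}, (∀ A ∈ F, IsAtom S A) →
      ∀ A ∈ F, IsAtom Set.univ A := fun h A hA => (h A hA).of_mem fun _ _ => Set.mem_univ _
  have hBz : B.sum = 0 := by rw [← hEs]; exact (isZeroSumSeq_sum hE).2
  obtain ⟨D, hD, hDs⟩ := exists_factorization (G₀ := Set.univ) (B := B - F.sum)
    ⟨fun _ _ => Set.mem_univ _, by
      rw [sum_sub_eq hFB, hBz, (isZeroSumSeq_sum hF).2, sub_zero]⟩
  have := hB (F + D) (F' + D) (forall_mem_add (huniv hF) hD) (forall_mem_add (huniv hF') hD)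
    (by rw [Multiset.sum_add, hDs, add_tsub_cancel_of_le hFB])
    (by rw [Multiset.sum_add, hDs, ← hs, add_tsub_cancel_of_le hFB])
  simpa using this

theorem map_sum_eq_sum_count [DecidableEq G] [Fintype G] (φ : G → ℕ) (B : Multiset G) :
    (B.map φ).sum = ∑ g : G, B.count g * φ g := by
  rw [Finset.sum_multiset_map_count]
  simp only [smul_eq_mul]
  refine Finset.sum_subset (Finset.subset_univ _) fun g _ hg => ?_
  rw [Multiset.mem_toFinset] at hg
  rw [Multiset.count_eq_zero_of_notMem hg, zero_mul]

theorem IsAtom.card_le [Fintype G] {n : ℕ} (hn : 0 < n) (hexp : ∀ x : G, n • x = 0)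
    {G₀ : Set G} {A : Multiset G} (hA : IsAtom G₀ A) :
    Multiset.card A ≤ Fintype.card G * n := by
  classical
  have h := map_sum_eq_sum_count (fun _ : G => 1) A
  simp only [Multiset.map_const', Multiset.sum_replicate, smul_eq_mul, mul_one] at h
  rw [h, ← smul_eq_mul, ← Finset.card_univ]
  exact Finset.sum_le_card_nsmul _ _ _ fun g _ =>
    (hA.count_le hn hexp g).trans (order_le hn hexp g)

/-- A maximal `S` with `Spread d S` works. Maximality bounds the multiplicities of elements outside
`S` in the relevant sequences; were `S` half-factorial, all but boundedly many atoms of a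
factorization would weigh `n`, which confines the lengths to an interval of bounded size. -/
theorem exists_admissible_of_mem_deltaOne {d : ℕ} (hd : d ∈ DeltaOne G) :
    ∃ G₀ : Set G, Admissible d G₀ := by
  classical
  have := Fintype.ofFinite G
  obtain ⟨S, hS⟩ := (Set.toFinite {S : Set G | Spread d S}).exists_maximal ⟨∅, spread_empty hd⟩
  have hSS : Spread d S := hS.prop
  refine ⟨S, admissible_of_uniformLengths hSS.uniformLengths fun hHF => ?_⟩
  have hmax : ∀ g : G, g ∉ S → ∃ N : ℕ, ∀ B : Multiset G,
      (∃ F F' : Multiset (Multiset G), (∀ A ∈ F, IsAtom Set.univ A) ∧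
        (∀ A ∈ F', IsAtom Set.univ A) ∧ F.sum = B ∧ F'.sum = B ∧
        Multiset.card F + N ≤ Multiset.card F') →
      (∀ F F' : Multiset (Multiset G), (∀ A ∈ F, IsAtom Set.univ A) →
        (∀ A ∈ F', IsAtom Set.univ A) → F.sum = B → F'.sum = B →
        (d : ℤ) ∣ (Multiset.card F : ℤ) - Multiset.card F') →
      ¬ ∀ h ∈ insert g S, Multiset.replicate N h ≤ B := by
    intro g hg
    by_contra hcon
    push Not at hcon
    have : Spread d (insert g S) := by
      intro N
      obtain ⟨B, h1, h2, h3⟩ := hcon N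
      exact ⟨B, h1, h2, h3⟩
    exact hg (hS.le_of_ge this (Set.subset_insert g S) (Set.mem_insert g S))
  choose! N hN using hmax
  set N₀ := Finset.univ.sup N with hN₀
  set n := Fintype.card G with hn
  have hn0 : 0 < n := Fintype.card_pos
  have hexp : ∀ x : G, n • x = 0 := fun x => card_nsmul_eq_zero
  set c := n * N₀ with hc
  set D := n * n with hD
  -- At most `c` terms of `B` will lie outside `S`, and `n * D` bounds the weight of an atom; so `c
  -- + c * D` is the largest spread of lengths that half-factoriality of `S` would allow.
  obtain ⟨B, ⟨F, F', hF, hF', hFs, hFs', hcard⟩, hB, hle⟩ := hSS (max N₀ (c + c * D + 1))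
  have hrep : ∀ {m : ℕ} {g : G}, m ≤ max N₀ (c + c * D + 1) → g ∈ S →
      Multiset.replicate m g ≤ B := fun hm hg =>
    ((Multiset.replicate_le_replicate _).2 hm).trans (hle _ hg)
  have hcount : ∀ g, g ∉ S → B.count g ≤ N₀ := by
    intro g hg
    by_contra hcon
    push Not at hcon
    have hNg : N g ≤ N₀ := Finset.le_sup (f := N) (Finset.mem_univ g)
    refine hN g hg B ⟨F, F', hF, hF', hFs, hFs', ?_⟩ hB ?_
    · have := le_max_left N₀ (c + c * D + 1)
      omega
    · intro h hh
      rcases Set.mem_insert_iff.1 hh with rfl | hh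
      · exact Multiset.le_count_iff_replicate_le.1 (hNg.trans hcon.le)
      · exact hrep (hNg.trans (le_max_left _ _)) hh
  have hbound : ∀ E : Multiset (Multiset G), (∀ A ∈ E, IsAtom Set.univ A) → E.sum = B →
      n * Multiset.card E ≤ wt n B + n * c ∧ wt n B ≤ n * Multiset.card E + n * (c * D) := by
    intro E hE hEs
    set E₁ := E.filter fun A => ∀ g ∈ A, g ∈ S
    set E₂ := E.filter fun A => ¬ ∀ g ∈ A, g ∈ S
    have hE12 : E₁ + E₂ = E := Multiset.filter_add_not _ _
    have hE₁ : ∀ A ∈ E₁, wt n A = n := by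
      intro A hA
      obtain ⟨h1, h2⟩ := Multiset.mem_filter.1 hA
      exact hHF.wt_eq hn0 hexp ((hE A h1).of_mem h2)
    have hw1 := wt_sum_eq hE₁
    have hwB : wt n B = wt n E₁.sum + wt n E₂.sum := by
      rw [← hEs, ← hE12, Multiset.sum_add, wt_add]
    have hcE : Multiset.card E = Multiset.card E₁ + Multiset.card E₂ := by
      rw [← hE12, Multiset.card_add]
    -- Each atom of `E₂` uses up at least one term outside `S`.
    have hE₂c : Multiset.card E₂ ≤ c := by
      have h1 := le_map_sum (fun g : G => if g ∈ S then 0 else 1) 1 E₂ (by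
        intro A hA
        obtain ⟨h1, h2⟩ := Multiset.mem_filter.1 hA
        push Not at h2
        obtain ⟨g, hg, hgS⟩ := h2
        have : (if g ∈ S then 0 else 1) ≤ (A.map fun g : G => if g ∈ S then 0 else 1).sum :=
          Multiset.single_le_sum (fun _ _ => Nat.zero_le _) _ (Multiset.mem_map_of_mem _ hg)
        rwa [if_neg hgS] at this)
      have h2 : (E₂.sum.map fun g : G => if g ∈ S then 0 else 1).sum ≤
          (B.map fun g : G => if g ∈ S then 0 else 1).sum := by
        rw [← hEs, ← hE12, Multiset.sum_add, Multiset.map_add, Multiset.sum_add]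
        exact Nat.le_add_left _ _
      have h3 : (B.map fun g : G => if g ∈ S then 0 else 1).sum ≤ c := by
        rw [map_sum_eq_sum_count, hc, hn, ← smul_eq_mul, ← Finset.card_univ]
        refine Finset.sum_le_card_nsmul _ _ _ fun g _ => ?_
        split_ifs with hg
        · simp
        · simpa using hcount g hg
      simp only [smul_eq_mul, mul_one] at h1
      exact h1.trans (h2.trans h3)
    have hw2 : wt n E₂.sum ≤ n * (c * D) := by
      have := map_sum_le (fun g : G => n / addOrderOf g) (n * D) E₂ (by
        intro A hA
        exact (wt_le_mul_card A).trans (Nat.mul_le_mul_left _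
          ((hE A (Multiset.mem_filter.1 hA).1).card_le hn0 hexp)))
      rw [smul_eq_mul] at this
      calc wt n E₂.sum ≤ Multiset.card E₂ * (n * D) := this
        _ ≤ c * (n * D) := Nat.mul_le_mul_right _ hE₂c
        _ = _ := by ring
    have : n * Multiset.card E₂ ≤ n * c := Nat.mul_le_mul_left _ hE₂c
    rw [hcE, Nat.mul_add]
    omega
  have h1 := (hbound F hF hFs).2
  have h2 := (hbound F' hF' hFs').1
  have h3 : n * (Multiset.card F + (c + c * D + 1)) ≤ n * Multiset.card F' :=
    Nat.mul_le_mul_left _ (le_trans (Nat.add_le_add_left (le_max_right _ _) _) hcard)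
  simp only [Nat.mul_add] at h3
  omega

end deltaOne

/-! ### Atoms of small and of large cross number -/

/-- The product of the atoms `g ^ ord(g)` with `g ∈ S`. -/
noncomputable def strips (S : Finset G) : Multiset G := (S.val.map strip).sum

theorem count_strips [DecidableEq G] (S : Finset G) (x : G) :
    (strips S).count x = if x ∈ S then addOrderOf x else 0 := by
  classical
  have h : strips S = ∑ g ∈ S, strip g := rfl
  rw [h, Multiset.count_sum']
  simp only [strip, Multiset.count_replicate]
  simp

theorem mem_of_mem_strips [DecidableEq G] {S : Finset G} {x : G} (h : x ∈ strips S) : x ∈ S := by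
  by_contra hx
  have := count_strips S x
  rw [if_neg hx, Multiset.count_eq_zero] at this
  exact this h

theorem sum_strips (S : Finset G) : (strips S).sum = 0 := by
  classical
  induction S using Finset.induction_on with
  | empty => simp [strips]
  | insert a s ha ih =>
    have : strips (insert a s) = strip a + strips s := by
      simp [strips, Finset.insert_val_of_notMem ha]
    rw [this, Multiset.sum_add, ih, strip, Multiset.sum_replicate, addOrderOf_nsmul_eq_zero,
      add_zero]

section exponent

variable {n : ℕ} (hn : 0 < n) (hexp : ∀ x : G, n • x = 0)

include hn hexp in
theorem isAtom_of_mem_map_strip {G₀ : Set G} {S : Finset G} (hS : ∀ g ∈ S, g ∈ G₀) :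
    ∀ A ∈ S.val.map strip, IsAtom G₀ A := by
  intro A hA
  obtain ⟨g, hg, rfl⟩ := Multiset.mem_map.1 hA
  exact isAtom_strip hn hexp (hS g hg)

include hn hexp in
theorem wt_strips (S : Finset G) : wt n (strips S) = n * S.card := by
  rw [strips, wt_sum_eq, Multiset.card_map, Finset.card_def]
  intro A hA
  obtain ⟨g, hg, rfl⟩ := Multiset.mem_map.1 hA
  exact wt_strip hn hexp g

variable {d : ℕ} (hd : n ≤ 2 * d + 1) {G₀ : Set G} (hU : UniformLengths d G₀)

include hn hexp hd hU in
-- The deficit `n - wt n U` is a positive multiple of `d` and at most `n - 2 < 2 * d`, so it equals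
-- `d`.
theorem wt_eq_of_wt_lt {U : Multiset G} (hA : IsAtom G₀ U) (hlt : wt n U < n) :
    wt n U + d = n := by
  have h2 := hA.two_le_wt hn hexp hlt
  obtain ⟨c, hc⟩ := hU.dvd_wt_sub hn hexp hA
  have hc0 : c < 0 := by
    by_contra hcon
    push Not at hcon
    have : 0 ≤ (d : ℤ) * c := by positivity
    omega
  rcases eq_or_lt_of_le (Int.le_sub_one_of_lt hc0) with h | h
  · rw [h] at hc
    omega
  · have : (d : ℤ) * c ≤ d * (-2) := mul_le_mul_of_nonneg_left (by omega) (by positivity)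
    omega

include hn hexp hd hU in
theorem sub_le_wt {U : Multiset G} (hA : IsAtom G₀ U) : n ≤ wt n U + d := by
  by_cases h : wt n U < n
  · exact (wt_eq_of_wt_lt hn hexp hd hU hA h).ge
  · omega

include hn hexp hd hU in
/-- Atoms of cross number less than one are squarefree, and their terms have maximal order. -/
theorem count_eq_one_of_wt_lt [DecidableEq G] {U : Multiset G} (hA : IsAtom G₀ U)
    (hlt : wt n U < n) {g : G} (hg : g ∈ U) : U.count g = 1 ∧ addOrderOf g = n := by
  classical
  have hw := wt_eq_of_wt_lt hn hexp hd hU hA hlt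
  have hw2 := hA.two_le_wt hn hexp hlt
  have hex : ∃ t : ℕ, ∃ g ∈ U, addOrderOf g ≤ t * U.count g := by
    refine ⟨n, g, hg, (order_le hn hexp g).trans ?_⟩
    exact Nat.le_mul_of_pos_right _ (Multiset.count_pos.2 hg)
  -- Let `t` be the least exponent for which `t • U` contains some `strip x`. Splitting off all
  -- these `strip x` gives a second factorization of `t • U`, to be compared with `t` copies of `U`.
  obtain ⟨t, ht, htmin⟩ : ∃ t : ℕ, (∃ g ∈ U, addOrderOf g ≤ t * U.count g) ∧
      ∀ s < t, ∀ g ∈ U, s * U.count g < addOrderOf g := by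
    refine ⟨Nat.find hex, Nat.find_spec hex, fun s hs g hg => ?_⟩
    have := Nat.find_min hex hs
    push Not at this
    exact this g hg
  set J := U.toFinset.filter fun x => addOrderOf x ≤ t * U.count x with hJ
  have hJne : 0 < J.card := by
    obtain ⟨x, hx, hxt⟩ := ht
    exact Finset.card_pos.2 ⟨x, Finset.mem_filter.2 ⟨Multiset.mem_toFinset.2 hx, hxt⟩⟩
  have hJU : ∀ x ∈ J, x ∈ G₀ := fun x hx =>
    hA.mem (Multiset.mem_toFinset.1 (Finset.mem_filter.1 hx).1)
  have hle : strips J ≤ t • U := by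
    rw [Multiset.le_iff_count]
    intro x
    rw [count_strips, Multiset.count_nsmul]
    split_ifs with hx
    · exact (Finset.mem_filter.1 hx).2
    · exact Nat.zero_le _
  have hz : IsZeroSumSeq G₀ (t • U) :=
    ⟨fun x hx => hA.mem (Multiset.mem_of_mem_nsmul hx), by
      rw [Multiset.sum_nsmul, hA.sum_eq, nsmul_zero]⟩
  obtain ⟨F, hF, hFs⟩ := exists_factorization (hz.sub (sum_strips J) hle)
  have hdvd := hU (Multiset.replicate t U) (J.val.map strip + F)
    (fun C hC => (Multiset.eq_of_mem_replicate hC) ▸ hA)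
    (forall_mem_add (isAtom_of_mem_map_strip hn hexp hJU) hF) (by
      rw [Multiset.sum_replicate, Multiset.sum_add, hFs]
      exact (add_tsub_cancel_of_le hle).symm)
  rw [Multiset.card_replicate, Multiset.card_add, Multiset.card_map, ← Finset.card_def] at hdvd
  have hwt : t * wt n U = n * J.card + wt n F.sum := by
    rw [hFs, ← wt_strips hn hexp, ← wt_add, add_tsub_cancel_of_le hle, wt_nsmul]
  have hFw : wt n U * Multiset.card F ≤ wt n F.sum :=
    mul_card_le_wt_sum fun A hA' => by
      have := sub_le_wt hn hexp hd hU (hF A hA')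
      omega
  -- No atom is lighter than `U` while each split-off atom weighs `n > wt n U`, so the new
  -- factorization is shorter, hence shorter by at least `d`. It has at least two atoms unless
  -- nothing remains after splitting; in that case `t` is a multiple of `n`.
  have htd : d + 2 ≤ t := by
    obtain ⟨c, hc⟩ := hdvd
    set f := Multiset.card F
    set w := wt n U
    have hc1 : 0 < c := by
      by_contra hcon
      push Not at hcon
      have h1 : (d : ℤ) * c ≤ 0 := mul_nonpos_of_nonneg_of_nonpos (by positivity) hcon
      have h2 : t ≤ J.card + f := by
        have : (t : ℤ) ≤ J.card + f := by push_cast at hc; linarith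
        exact_mod_cast this
      have h3 : t * w ≤ (J.card + f) * w := Nat.mul_le_mul_right _ h2
      have h4 : J.card * w < J.card * n := Nat.mul_lt_mul_of_pos_left hlt hJne
      nlinarith
    have hdc : (d : ℤ) ≤ d * c := le_mul_of_one_le_right (by positivity) hc1
    push_cast at hc
    rcases Nat.eq_zero_or_pos f with hf | hf
    · have hF0 : F = 0 := Multiset.card_eq_zero.1 hf
      rw [hF0, Multiset.sum_zero, wt_zero, add_zero] at hwt
      have hd0 : 0 < (d : ℤ) := by omega
      have e1 : (t : ℤ) * w = n * J.card := by exact_mod_cast hwt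
      have e2 : (w : ℤ) + d = n := by exact_mod_cast hw
      have e3 : (t : ℤ) = J.card + d * c := by rw [hf] at hc; push_cast at hc; linarith
      have e4 : (d : ℤ) * (c * w) = d * J.card := by
        rw [e3] at e1
        linear_combination e1 - (J.card : ℤ) * e2
      have e5 : c * w = J.card := mul_left_cancel₀ hd0.ne' e4
      have e6 : (t : ℤ) = c * n := by rw [e3, ← e5, ← e2]; ring
      have : (n : ℤ) ≤ c * n := le_mul_of_one_le_left (by positivity) hc1
      omega
    · omega
  -- Minimality at `t - 1 ≥ d + 1` gives `(d + 1) * U.count g < addOrderOf g ≤ 2 * d + 1`. This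
  -- forces multiplicity one and an order exceeding `n / 2`, thus equal to `n`.
  have hg1 := htmin (t - 1) (by omega) g hg
  have hgo := order_le hn hexp g
  have hgc : 1 ≤ U.count g := Multiset.count_pos.2 hg
  have h3 : (d + 1) * U.count g < 2 * d + 2 := by
    have : (d + 1) * U.count g ≤ (t - 1) * U.count g := Nat.mul_le_mul_right _ (by omega)
    omega
  have h4 : U.count g = 1 := by
    by_contra hne
    have : (d + 1) * 2 ≤ (d + 1) * U.count g := Nat.mul_le_mul_left _ (by omega)
    omega
  refine ⟨h4, ?_⟩
  rw [h4] at hg1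
  obtain ⟨m, hm⟩ := order_dvd hexp g
  have hm1 : m = 1 := by
    rcases Nat.lt_or_ge m 2 with h | h
    · interval_cases m
      · omega
      · rfl
    · have : addOrderOf g * 2 ≤ addOrderOf g * m := Nat.mul_le_mul_left _ h
      omega
  rw [hm1, mul_one] at hm
  exact hm.symm

include hn hexp hd hU in
-- A lighter atom supported in `A` would be squarefree, hence a subsequence of `A`, hence `A`
-- itself, which is heavy.
theorem le_wt_of_subset_support {A V : Multiset G} (hA : IsAtom G₀ A) (hbad : n < wt n A)
    (hV : IsAtom G₀ V) (hVA : ∀ x ∈ V, x ∈ A) : n ≤ wt n V := by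
  classical
  by_contra hlt
  push Not at hlt
  have hle : V ≤ A := by
    rw [Multiset.le_iff_count]
    intro x
    by_cases hx : x ∈ V
    · rw [(count_eq_one_of_wt_lt hn hexp hd hU hV hlt hx).1]
      exact Multiset.count_pos.2 (hVA x hx)
    · rw [Multiset.count_eq_zero_of_notMem hx]; exact Nat.zero_le _
  have := hA.eq_of_le hle hV.ne_zero hV.sum_eq
  rw [this] at hlt
  omega

include hn hexp in
theorem IsAtom.count_lt [DecidableEq G] {A : Multiset G} (hA : IsAtom G₀ A) (hne : wt n A ≠ n)
    (g : G) : A.count g < addOrderOf g := by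
  by_contra h
  push Not at h
  apply hne
  rw [hA.eq_strip hn hexp h, wt_strip hn hexp]

include hn hexp in
theorem IsAtom.le_strips [DecidableEq G] {A : Multiset G} (hA : IsAtom G₀ A) :
    A ≤ strips A.toFinset := by
  rw [Multiset.le_iff_count]
  intro x
  rw [count_strips]
  split_ifs with hx
  · exact hA.count_le hn hexp x
  · rw [Multiset.mem_toFinset] at hx
    rw [Multiset.count_eq_zero_of_notMem hx]

include hn hexp hd hU in
/-- An atom of cross number larger than one has large support. -/
theorem card_support_of_lt_wt [DecidableEq G] {A : Multiset G} (hA : IsAtom G₀ A)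
    (hbad : n < wt n A) : d + 2 ≤ A.toFinset.card ∧
      (A.toFinset.card = d + 2 → IsAtom G₀ (strips A.toFinset - A)) := by
  have hle := hA.le_strips hn hexp
  set S := A.toFinset with hS
  set A' := strips S - A with hA'
  have hAA : A + A' = strips S := add_tsub_cancel_of_le hle
  have hz : IsZeroSumSeq G₀ A' := by
    refine ⟨fun x hx => ?_, by rw [hA', sum_sub_eq hle, sum_strips, hA.sum_eq, sub_zero]⟩
    have := mem_of_mem_strips (Multiset.mem_of_le (Multiset.sub_le_self _ _) hx)
    exact hA.mem (Multiset.mem_toFinset.1 this)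
  have hA'0 : A' ≠ 0 := by
    obtain ⟨x, hx⟩ := Multiset.exists_mem_of_ne_zero hA.ne_zero
    intro h0
    have h1 := congrArg (Multiset.count x) hAA
    rw [h0, add_zero, count_strips, if_pos (Multiset.mem_toFinset.2 hx)] at h1
    exact (hA.count_lt hn hexp hbad.ne' x).ne h1
  -- The sequence `strips S` has the factorizations into `S.card` strips and into `A` followed by
  -- `F`. By weight the second is strictly shorter, so it is shorter by at least `d`.
  have key : ∀ F : Multiset (Multiset G), (∀ V ∈ F, IsAtom G₀ V) → F.sum = A' →
      d + 1 + Multiset.card F ≤ S.card := by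
    intro F hF hFs
    have h1 : n * Multiset.card F ≤ wt n F.sum := by
      refine mul_card_le_wt_sum fun V hV => ?_
      refine le_wt_of_subset_support hn hexp hd hU hA hbad (hF V hV) fun x hx => ?_
      have hx' : x ∈ A' := hFs ▸ Multiset.mem_of_le (mem_sum_of_mem hV) hx
      have := mem_of_mem_strips (Multiset.mem_of_le (Multiset.sub_le_self _ _) hx')
      exact Multiset.mem_toFinset.1 this
    have h2 : wt n A + wt n A' = n * S.card := by rw [← wt_add, hAA, wt_strips hn hexp]
    rw [hFs] at h1
    have h3 : Multiset.card F + 1 < S.card := by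
      have : n * (Multiset.card F + 1) < n * S.card := by rw [Nat.mul_add]; omega
      exact Nat.lt_of_mul_lt_mul_left this
    have h4 := hU (S.val.map strip) (A ::ₘ F)
      (isAtom_of_mem_map_strip hn hexp fun x hx => hA.mem (Multiset.mem_toFinset.1 hx))
      (by
        intro C hC
        rcases Multiset.mem_cons.1 hC with rfl | hC
        exacts [hA, hF C hC])
      (by rw [Multiset.sum_cons, hFs, hAA, strips])
    rw [Multiset.card_map, Multiset.card_cons, ← Finset.card_def] at h4
    have := Int.le_of_dvd (by push_cast; omega) h4
    push_cast at this
    omega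
  obtain ⟨F, hF, hFs⟩ := exists_factorization hz
  have hk := key F hF hFs
  have hF0 : 0 < Multiset.card F := by
    rw [Multiset.card_pos]
    rintro rfl
    exact hA'0 (by rw [← hFs, Multiset.sum_zero])
  refine ⟨by omega, fun hc => ?_⟩
  have hF1 : Multiset.card F = 1 := by omega
  obtain ⟨V, rfl⟩ := Multiset.card_eq_one.1 hF1
  rw [Multiset.sum_singleton] at hFs
  rw [← hFs]
  exact hF V (Multiset.mem_singleton_self V)

end exponent

/-! ### Integral relations in groups with few generators -/

/-- More than `r` lifts to `ℤ^r` are linearly dependent. Since `ℤ^r` is torsion-free, a relation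
among the lifts may be divided by the gcd of its coefficients before it is mapped to `G`. -/
theorem exists_primitive_relation {ι : Type*} [Fintype ι] (x : ι → G) {r : ℕ}
    {f : (Fin r → ℤ) →+ G} (hf : Function.Surjective f) (hr : r < Fintype.card ι) :
    ∃ w : ι → ℤ, (∀ a : ℤ, (∀ i, a ∣ w i) → IsUnit a) ∧ ∑ i, w i • x i = 0 := by
  classical
  choose v hv using fun i => hf (x i)
  have hnl : ¬ LinearIndependent ℤ v := by
    intro h
    have := h.fintype_card_le_finrank
    rw [Module.finrank_fin_fun] at this
    omega
  obtain ⟨u, hu, i, hi⟩ := Fintype.not_linearIndependent_iff.1 hnl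
  obtain ⟨w, hw, hw1⟩ := Finset.extract_gcd (s := Finset.univ) u ⟨i, Finset.mem_univ i⟩
  have hg : Finset.univ.gcd u ≠ 0 := by
    intro h0
    exact hi (Finset.gcd_eq_zero_iff.1 h0 i (Finset.mem_univ i))
  refine ⟨w, fun a ha => ?_, ?_⟩
  · have : a ∣ Finset.univ.gcd w := Finset.dvd_gcd fun i _ => ha i
    rw [hw1] at this
    exact isUnit_of_dvd_one this
  · have h1 : Finset.univ.gcd u • ∑ i, w i • v i = 0 := by
      rw [Finset.smul_sum, ← hu]
      refine Finset.sum_congr rfl fun i hi => ?_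
      rw [hw i hi, smul_smul]
    have h2 := (smul_eq_zero.1 h1).resolve_left hg
    have h3 := congrArg f h2
    rw [map_sum, map_zero] at h3
    rw [← h3]
    refine Finset.sum_congr rfl fun i _ => ?_
    rw [map_zsmul, hv]

/-- Integral vectors are generated by those with a vanishing coordinate, given a suitable
vector with a vanishing coordinate. -/
theorem le_of_primitive {S : Finset G} {D R : AddSubgroup (G → ℤ)} {m : ℤ} {i₀ : G}
    {w : G → ℤ} (hD : ∀ z ∈ R, ∀ h ∈ S, z h = 0 → z ∈ D) (hw : w ∈ R) (hi₀ : i₀ ∈ S)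
    (hw0 : w i₀ = 0) (hm : ∀ z ∈ R, m • z ∈ D)
    (hu : ∀ a : ℤ, (∀ h ∈ S, a ∣ w h) → a ∣ m → IsUnit a) : R ≤ D := by
  intro z hz
  let φ : ℤ →+ (G → ℤ) :=
    { toFun := fun c => c • z, map_zero' := zero_smul _ _, map_add' := fun a b => add_smul a b z }
  -- The integers `c` with `c • z ∈ D` form an ideal `aℤ`. For each `h ∈ S` the vector `w h • z - z
  -- h • w` vanishes at `h`, so `a` divides every `w h`; primitivity then makes `a` a unit.
  obtain ⟨a, ha⟩ := Int.subgroup_cyclic (D.comap φ)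
  have hmem : ∀ c : ℤ, c • z ∈ D ↔ a ∣ c := by
    intro c
    have : c • z ∈ D ↔ c ∈ D.comap φ := Iff.rfl
    rw [this, ha, ← AddSubgroup.zmultiples_eq_closure, Int.mem_zmultiples_iff]
  have hwD : w ∈ D := hD w hw i₀ hi₀ hw0
  have h1 : ∀ h ∈ S, a ∣ w h := by
    intro h hh
    rw [← hmem]
    have h2 : w h • z - z h • w ∈ D := by
      refine hD _ (R.sub_mem (R.zsmul_mem hz _) (R.zsmul_mem hw _)) h hh ?_
      simp only [Pi.sub_apply, Pi.smul_apply, smul_eq_mul]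
      ring
    have h3 := D.add_mem h2 (D.zsmul_mem hwD (z h))
    rwa [sub_add_cancel] at h3
  have h2 := hu a h1 ((hmem m).1 (hm z hz))
  have h3 := (hmem 1).2 h2.dvd
  rwa [one_smul] at h3

/-! ### Sequences with prescribed multiplicities -/

section counts

variable [Fintype G] [DecidableEq G]

/-- The sequence in which `x` has multiplicity `k x`. -/
def ofCounts (k : G → ℕ) : Multiset G := ∑ x, Multiset.replicate (k x) x

@[simp] theorem count_ofCounts (k : G → ℕ) (x : G) : (ofCounts k).count x = k x := by
  simp [ofCounts, Multiset.count_sum', Multiset.count_replicate]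

theorem sum_eq_sum_count (B : Multiset G) : B.sum = ∑ x, B.count x • x := by
  rw [Finset.sum_multiset_count]
  refine Finset.sum_subset (Finset.subset_univ _) fun x _ hx => ?_
  rw [Multiset.mem_toFinset] at hx
  rw [Multiset.count_eq_zero_of_notMem hx, zero_smul]

theorem sum_ofCounts (k : G → ℕ) : (ofCounts k).sum = ∑ x, k x • x := by
  rw [sum_eq_sum_count]; simp

/-- Adding powers `g ^ ord(g)` turns integral relations into zero-sum sequences. -/
theorem exists_shift {n : ℕ} (hn : 0 < n) (hexp : ∀ x : G, n • x = 0) (T : Finset G)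
    (z : G → ℤ) (hz : ∀ x ∉ T, z x = 0) :
    ∃ (N : ℕ) (B : Multiset G), (∀ x, (B.count x : ℤ) = z x + (N • strips T).count x) ∧
      (∀ x ∈ B, x ∈ T) ∧ B.sum = ∑ x, z x • x := by
  set N := ∑ x, (z x).natAbs with hN
  have hcount : ∀ x, (((z x + (N • strips T).count x).toNat : ℕ) : ℤ) =
      z x + (N • strips T).count x := by
    intro x
    rw [Int.toNat_of_nonneg]
    rw [Multiset.count_nsmul, count_strips]
    split_ifs with hx
    · have h1 : (z x).natAbs ≤ N :=
        Finset.single_le_sum (f := fun x => (z x).natAbs) (fun _ _ => Nat.zero_le _)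
          (Finset.mem_univ x)
      have h2 : N ≤ N * addOrderOf x := Nat.le_mul_of_pos_right _ (order_pos hn hexp x)
      have h3 : ((z x).natAbs : ℤ) ≤ ((N * addOrderOf x : ℕ) : ℤ) := by exact_mod_cast h1.trans h2
      have h4 : -((z x).natAbs : ℤ) ≤ z x := by omega
      linarith
    · simp [hz x hx]
  refine ⟨N, ofCounts fun x => (z x + (N • strips T).count x).toNat, ?_, ?_, ?_⟩
  · intro x
    rw [count_ofCounts, hcount]
  · intro x hx
    by_contra hxT
    rw [← Multiset.count_pos, count_ofCounts, hz x hxT, Multiset.count_nsmul, count_strips,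
      if_neg hxT] at hx
    simp at hx
  · rw [sum_ofCounts]
    have : ∀ x : G, (z x + (N • strips T).count x).toNat • x = z x • x +
        (N • strips T).count x • x := by
      intro x
      rw [← natCast_zsmul, hcount, add_smul, natCast_zsmul]
    rw [Finset.sum_congr rfl fun x _ => this x, Finset.sum_add_distrib, ← sum_eq_sum_count,
      Multiset.sum_nsmul, sum_strips, nsmul_zero, add_zero]

end counts

theorem card_mul_le_count_sum [DecidableEq G] {x : G} {k : ℕ} (F : Multiset (Multiset G))
    (h : ∀ V ∈ F, k ≤ V.count x) : Multiset.card F * k ≤ F.sum.count x := by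
  induction F using Multiset.induction with
  | empty => simp
  | cons A F ih =>
    have h1 := h A (Multiset.mem_cons_self _ _)
    have h2 := ih fun V hV => h V (Multiset.mem_cons_of_mem hV)
    rw [Multiset.sum_cons, Multiset.count_add, Multiset.card_cons, Nat.add_mul]
    omega

/-! ### Atoms of cross number larger than one do not occur for large distances -/

/-- `B` is a product of atoms over `S` of cross number one. -/
def Good (n : ℕ) (S : Set G) (B : Multiset G) : Prop :=
  ∃ F : Multiset (Multiset G), (∀ V ∈ F, IsAtom S V ∧ wt n V = n) ∧ F.sum = B

theorem Good.zero {n : ℕ} {S : Set G} : Good n S 0 := ⟨0, by simp, by simp⟩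

theorem Good.add {n : ℕ} {S : Set G} {B C : Multiset G} (hB : Good n S B) (hC : Good n S C) :
    Good n S (B + C) := by
  obtain ⟨F, hF, rfl⟩ := hB
  obtain ⟨E, hE, rfl⟩ := hC
  refine ⟨F + E, fun V hV => ?_, Multiset.sum_add _ _⟩
  rcases Multiset.mem_add.1 hV with h | h
  exacts [hF V h, hE V h]

theorem Good.nsmul {n : ℕ} {S : Set G} {B : Multiset G} (hB : Good n S B) (k : ℕ) :
    Good n S (k • B) := by
  induction k with
  | zero => rw [zero_smul]; exact Good.zero
  | succ k ih => rw [succ_nsmul]; exact ih.add hB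

theorem Good.isZeroSumSeq {n : ℕ} {S : Set G} {B : Multiset G} (hB : Good n S B) :
    IsZeroSumSeq S B := by
  obtain ⟨F, hF, rfl⟩ := hB
  exact isZeroSumSeq_sum fun A hA => (hF A hA).1

section crossing

variable {n : ℕ} (hn : 0 < n) (hexp : ∀ x : G, n • x = 0)

include hn hexp in
/-- If all sequences without a good factorization have large cross number and full support, then
no good sequence arises from them by adding an atom `g ^ ord(g)`. -/
theorem not_good_add_strip [DecidableEq G] {d : ℕ} (hd : n ≤ 2 * d + 1) {S : Finset G}
    (hS : ∀ Z : Multiset G, IsZeroSumSeq (S : Set G) Z → ¬ Good n (S : Set G) Z →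
      n * (d + 1) ≤ wt n Z ∧ ∀ x ∈ S, x ∈ Z) {Z : Multiset G} {x : G} (hx : x ∈ S)
    (hZ : IsZeroSumSeq (S : Set G) Z) (hbad : ¬ Good n (S : Set G) Z) :
    ¬ Good n (S : Set G) (Z + strip x) := by
  induction hc : Multiset.card Z using Nat.strong_induction_on generalizing Z with
  | _ c ih =>
    rintro ⟨F, hF, hFs⟩
    -- A factor inside `Z` could be cancelled from both sides, leaving a smaller counterexample.
    have hnot : ∀ V ∈ F, ¬ V ≤ Z := by
      intro V hV hle
      have hVF := hF V hV
      have hbad' : ¬ Good n (S : Set G) (Z - V) := by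
        intro hg
        apply hbad
        have : Good n (S : Set G) V := ⟨{V}, by simpa using hVF, by simp⟩
        have := hg.add this
        rwa [tsub_add_cancel_of_le hle] at this
      refine ih (Multiset.card (Z - V)) ?_ (hZ.sub hVF.1.sum_eq hle) hbad' rfl ?_
      · rw [Multiset.card_sub hle, ← hc]
        have := Multiset.card_pos.2 hVF.1.ne_zero
        have := Multiset.card_le_card hle
        omega
      · refine ⟨F.erase V, fun W hW => hF W (Multiset.mem_of_mem_erase hW), ?_⟩
        have h1 : V + (F.erase V).sum = V + (Z - V + strip x) := by
          rw [← Multiset.sum_cons, Multiset.cons_erase hV, hFs, ← add_assoc,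
            add_tsub_cancel_of_le hle]
        exact add_left_cancel h1
    -- Away from `x` the multiplicities of `Z + strip x` are those of `Z`, so `V` can only exceed
    -- `Z` at `x`.
    have hcount : ∀ V ∈ F, Z.count x + 1 ≤ V.count x := by
      intro V hV
      by_contra hcon
      apply hnot V hV
      rw [Multiset.le_iff_count]
      intro y
      by_cases hy : y = x
      · subst hy; omega
      · have := Multiset.count_le_of_le y (mem_sum_of_mem hV)
        rw [hFs, Multiset.count_add, strip, Multiset.count_replicate, if_neg (Ne.symm hy)] at this
        simpa using this
    have h1 := card_mul_le_count_sum F hcount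
    rw [hFs, Multiset.count_add, strip, Multiset.count_replicate_self] at h1
    obtain ⟨h2, h3⟩ := hS Z hZ hbad
    have h4 : 0 < Z.count x := Multiset.count_pos.2 (h3 x hx)
    have h5 := wt_sum_eq fun V hV => (hF V hV).2
    rw [hFs, wt_add, wt_strip hn hexp] at h5
    have h6 : d + 2 ≤ Multiset.card F := by
      have : n * (d + 2) ≤ n * Multiset.card F := by rw [← h5]; linarith
      exact Nat.le_of_mul_le_mul_left this hn
    -- There are at least `d + 2` factors by weight, so they need `(d + 2) * (Z.count x + 1)` copies
    -- of `x`. Only `Z.count x + addOrderOf x` are available, which is too few because `addOrderOf x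
    -- ≤ 2 * d + 1` and `Z.count x > 0`.
    have h7 : (d + 2) * (Z.count x + 1) ≤ Multiset.card F * (Z.count x + 1) :=
      Nat.mul_le_mul_right _ h6
    have h8 := order_le hn hexp x
    nlinarith

include hn hexp in
/-- If `min Δ(G₀)` is a multiple of `d`, where `d` is at least the rank and roughly half the
exponent, then all atoms over `G₀` have cross number at most one. -/
theorem wt_le_of_rank_le [Finite G] {d : ℕ} (hd : n ≤ 2 * d + 1) {G₀ : Set G}
    (hU : UniformLengths d G₀) {r : ℕ} {f : (Fin r → ℤ) →+ G} (hf : Function.Surjective f)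
    (hr : r ≤ d) {A : Multiset G} (hA : IsAtom G₀ A) : wt n A ≤ n := by
  classical
  have := Fintype.ofFinite G
  by_contra hcon
  push Not at hcon
  induction hc : A.toFinset.card using Nat.strong_induction_on generalizing A with
  | _ c ih =>
  set S := A.toFinset with hS
  have hSA : ∀ x, x ∈ S ↔ x ∈ A := fun x => Multiset.mem_toFinset
  have hSG : ∀ {V : Multiset G}, IsAtom (S : Set G) V → IsAtom G₀ V := fun hV =>
    hV.of_mem fun x hx => hA.mem ((hSA x).1 (hV.mem hx))
  have hlow : ∀ {V : Multiset G}, IsAtom (S : Set G) V → n ≤ wt n V := fun {V} hV =>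
    le_wt_of_subset_support hn hexp hd hU hA hcon (hSG hV) fun x hx => (hSA x).1 (hV.mem hx)
  -- By minimality of the support of `A`, atoms over `S` of weight other than `n` use every element
  -- of `S`.
  have hfull : ∀ {V : Multiset G}, IsAtom (S : Set G) V → wt n V ≠ n → ∀ x ∈ S, x ∈ V := by
    intro V hV hne x hx
    by_contra hxV
    have hsub : V.toFinset ⊂ S := by
      refine Finset.ssubset_iff_subset_ne.2 ⟨fun y hy => hV.mem (Multiset.mem_toFinset.1 hy), ?_⟩
      intro h
      rw [← h, Multiset.mem_toFinset] at hx
      exact hxV hx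
    exact ih _ (hc ▸ Finset.card_lt_card hsub) (hSG hV)
      (lt_of_le_of_ne (hlow hV) (Ne.symm hne)) rfl
  have hcard := (card_support_of_lt_wt hn hexp hd hU hA hcon).1
  rw [← hS] at hcard
  obtain ⟨i₀, hi₀⟩ : S.Nonempty := Finset.card_pos.1 (by omega)
  let R : AddSubgroup (G → ℤ) :=
    { carrier := {z | (∀ x ∉ S, z x = 0) ∧ ∑ x, z x • x = 0}
      zero_mem' := by simp
      add_mem' := by
        rintro a b ⟨ha, ha'⟩ ⟨hb, hb'⟩
        refine ⟨fun x hx => by simp [ha x hx, hb x hx], ?_⟩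
        simp only [Pi.add_apply, add_smul, Finset.sum_add_distrib, ha', hb', add_zero]
      neg_mem' := by
        rintro a ⟨ha, ha'⟩
        refine ⟨fun x hx => by simp [ha x hx], ?_⟩
        simp only [Pi.neg_apply, neg_smul, Finset.sum_neg_distrib, ha', neg_zero] }
  let D : AddSubgroup (G → ℤ) :=
    { carrier := {z | ∃ B C, Good n (S : Set G) B ∧ Good n (S : Set G) C ∧
        ∀ x, z x = (B.count x : ℤ) - C.count x}
      zero_mem' := ⟨0, 0, Good.zero, Good.zero, by simp⟩
      add_mem' := by
        rintro a b ⟨B, C, hB, hC, h⟩ ⟨B', C', hB', hC', h'⟩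
        refine ⟨B + B', C + C', hB.add hB', hC.add hC', fun x => ?_⟩
        rw [Pi.add_apply, h, h', Multiset.count_add, Multiset.count_add]
        push_cast; ring
      neg_mem' := by
        rintro a ⟨B, C, hB, hC, h⟩
        exact ⟨C, B, hC, hB, fun x => by rw [Pi.neg_apply, h]; ring⟩ }
  have hgs : ∀ T ⊆ S, Good n (S : Set G) (strips T) := fun T hT =>
    ⟨T.val.map strip, fun V hV => ⟨isAtom_of_mem_map_strip hn hexp (fun g hg => hT hg) V hV, by
      obtain ⟨g, -, rfl⟩ := Multiset.mem_map.1 hV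
      exact wt_strip hn hexp g⟩, rfl⟩
  -- After adding strips, such a relation becomes a zero-sum sequence avoiding `h`, and all atoms
  -- dividing it weigh `n`.
  have hDR : ∀ z ∈ R, ∀ h ∈ S, z h = 0 → z ∈ D := by
    rintro z ⟨hz, hz'⟩ h hh hzh
    obtain ⟨N, B, hB, hBS, hBs⟩ := exists_shift hn hexp (S.erase h) z (by
      intro x hx
      by_cases hxh : x = h
      · rw [hxh, hzh]
      · exact hz x fun hxS => hx (Finset.mem_erase.2 ⟨hxh, hxS⟩))
    rw [hz'] at hBs
    obtain ⟨F, hF, hFs⟩ := exists_factorization (G₀ := (S : Set G)) (B := B)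
      ⟨fun x hx => Finset.mem_of_mem_erase (hBS x hx), hBs⟩
    refine ⟨B, N • strips (S.erase h), ⟨F, fun V hV => ⟨hF V hV, ?_⟩, hFs⟩,
      (hgs _ (Finset.erase_subset h S)).nsmul N, fun x => by rw [hB]; ring⟩
    by_contra hne
    have h1 := hfull (hF V hV) hne h hh
    have h2 := hBS h (hFs ▸ Multiset.mem_of_le (mem_sum_of_mem hV) h1)
    exact Finset.notMem_erase h S h2
  -- The support has at least `d + 2` elements, so after removing `i₀` there are still more than
  -- `r`.
  obtain ⟨w, hw, hw0⟩ := exists_primitive_relation (fun x : (S.erase i₀ : Finset G) => (x : G)) hf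
    (by rw [Fintype.card_coe, Finset.card_erase_of_mem hi₀]; omega)
  let w' : G → ℤ := fun x => if h : x ∈ S.erase i₀ then w ⟨x, h⟩ else 0
  have hw'S : ∀ x ∉ S.erase i₀, w' x = 0 := fun x hx => dif_neg hx
  have hw'R : w' ∈ R := by
    refine ⟨fun x hx => hw'S x fun h => hx (Finset.mem_of_mem_erase h), ?_⟩
    rw [← Finset.sum_subset (Finset.subset_univ (S.erase i₀)) fun x _ hx => by
      rw [hw'S x hx, zero_smul], ← Finset.sum_coe_sort, ← hw0]
    refine Finset.sum_congr rfl fun x _ => ?_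
    simp only [w', dif_pos x.2]
  have hRD : R ≤ D := by
    refine le_of_primitive (m := 0) hDR hw'R hi₀ (hw'S _ (Finset.notMem_erase _ _))
      (fun z _ => by rw [zero_smul]; exact D.zero_mem) fun a ha _ => hw a fun x => ?_
    have := ha x (Finset.mem_of_mem_erase x.2)
    simpa only [w', dif_pos x.2] using this
  have hdiff : ∀ Z : Multiset G, IsZeroSumSeq (S : Set G) Z →
      ∃ C, Good n (S : Set G) C ∧ Good n (S : Set G) (Z + C) := by
    intro Z hZ
    obtain ⟨B, C, hB, hC, h⟩ : (fun x => (Z.count x : ℤ)) ∈ D := by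
      refine hRD ⟨fun x hx => ?_, ?_⟩
      · show (Z.count x : ℤ) = 0
        exact_mod_cast Multiset.count_eq_zero_of_notMem fun h => hx (hZ.1 x h)
      · rw [← hZ.2, sum_eq_sum_count]
        simp
    refine ⟨C, hC, ?_⟩
    convert hB using 1
    ext x
    have : (Z.count x : ℤ) = B.count x - C.count x := h x
    rw [Multiset.count_add]
    omega
  -- With `C` and `V + C` both products of atoms of weight `n`, the ratio `wt n V / n` is an integer
  -- above `1`, and it is congruent to `1` modulo `d`.
  have hbadatom : ∀ V : Multiset G, IsAtom (S : Set G) V → wt n V ≠ n →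
      n * (d + 1) ≤ wt n V := by
    intro V hV hne
    obtain ⟨C, ⟨E, hE, hEs⟩, ⟨F, hF, hFs⟩⟩ := hdiff V hV.1
    have h1 := wt_sum_eq fun W hW => (hE W hW).2
    have h2 := wt_sum_eq fun W hW => (hF W hW).2
    rw [hEs] at h1
    rw [hFs, wt_add, h1] at h2
    have h3 := hU F (V ::ₘ E) (fun W hW => hSG (hF W hW).1) (fun W hW => by
      rcases Multiset.mem_cons.1 hW with rfl | hW
      exacts [hSG hV, hSG (hE W hW).1]) (by rw [hFs, Multiset.sum_cons, hEs])
    rw [Multiset.card_cons] at h3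
    have h4 : n < wt n V := lt_of_le_of_ne (hlow hV) (Ne.symm hne)
    have h5 : Multiset.card E + 1 < Multiset.card F := by
      have : n * (Multiset.card E + 1) < n * Multiset.card F := by rw [← h2]; linarith
      exact Nat.lt_of_mul_lt_mul_left this
    have h6 := Int.le_of_dvd (by push_cast; omega) h3
    have h7 : Multiset.card E + (d + 1) ≤ Multiset.card F := by push_cast at h6; omega
    have h8 := Nat.mul_le_mul_left n h7
    rw [← h2, Nat.mul_add] at h8
    omega
  have hZbad : ∀ Z : Multiset G, IsZeroSumSeq (S : Set G) Z → ¬ Good n (S : Set G) Z →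
      n * (d + 1) ≤ wt n Z ∧ ∀ x ∈ S, x ∈ Z := by
    intro Z hZ hng
    obtain ⟨F, hF, hFs⟩ := exists_factorization hZ
    have : ∃ V ∈ F, wt n V ≠ n := by
      by_contra hcon
      push Not at hcon
      exact hng ⟨F, fun V hV => ⟨hF V hV, hcon V hV⟩, hFs⟩
    obtain ⟨V, hV, hne⟩ := this
    have hVZ : V ≤ Z := hFs ▸ mem_sum_of_mem hV
    exact ⟨(hbadatom V (hF V hV) hne).trans (wt_mono n hVZ), fun x hx =>
      Multiset.mem_of_le hVZ (hfull (hF V hV) hne x hx)⟩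
  have hstep := fun Z x hx => not_good_add_strip hn hexp hd hZbad (Z := Z) (x := x) hx
  have hAS : IsAtom (S : Set G) A := hA.of_mem fun x hx => (hSA x).2 hx
  have hAbad : ¬ Good n (S : Set G) A := by
    rintro ⟨F, hF, hFs⟩
    have h0 : F ≠ 0 := by
      rintro rfl
      exact hA.ne_zero (by rw [← hFs, Multiset.sum_zero])
    obtain ⟨V, hV⟩ := Multiset.exists_mem_of_ne_zero h0
    have := hAS.eq_of_le (hFs ▸ mem_sum_of_mem hV) (hF V hV).1.ne_zero (hF V hV).1.sum_eq
    rw [← this, (hF V hV).2] at hcon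
    exact lt_irrefl _ hcon
  obtain ⟨C, hC, hAC⟩ := hdiff A hAS.1
  -- Adding strips never makes `A` good. But `n • C` is a sum of strips, and `A + n • C = (A + C) +
  -- (n - 1) • C` is good.
  have hmulti : ∀ F : Multiset (Multiset G), (∀ V ∈ F, ∃ g ∈ C, V = strip g) →
      IsZeroSumSeq (S : Set G) (A + F.sum) ∧ ¬ Good n (S : Set G) (A + F.sum) := by
    intro F hF
    induction F using Multiset.induction with
    | empty => simpa using ⟨hAS.1, hAbad⟩
    | cons V F ihF =>
      obtain ⟨h1, h2⟩ := ihF fun W hW => hF W (Multiset.mem_cons_of_mem hW)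
      obtain ⟨g, hg, rfl⟩ := hF V (Multiset.mem_cons_self _ _)
      have hgS := hC.isZeroSumSeq.1 g hg
      have e : A + (strip g ::ₘ F).sum = A + F.sum + strip g := by
        rw [Multiset.sum_cons]; abel
      rw [e]
      refine ⟨⟨fun x hx => ?_, ?_⟩, hstep _ g hgS h1 h2⟩
      · rcases Multiset.mem_add.1 hx with h | h
        · exact h1.1 x h
        · rw [Multiset.eq_of_mem_replicate h]; exact hgS
      · rw [Multiset.sum_add, h1.2, (isAtom_strip hn hexp (Set.mem_univ g)).sum_eq, add_zero]
  obtain ⟨F, hF, hFs, -⟩ := exists_strips hn hexp C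
  apply (hmulti F hF).2
  rw [hFs]
  have e : A + n • C = A + C + (n - 1) • C := by
    rw [add_assoc, ← succ_nsmul', Nat.sub_add_cancel hn]
  rw [e]
  exact hAC.add (hC.nsmul _)

end crossing

/-! ### Elasticity when the distances are at least the rank -/

section large_distance

variable {n : ℕ} (hn : 0 < n) (hexp : ∀ x : G, n • x = 0) {d : ℕ} (hd : n ≤ 2 * d + 1)

include hn hexp hd in
-- All atoms weigh between `n - d` and `n`. An atom `U` of weight `n - d` exists because `G₀` is not
-- half-factorial, and `n • U` has factorizations of lengths `n` and `n - d`.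
theorem elasticity_eq_of_rank_le [Finite G] {G₀ : Set G} (h : Admissible d G₀)
    {r : ℕ} {f : (Fin r → ℤ) →+ G} (hf : Function.Surjective f) (hr : r ≤ d) :
    d < n ∧ elasticity G₀ = ENNReal.ofReal ((n : ℝ) / ((n : ℝ) - d)) := by
  have hU := h.uniformLengths
  obtain ⟨U, hA, hne⟩ := exists_wt_ne hn hexp h.not_halfFactorial
  have hle := wt_le_of_rank_le hn hexp hd hU hf hr hA
  have hlt : wt n U < n := lt_of_le_of_ne hle hne
  have hw := wt_eq_of_wt_lt hn hexp hd hU hA hlt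
  have h2 := hA.two_le_wt hn hexp hlt
  have hdn : d < n := by omega
  have hwr : (wt n U : ℝ) = n - d := by
    have : (wt n U : ℝ) + d = n := by exact_mod_cast hw
    linarith
  have hw0 : (0 : ℝ) < n - d := by
    rw [← hwr]; exact_mod_cast (by omega : 0 < wt n U)
  refine ⟨hdn, le_antisymm ?_ ?_⟩
  · have hval : ∀ A : Multiset G,
        (A.map fun g => (n : ℝ) / (n - d) * ((addOrderOf g : ℝ))⁻¹).sum =
          (wt n A : ℝ) / (n - d) := by
      intro A
      have hn' : (n : ℝ) ≠ 0 := by exact_mod_cast hn.ne'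
      rw [Multiset.sum_map_mul_left, real_weight_eq hn hexp]
      field_simp
    refine elasticity_le_of_weight (fun g => (n : ℝ) / (n - d) * ((addOrderOf g : ℝ))⁻¹) _ ?_
      (fun A hA => ?_) (fun A hA => ?_)
    · rw [le_div_iff₀ hw0]
      have : (0 : ℝ) ≤ d := by positivity
      linarith
    · rw [hval, le_div_iff₀ hw0]
      have : (n : ℝ) ≤ wt n A + d := by exact_mod_cast sub_le_wt hn hexp hd hU hA
      linarith
    · rw [hval]
      have : (wt n A : ℝ) ≤ n := by exact_mod_cast wt_le_of_rank_le hn hexp hd hU hf hr hA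
      gcongr
  · obtain ⟨F, hF, hs, hc⟩ := exists_strip_factorization hn hexp (G₀ := G₀) (B := U)
      fun g hg => hA.mem hg
    have hne : F ≠ 0 := by
      rintro rfl
      rw [Multiset.card_zero] at hc
      omega
    have h1 := le_elasticity (F := F) (F' := Multiset.replicate n U) hF
      (fun C hC => (Multiset.eq_of_mem_replicate hC) ▸ hA)
      (by rw [hs, Multiset.sum_replicate]) hne
    rw [hc, Multiset.card_replicate] at h1
    refine le_trans (le_of_eq ?_) h1
    rw [← hwr, ENNReal.ofReal_div_of_pos (by rw [hwr]; exact hw0), ENNReal.ofReal_natCast,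
      ENNReal.ofReal_natCast]

include hn hexp hd in
theorem rhoStar_eq_of_rank_le [Finite G] (h : ∃ G₀ : Set G, Admissible d G₀)
    {r : ℕ} {f : (Fin r → ℤ) →+ G} (hf : Function.Surjective f) (hr : r ≤ d) :
    d < n ∧ rhoStar G d = ENNReal.ofReal ((n : ℝ) / ((n : ℝ) - d)) := by
  obtain ⟨G₀, h⟩ := h
  have key := elasticity_eq_of_rank_le hn hexp hd h hf hr
  refine ⟨key.1, le_antisymm (rhoStar_le fun G₁ h1 => ?_) (key.2.ge.trans (le_rhoStar h))⟩
  exact (elasticity_eq_of_rank_le hn hexp hd h1 hf hr).2.le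

end large_distance

/-! ### Minimal sequences with sum in a cyclic subgroup -/

/-- `T` is a nonempty sequence over `G₀ \ {g, -g}` with sum in `⟨g⟩`, minimal with these
properties. -/
def IsBlock (G₀ : Set G) (g : G) (T : Multiset G) : Prop :=
  T ≠ 0 ∧ (∀ x ∈ T, x ∈ G₀ ∧ x ≠ g ∧ x ≠ -g) ∧ T.sum ∈ AddSubgroup.zmultiples g ∧
    ∀ T' ≤ T, T' ≠ 0 → T'.sum ∈ AddSubgroup.zmultiples g → T' = T

theorem IsBlock.neg {G₀ : Set G} {g : G} {T : Multiset G} (h : IsBlock G₀ g T) :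
    IsBlock G₀ (-g) T := by
  obtain ⟨h0, h1, h2, h3⟩ := h
  refine ⟨h0, fun x hx => ⟨(h1 x hx).1, (h1 x hx).2.2, ?_⟩, ?_, ?_⟩
  · rw [neg_neg]; exact (h1 x hx).2.1
  · rwa [AddSubgroup.zmultiples_neg]
  · simpa only [AddSubgroup.zmultiples_neg] using h3

theorem exists_isBlock_le {G₀ : Set G} {g : G} {B : Multiset G} (h0 : B ≠ 0)
    (hB : ∀ x ∈ B, x ∈ G₀ ∧ x ≠ g ∧ x ≠ -g) (hs : B.sum ∈ AddSubgroup.zmultiples g) :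
    ∃ T, IsBlock G₀ g T ∧ T ≤ B := by
  induction hc : Multiset.card B using Nat.strong_induction_on generalizing B with
  | _ c ih =>
    by_cases h : ∀ T' ≤ B, T' ≠ 0 → T'.sum ∈ AddSubgroup.zmultiples g → T' = B
    · exact ⟨B, ⟨h0, hB, hs, h⟩, le_rfl⟩
    · push Not at h
      obtain ⟨T, hT, hT0, hTs, hne⟩ := h
      obtain ⟨A, hA, hAT⟩ := ih _ (hc ▸ Multiset.card_lt_card (lt_of_le_of_ne hT hne)) hT0
        (fun x hx => hB x (Multiset.mem_of_le hT hx)) hTs rfl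
      exact ⟨A, hA, hAT.trans hT⟩

theorem exists_block_factorization {G₀ : Set G} {g : G} {B : Multiset G}
    (hB : ∀ x ∈ B, x ∈ G₀ ∧ x ≠ g ∧ x ≠ -g) (hs : B.sum ∈ AddSubgroup.zmultiples g) :
    ∃ F : Multiset (Multiset G), (∀ T ∈ F, IsBlock G₀ g T) ∧ F.sum = B := by
  classical
  induction hc : Multiset.card B using Nat.strong_induction_on generalizing B with
  | _ c ih =>
    by_cases h0 : B = 0
    · exact ⟨0, by simp, by simp [h0]⟩
    · obtain ⟨T, hT, hTB⟩ := exists_isBlock_le h0 hB hs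
      have hlt : Multiset.card (B - T) < c := by
        rw [Multiset.card_sub hTB, ← hc]
        have := Multiset.card_pos.2 hT.1
        have := Multiset.card_le_card hTB
        omega
      obtain ⟨F, hF, hFs⟩ := ih _ hlt
        (fun x hx => hB x (Multiset.mem_of_le (Multiset.sub_le_self _ _) hx))
        (by rw [sum_sub_eq hTB]; exact sub_mem hs hT.2.2.1) rfl
      refine ⟨T ::ₘ F, fun V hV => ?_, ?_⟩
      · rcases Multiset.mem_cons.1 hV with rfl | hV
        exacts [hT, hF V hV]
      · rw [Multiset.sum_cons, hFs, add_tsub_cancel_of_le hTB]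

/-- A zero-sum subsequence meets `T` in a part with sum in `⟨g⟩`, so in nothing or in all of `T`;
since `j` is below the order of `g`, the number of copies of `g` is then determined too. -/
theorem IsBlock.isAtom_add_replicate {G₀ : Set G} {g : G} {T : Multiset G} (hT : IsBlock G₀ g T)
    {G₁ : Set G} (h₀₁ : G₀ ⊆ G₁) (hg : g ∈ G₁) {j : ℕ} (hj : j < addOrderOf g)
    (hs : T.sum + j • g = 0) : IsAtom G₁ (T + Multiset.replicate j g) := by
  classical
  obtain ⟨h0, h1, h2, h3⟩ := hT
  refine isAtom_of_forall ?_ ?_ ?_ ?_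
  · intro x hx
    rcases Multiset.mem_add.1 hx with hx | hx
    · exact h₀₁ (h1 x hx).1
    · rw [Multiset.eq_of_mem_replicate hx]; exact hg
  · rw [Multiset.sum_add, Multiset.sum_replicate, hs]
  · intro h
    exact h0 (add_eq_zero.1 h).1
  · intro S hS hS0 hSs
    have hdec : S.filter (fun x => x ≠ g) + Multiset.replicate (S.count g) g = S := by
      rw [← Multiset.filter_eq', add_comm]
      exact Multiset.filter_add_not _ S
    have hle : S.filter (fun x => x ≠ g) ≤ T := by
      have := Multiset.filter_le_filter (fun x => x ≠ g) hS
      rw [Multiset.filter_add, Multiset.filter_eq_self.2 fun x hx => (h1 x hx).2.1,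
        (Multiset.filter_eq_nil.2 fun x hx h => h (Multiset.eq_of_mem_replicate hx) :
          (Multiset.replicate j g).filter (fun x => x ≠ g) = 0), add_zero] at this
      exact this
    have hc : S.count g ≤ j := by
      have := Multiset.count_le_of_le g hS
      rwa [Multiset.count_add, Multiset.count_replicate_self,
        Multiset.count_eq_zero_of_notMem fun h => (h1 g h).2.1 rfl, zero_add] at this
    have hsum : (S.filter fun x => x ≠ g).sum + S.count g • g = 0 := by
      rw [← hSs]
      conv_rhs => rw [← hdec]
      rw [Multiset.sum_add, Multiset.sum_replicate]
    by_cases hz : S.filter (fun x => x ≠ g) = 0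
    · rw [hz, Multiset.sum_zero, zero_add] at hsum
      have := Nat.eq_zero_of_dvd_of_lt (addOrderOf_dvd_of_nsmul_eq_zero hsum) (hc.trans_lt hj)
      rw [hz, this, Multiset.replicate_zero, add_zero] at hdec
      exact absurd hdec.symm hS0
    · have hT := h3 _ hle hz (by
        rw [eq_neg_of_add_eq_zero_left hsum]
        exact neg_mem (AddSubgroup.nsmul_mem _ (AddSubgroup.mem_zmultiples g) _))
      rw [hT] at hsum hdec
      have h4 : (j - S.count g) • g = 0 := by
        have : (j - S.count g) • g + S.count g • g = S.count g • g := by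
          rw [← add_nsmul, Nat.sub_add_cancel hc]
          exact add_left_cancel (hs.trans hsum.symm)
        exact add_eq_right.1 this
      have := Nat.eq_zero_of_dvd_of_lt (addOrderOf_dvd_of_nsmul_eq_zero h4)
        (lt_of_le_of_lt (Nat.sub_le _ _) hj)
      rw [← hdec]
      congr 2
      omega

section blocks

variable {n : ℕ} (hn : 4 ≤ n) (hexp : ∀ x : G, n • x = 0) {G₀ : Set G}
  (hU : UniformLengths (n - 2) G₀) {g : G} (hg : g ∈ G₀) (hg' : -g ∈ G₀) (hgn : addOrderOf g = n)

include hn hgn in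
theorem isAtom_pair {G₁ : Set G} (hg : g ∈ G₁) (hg' : -g ∈ G₁) : IsAtom G₁ {g, -g} := by
  have hg0 : g ≠ 0 := by
    rintro rfl
    rw [addOrderOf_zero] at hgn
    omega
  refine isAtom_of_forall ?_ ?_ ?_ ?_
  · intro x hx
    rcases Multiset.mem_cons.1 hx with rfl | hx
    · exact hg
    · rw [Multiset.mem_singleton.1 hx]; exact hg'
  · simp
  · simp
  · intro T hT hT0 hTs
    refine Multiset.eq_of_le_of_card_le hT ?_
    by_contra hc
    have h1 : Multiset.card T = 1 := by
      have := Multiset.card_pos.2 hT0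
      simp at hc
      omega
    obtain ⟨x, rfl⟩ := Multiset.card_eq_one.1 h1
    rw [Multiset.sum_singleton] at hTs
    have := Multiset.mem_of_le hT (Multiset.mem_singleton_self x)
    rcases Multiset.mem_cons.1 this with rfl | hx
    · exact hg0 hTs
    · rw [Multiset.mem_singleton.1 hx] at hTs
      exact hg0 (neg_eq_zero.1 hTs)

include hn hexp hU hg hg' hgn in
-- If `T.sum = u • g` with `0 < u < n`, then `T g^(n-u)` times `u` pairs `g (-g)` equals `T (-g)^u`
-- times `g^n`. The lengths `u + 1` and `2` agree modulo `n - 2` only for `u = 1` and `u = n - 1`.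
theorem IsBlock.sum_eq {T : Multiset G} (hT : IsBlock G₀ g T) :
    T.sum = 0 ∨ T.sum = g ∨ T.sum = -g := by
  classical
  have hn0 : 0 < n := by omega
  obtain ⟨u, hu, hus⟩ : ∃ u : ℕ, u < n ∧ u • g = T.sum := by
    have h := hT.2.2.1
    have hfin : IsOfFinAddOrder g := by
      rw [← addOrderOf_pos_iff]; omega
    rw [← hfin.mem_multiples_iff_mem_zmultiples, hfin.mem_multiples_iff_mem_range_addOrderOf,
      Finset.mem_image] at h
    obtain ⟨u, hu, hus⟩ := h
    exact ⟨u, hgn ▸ Finset.mem_range.1 hu, hus⟩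
  rcases Nat.eq_zero_or_pos u with rfl | hupos
  · left; rw [← hus, zero_nsmul]
  have h1 : IsAtom G₀ (T + Multiset.replicate u (-g)) :=
    hT.neg.isAtom_add_replicate le_rfl hg' (by rw [addOrderOf_neg]; omega)
      (by rw [← hus, smul_neg, add_neg_cancel])
  have h2 : IsAtom G₀ (T + Multiset.replicate (n - u) g) :=
    hT.isAtom_add_replicate le_rfl hg (by omega)
      (by rw [← hus, ← add_nsmul, Nat.add_sub_cancel' hu.le, hexp])
  have h3 : IsAtom G₀ (strip g) := isAtom_strip hn0 hexp hg
  have h4 := isAtom_pair hn hgn hg hg'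
  have h5 := hU ((T + Multiset.replicate (n - u) g) ::ₘ Multiset.replicate u {g, -g})
    {T + Multiset.replicate u (-g), strip g} (by
      intro A hA
      rcases Multiset.mem_cons.1 hA with rfl | hA
      exacts [h2, (Multiset.eq_of_mem_replicate hA) ▸ h4]) (by
      intro A hA
      rcases Multiset.mem_cons.1 hA with rfl | hA
      exacts [h1, (Multiset.mem_singleton.1 hA) ▸ h3]) (by
      have e1 : (Multiset.replicate u ({g, -g} : Multiset G)).sum =
          Multiset.replicate u g + Multiset.replicate u (-g) := by
        rw [Multiset.sum_replicate]
        have : ({g, -g} : Multiset G) = {g} + {-g} := rfl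
        rw [this, nsmul_add, Multiset.nsmul_singleton, Multiset.nsmul_singleton]
      have e2 : strip g = Multiset.replicate (n - u) g + Multiset.replicate u g := by
        rw [← Multiset.replicate_add, Nat.sub_add_cancel hu.le, strip, hgn]
      rw [Multiset.sum_cons, e1, Multiset.insert_eq_cons, Multiset.sum_cons,
        Multiset.sum_singleton, e2]
      abel)
  rw [Multiset.card_cons, Multiset.card_replicate, Multiset.insert_eq_cons, Multiset.card_cons,
    Multiset.card_singleton] at h5
  have h6 : ((n - 2 : ℕ) : ℤ) ∣ ((u - 1 : ℕ) : ℤ) := by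
    convert h5 using 1
    omega
  have h7 := Int.natCast_dvd_natCast.1 h6
  obtain ⟨c, hc⟩ := h7
  have hc2 : c < 2 := by
    by_contra hcon
    have : (n - 2) * 2 ≤ (n - 2) * c := Nat.mul_le_mul_left _ (by omega)
    omega
  interval_cases c
  · right; left
    have : u = 1 := by omega
    rw [← hus, this, one_nsmul]
  · right; right
    have : u = n - 1 := by omega
    rw [← hus, this, eq_neg_iff_add_eq_zero]
    nth_rewrite 2 [← one_nsmul g]
    rw [← add_nsmul, Nat.sub_add_cancel (by omega), hexp]

include hn hexp hg hgn in
theorem IsBlock.isAtom_plus {T : Multiset G} (hT : IsBlock G₀ g T) (hs : T.sum = g) :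
    IsAtom G₀ (T + Multiset.replicate (n - 1) g) ∧ n < wt n (T + Multiset.replicate (n - 1) g) := by
  have hn0 : 0 < n := by omega
  refine ⟨hT.isAtom_add_replicate le_rfl hg (by omega) ?_, ?_⟩
  · rw [hs]
    nth_rewrite 1 [← one_nsmul g]
    rw [← add_nsmul, Nat.add_sub_cancel' (by omega), hexp]
  · rw [wt_add, wt_replicate, hgn, Nat.div_self hn0, mul_one]
    suffices 2 ≤ wt n T by omega
    refine le_trans ?_ (card_le_wt hn0 hexp T)
    by_contra hc
    have h1 : Multiset.card T = 1 := by
      have := Multiset.card_pos.2 hT.1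
      omega
    obtain ⟨x, rfl⟩ := Multiset.card_eq_one.1 h1
    rw [Multiset.sum_singleton] at hs
    exact (hT.2.1 x (Multiset.mem_singleton_self x)).2.1 hs

include hn hexp hU hg hgn in
-- The sequence `T g^(n-1)` is a heavy atom, so it has at least `d + 2 = n` distinct terms, one of
-- which is `g`. In the case of equality, its complement in the product of strips is an atom that
-- contains `g` exactly once.
theorem IsBlock.card_support [DecidableEq G] {T : Multiset G} (hT : IsBlock G₀ g T)
    (hs : T.sum = g) : n - 1 ≤ T.toFinset.card ∧
      (T.toFinset.card = n - 1 → IsAtom G₀ (strips T.toFinset - T + {g})) ∧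
      ∀ x, T.count x < addOrderOf x := by
  have hn0 : 0 < n := by omega
  obtain ⟨hA, hbad⟩ := hT.isAtom_plus hn hexp hg hgn hs
  have hgT : g ∉ T := fun h => (hT.2.1 g h).2.1 rfl
  have hsupp : (T + Multiset.replicate (n - 1) g).toFinset = insert g T.toFinset := by
    ext x
    simp only [Multiset.mem_toFinset, Multiset.mem_add, Multiset.mem_replicate, Finset.mem_insert]
    constructor
    · rintro (h | ⟨-, h⟩)
      exacts [Or.inr h, Or.inl h]
    · rintro (h | h)
      exacts [Or.inr ⟨by omega, h⟩, Or.inl h]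
  have hcard : (insert g T.toFinset).card = T.toFinset.card + 1 :=
    Finset.card_insert_of_notMem (by rwa [Multiset.mem_toFinset])
  have hsc := card_support_of_lt_wt hn0 hexp (by omega) hU hA hbad
  rw [hsupp, hcard] at hsc
  refine ⟨by omega, fun h => ?_, fun x => ?_⟩
  · have h1 := hsc.2 (by omega)
    convert h1 using 1
    ext x
    simp only [Multiset.count_add, Multiset.count_sub, count_strips, Multiset.mem_toFinset,
      Finset.mem_insert, Multiset.count_replicate, Multiset.count_singleton]
    by_cases hx : x = g
    · subst hx
      rw [if_neg hgT, Multiset.count_eq_zero_of_notMem hgT, hgn]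
      simp
      omega
    · simp [hx, Ne.symm hx]
  · have := hA.count_lt hn0 hexp hbad.ne' x
    rw [Multiset.count_add] at this
    omega

end blocks

section blocks

variable {n : ℕ} (hn : 4 ≤ n) (hexp : ∀ x : G, n • x = 0) {G₀ : Set G}
  (hU : UniformLengths (n - 2) G₀) {g : G} (hg : g ∈ G₀) (hg' : -g ∈ G₀) (hgn : addOrderOf g = n)

include hn hexp hU hg hg' hgn in
theorem IsBlock.le_card_support [DecidableEq G] {T : Multiset G} (hT : IsBlock G₀ g T)
    (hs : T.sum ≠ 0) : n - 1 ≤ T.toFinset.card := by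
  rcases (hT.sum_eq hn hexp hU hg hg' hgn).resolve_left hs with h | h
  · exact (hT.card_support hn hexp hU hg hgn h).1
  · exact (hT.neg.card_support hn hexp hU hg' (by rwa [addOrderOf_neg]) h).1

include hn hexp hU hg hg' hgn in
/-- If `G` is generated by `n - 1` elements, then a block with nonzero sum of minimal support has
support of size `n - 1`. -/
theorem exists_block_card_support [Finite G] [DecidableEq G] {r : ℕ} {f : (Fin r → ℤ) →+ G}
    (hf : Function.Surjective f) (hr : r + 1 = n)
    (h : ∃ T, IsBlock G₀ g T ∧ T.sum ≠ 0) :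
    ∃ T, IsBlock G₀ g T ∧ T.sum ≠ 0 ∧ T.toFinset.card = n - 1 := by
  classical
  have := Fintype.ofFinite G
  have hn0 : 0 < n := by omega
  have hex : ∃ c, ∃ T, IsBlock G₀ g T ∧ T.sum ≠ 0 ∧ T.toFinset.card = c := by
    obtain ⟨T, h1, h2⟩ := h
    exact ⟨_, T, h1, h2, rfl⟩
  obtain ⟨T, hT, hs, hc⟩ := Nat.find_spec hex
  have hmin : ∀ V, IsBlock G₀ g V → V.sum ≠ 0 → T.toFinset.card ≤ V.toFinset.card := fun V h1 h2 =>
    hc.trans_le (Nat.find_min' hex ⟨V, h1, h2, rfl⟩)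
  have hle := hT.le_card_support hn hexp hU hg hg' hgn hs
  refine ⟨T, hT, hs, le_antisymm ?_ hle⟩
  by_contra hlt
  push Not at hlt
  set S := T.toFinset with hS
  obtain ⟨i₀, hi₀⟩ : S.Nonempty := Finset.card_pos.1 (by omega)
  let R : AddSubgroup (G → ℤ) :=
    { carrier := {z | (∀ x ∉ S, z x = 0) ∧ ∑ x, z x • x ∈ AddSubgroup.zmultiples g}
      zero_mem' := by simp
      add_mem' := by
        rintro a b ⟨ha, ha'⟩ ⟨hb, hb'⟩
        refine ⟨fun x hx => by simp [ha x hx, hb x hx], ?_⟩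
        simp only [Pi.add_apply, add_smul, Finset.sum_add_distrib]
        exact add_mem ha' hb'
      neg_mem' := by
        rintro a ⟨ha, ha'⟩
        refine ⟨fun x hx => by simp [ha x hx], ?_⟩
        simp only [Pi.neg_apply, neg_smul, Finset.sum_neg_distrib]
        exact neg_mem ha' }
  let D : AddSubgroup (G → ℤ) :=
    { carrier := {z | ∑ x, z x • x = 0}
      zero_mem' := by simp
      add_mem' := by
        rintro a b (ha : _ = _) (hb : _ = _)
        show ∑ x, (a + b) x • x = 0
        simp only [Pi.add_apply, add_smul, Finset.sum_add_distrib, ha, hb, add_zero]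
      neg_mem' := by
        rintro a (ha : _ = _)
        show ∑ x, (-a) x • x = 0
        simp only [Pi.neg_apply, neg_smul, Finset.sum_neg_distrib, ha, neg_zero] }
  -- Vectors in `R` have sum in `⟨g⟩`, those in `D` have sum zero. Blocks avoiding some `h ∈ S` have
  -- smaller support than `T`, so they sum to zero.
  have hDR : ∀ z ∈ R, ∀ h ∈ S, z h = 0 → z ∈ D := by
    rintro z ⟨hz, hz'⟩ h hh hzh
    obtain ⟨N, B, -, hBS, hBs⟩ := exists_shift hn0 hexp (S.erase h) z (by
      intro x hx
      by_cases hxh : x = h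
      · rw [hxh, hzh]
      · exact hz x fun hxS => hx (Finset.mem_erase.2 ⟨hxh, hxS⟩))
    obtain ⟨F, hF, hFs⟩ := exists_block_factorization (G₀ := G₀) (g := g) (B := B)
      (fun x hx => hT.2.1 x (Multiset.mem_toFinset.1 (Finset.mem_of_mem_erase (hBS x hx))))
      (by rw [hBs]; exact hz')
    show ∑ x, z x • x = 0
    rw [← hBs, ← hFs, ← Multiset.coe_sumAddMonoidHom, map_multiset_sum]
    refine Multiset.sum_eq_zero fun y hy => ?_
    obtain ⟨V, hV, rfl⟩ := Multiset.mem_map.1 hy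
    rw [Multiset.coe_sumAddMonoidHom]
    by_contra hne
    have h1 := hmin V (hF V hV) hne
    have h2 : V.toFinset ⊆ S.erase h := fun x hx => hBS x
      (hFs ▸ Multiset.mem_of_le (mem_sum_of_mem hV) (Multiset.mem_toFinset.1 hx))
    have h3 := Finset.card_le_card h2
    rw [Finset.card_erase_of_mem hh] at h3
    omega
  -- The relation is sought among `g` and the elements of `S` other than `i₀`; these are at least `n
  -- > r` elements if the support of `T` exceeds `n - 1`.
  let e : Option (S.erase i₀ : Finset G) → G := fun o => o.elim g fun x => (x : G)
  obtain ⟨w, hw, hw0⟩ := exists_primitive_relation e hf (by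
    rw [Fintype.card_option, Fintype.card_coe, Finset.card_erase_of_mem hi₀]; omega)
  rw [Fintype.sum_option] at hw0
  simp only [e, Option.elim] at hw0
  let w' : G → ℤ := fun x => if h : x ∈ S.erase i₀ then w (some ⟨x, h⟩) else 0
  have hw'S : ∀ x ∉ S.erase i₀, w' x = 0 := fun x hx => dif_neg hx
  have hsum : ∑ x, w' x • x = ∑ x : (S.erase i₀ : Finset G), w (some x) • (x : G) := by
    rw [← Finset.sum_subset (Finset.subset_univ (S.erase i₀)) fun x _ hx => by
      rw [hw'S x hx, zero_smul], ← Finset.sum_coe_sort]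
    refine Finset.sum_congr rfl fun x _ => ?_
    simp only [w', dif_pos x.2]
  have hw'R : w' ∈ R := by
    refine ⟨fun x hx => hw'S x fun h => hx (Finset.mem_of_mem_erase h), ?_⟩
    rw [hsum, eq_neg_of_add_eq_zero_right hw0]
    exact neg_mem (zsmul_mem (AddSubgroup.mem_zmultiples g) _)
  have hRD : R ≤ D := by
    refine le_of_primitive (m := n) hDR hw'R hi₀ (hw'S _ (Finset.notMem_erase _ _)) (fun z _ => ?_)
      fun a ha han => hw a fun o => ?_
    · show ∑ x, ((n : ℤ) • z) x • x = 0
      refine Finset.sum_eq_zero fun x _ => ?_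
      rw [Pi.smul_apply, smul_eq_mul, mul_comm, mul_smul, natCast_zsmul, hexp, smul_zero]
    · have hsome : ∀ x : (S.erase i₀ : Finset G), a ∣ w (some x) := fun x => by
        have := ha x (Finset.mem_of_mem_erase x.2)
        simpa only [w', dif_pos x.2] using this
      cases o with
      | some x => exact hsome x
      | none =>
        obtain ⟨b, hb⟩ := han
        have hb0 : b ≠ 0 := by
          rintro rfl
          rw [mul_zero] at hb
          omega
        -- The coefficient of `g` is not visible on `S`. With `n = a * b`, multiplying the relation
        -- by `b` kills all its other terms, so `n ∣ b * w none` and thus `a ∣ w none`.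
        have h1 : (b * w none) • g = 0 := by
          rw [mul_smul, eq_neg_of_add_eq_zero_left hw0, smul_neg, Finset.smul_sum, neg_eq_zero]
          refine Finset.sum_eq_zero fun x _ => ?_
          obtain ⟨c, hc⟩ := hsome x
          rw [hc, smul_smul, show b * (a * c) = c * (n : ℤ) by rw [hb]; ring, mul_smul,
            natCast_zsmul, hexp, smul_zero]
        have h2 := addOrderOf_dvd_iff_zsmul_eq_zero.2 h1
        rw [hgn, hb, mul_comm a b] at h2
        exact Int.dvd_of_mul_dvd_mul_left hb0 h2
  apply hs
  have : (fun x => (T.count x : ℤ)) ∈ D := by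
    refine hRD ⟨fun x hx => ?_, ?_⟩
    · show (T.count x : ℤ) = 0
      exact_mod_cast Multiset.count_eq_zero_of_notMem fun h => hx (Multiset.mem_toFinset.2 h)
    · have h := hT.2.2.1
      rw [sum_eq_sum_count] at h
      simpa using h
  rw [sum_eq_sum_count]
  have h2 : ∑ x, (T.count x : ℤ) • x = 0 := this
  simpa using h2

include hn hexp hU hg hg' hgn in
-- Take two copies of the atom `T (-g)` and split off `strip y` for all `y ∈ J`. The remaining atoms
-- can be charged to distinct elements of `T.toFinset \ J`, so the new factorization has between `2`
-- and `n - 1` atoms; by the congruence modulo `n - 2` it has exactly two, and at least one of them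
-- is not a strip.
theorem IsBlock.card_filter_le_one [DecidableEq G] {T : Multiset G} (hT : IsBlock G₀ g T)
    (hs : T.sum = g) (hcard : T.toFinset.card = n - 1) :
    (T.toFinset.filter fun y => addOrderOf y ≤ 2 * T.count y).card ≤ 1 := by
  have hn0 : 0 < n := by omega
  have hlt := (hT.card_support hn hexp hU hg hgn hs).2.2
  set J := T.toFinset.filter fun y => addOrderOf y ≤ 2 * T.count y with hJ
  rcases J.eq_empty_or_nonempty with h0 | ⟨j, hj⟩
  · rw [h0]; simp
  have hJc : 0 < J.card := Finset.card_pos.2 ⟨j, hj⟩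
  have hmemJ : ∀ x, x ∈ J ↔ x ∈ T ∧ addOrderOf x ≤ 2 * T.count x := fun x => by
    rw [hJ, Finset.mem_filter, Multiset.mem_toFinset]
  have hJT : strips J ≤ T + T := by
    rw [Multiset.le_iff_count]
    intro x
    rw [count_strips, Multiset.count_add]
    split_ifs with h
    · have := ((hmemJ x).1 h).2
      omega
    · omega
  set Q := T + T - strips J with hQ
  have hQT : ∀ x ∈ Q, x ∈ T := fun x hx => by
    have := Multiset.mem_of_le (Multiset.sub_le_self _ _) hx
    simpa using this
  have hQJ : ∀ x ∈ J, Q.count x < T.count x := by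
    intro x hx
    rw [hQ, Multiset.count_sub, Multiset.count_add, count_strips, if_pos hx]
    have h1 := hlt x
    have h2 := Multiset.count_pos.2 ((hmemJ x).1 hx).1
    omega
  have hQ2 : ∀ x, Q.count x ≤ 2 * T.count x := by
    intro x
    rw [hQ, Multiset.count_sub, Multiset.count_add]
    omega
  have hQs : Q.sum = g + g := by
    rw [hQ, sum_sub_eq hJT, sum_strips, sub_zero, Multiset.sum_add, hs]
  obtain ⟨F, hF, hFs⟩ := exists_factorization (G₀ := G₀) (B := Q + Multiset.replicate 2 (-g)) (by
    refine ⟨fun x hx => ?_, ?_⟩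
    · rcases Multiset.mem_add.1 hx with hx | hx
      · exact (hT.2.1 x (hQT x hx)).1
      · rw [Multiset.eq_of_mem_replicate hx]; exact hg'
    · rw [Multiset.sum_add, hQs, Multiset.sum_replicate, two_nsmul]
      abel)
  have hatom : IsAtom G₀ (T + Multiset.replicate 1 (-g)) :=
    hT.neg.isAtom_add_replicate le_rfl hg' (by rw [addOrderOf_neg]; omega)
      (by rw [hs, one_nsmul, add_neg_cancel])
  have h5 := hU (Multiset.replicate 2 (T + Multiset.replicate 1 (-g))) (J.val.map strip + F)
    (fun A hA => (Multiset.eq_of_mem_replicate hA) ▸ hatom)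
    (forall_mem_add (isAtom_of_mem_map_strip hn0 hexp fun x hx =>
      (hT.2.1 x ((hmemJ x).1 hx).1).1) hF) (by
      rw [Multiset.sum_replicate, nsmul_add, Multiset.nsmul_replicate, Multiset.sum_add, hFs,
        two_nsmul, ← add_assoc]
      congr 1
      exact (add_tsub_cancel_of_le hJT).symm)
  rw [Multiset.card_replicate, Multiset.card_add, Multiset.card_map, ← Finset.card_def] at h5
  have hF0 : 0 < Multiset.card F := by
    rw [Multiset.card_pos]
    rintro rfl
    have := congrArg Multiset.card hFs
    simp at this
  -- Each such atom contains a block `V` inside `Q`. If `V ≤ T`, then `V = T`, but `Q` has fewer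
  -- copies of `j` than `T`. So `V` exceeds `T` somewhere, necessarily outside `J`.
  have hex : ∀ A ∈ F, ∃ x ∈ T.toFinset \ J, T.count x < A.count x := by
    intro A hA
    have hAE : A ≤ Q + Multiset.replicate 2 (-g) := hFs ▸ mem_sum_of_mem hA
    set A₀ := A.filter fun x => x ≠ -g with hA₀
    have hdec : A₀ + Multiset.replicate (A.count (-g)) (-g) = A := by
      rw [← Multiset.filter_eq', add_comm]
      exact Multiset.filter_add_not _ A
    have hgQ : -g ∉ Q := fun h => (hT.2.1 _ (hQT _ h)).2.2 rfl
    have hA₀Q : A₀ ≤ Q := by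
      have := Multiset.filter_le_filter (fun x => x ≠ -g) hAE
      rw [Multiset.filter_add, (Multiset.filter_eq_self.2 fun x hx h => hgQ (h ▸ hx) :
          Q.filter (fun x => x ≠ -g) = Q),
        (Multiset.filter_eq_nil.2 fun x hx h => h (Multiset.eq_of_mem_replicate hx) :
          (Multiset.replicate 2 (-g)).filter (fun x => x ≠ -g) = 0), add_zero] at this
      exact this
    have hc2 : A.count (-g) ≤ 2 := by
      have := Multiset.count_le_of_le (-g) hAE
      rwa [Multiset.count_add, Multiset.count_replicate_self, Multiset.count_eq_zero_of_notMem hgQ,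
        zero_add] at this
    have hsum : A₀.sum + A.count (-g) • (-g) = 0 := by
      rw [← (hF A hA).sum_eq]
      conv_rhs => rw [← hdec]
      rw [Multiset.sum_add, Multiset.sum_replicate]
    have hA₀0 : A₀ ≠ 0 := by
      intro h
      rw [h, Multiset.sum_zero, zero_add] at hsum
      have := Nat.eq_zero_of_dvd_of_lt (addOrderOf_dvd_of_nsmul_eq_zero hsum)
        (by rw [addOrderOf_neg]; omega)
      rw [h, this, Multiset.replicate_zero, add_zero] at hdec
      exact (hF A hA).ne_zero hdec.symm
    obtain ⟨V, hV, hVA⟩ := exists_isBlock_le (G₀ := G₀) (g := g) hA₀0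
      (fun x hx => hT.2.1 x (hQT x (Multiset.mem_of_le hA₀Q hx))) (by
        rw [eq_neg_of_add_eq_zero_left hsum]
        exact neg_mem (AddSubgroup.nsmul_mem _ (neg_mem (AddSubgroup.mem_zmultiples g)) _))
    have hVT : ¬ V ≤ T := by
      intro h
      have := hT.2.2.2 V h hV.1 hV.2.2.1
      have h1 := Multiset.count_le_of_le j (this ▸ hVA.trans hA₀Q)
      exact absurd (hQJ j hj) (by omega)
    rw [Multiset.le_iff_count] at hVT
    push Not at hVT
    obtain ⟨x, hx⟩ := hVT
    have h1 := Multiset.count_le_of_le x (hVA.trans hA₀Q)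
    refine ⟨x, Finset.mem_sdiff.2 ⟨?_, fun hxJ => ?_⟩, ?_⟩
    · rw [Multiset.mem_toFinset]
      exact hQT x (Multiset.count_pos.1 (by omega))
    · have := hQJ x hxJ
      omega
    · exact lt_of_lt_of_le hx (Multiset.count_le_of_le x (hVA.trans (Multiset.filter_le _ _)))
  choose! c hcm hcc using hex
  -- Two atoms charged to the same `y` would need `2 * (T.count y + 1)` copies of `y`, more than two
  -- copies of `T` supply.
  have hnodup : (F.map c).Nodup := by
    rw [Multiset.nodup_iff_count_le_one]
    intro y
    by_contra hcon
    push Not at hcon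
    rw [Multiset.count_map] at hcon
    obtain ⟨A, hA⟩ : ∃ A, A ∈ F.filter fun a => y = c a :=
      Multiset.exists_mem_of_ne_zero (Multiset.card_pos.1 (by omega))
    obtain ⟨hAF, hyA⟩ := Multiset.mem_filter.1 hA
    have h1 := card_mul_le_count_sum (x := y) (k := T.count y + 1) (F.filter fun a => y = c a)
      fun V hV => by
        obtain ⟨hVF, hyV⟩ := Multiset.mem_filter.1 hV
        have := hcc V hVF
        rw [← hyV] at this
        exact this
    have h2 : (F.filter fun a => y = c a).sum ≤ F.sum := by
      conv_rhs => rw [← Multiset.filter_add_not (fun a => y = c a) F, Multiset.sum_add]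
      exact Multiset.le_add_right _ _
    have h3 := Multiset.count_le_of_le y h2
    have hyT : y ∈ T := Multiset.mem_toFinset.1 (Finset.mem_sdiff.1 (hyA ▸ hcm A hAF)).1
    rw [hFs, Multiset.count_add, Multiset.count_eq_zero_of_notMem (s := Multiset.replicate 2 (-g))
      fun h => (hT.2.1 y hyT).2.2 (Multiset.eq_of_mem_replicate h), add_zero] at h3
    have h4 := hQ2 y
    have h6 : 2 * (T.count y + 1) ≤ Multiset.card (F.filter fun a => y = c a) * (T.count y + 1) :=
      Nat.mul_le_mul_right _ hcon
    omega
  have hFc : Multiset.card F ≤ n - 1 - J.card := by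
    rw [← Multiset.card_map c F, ← Multiset.toFinset_card_of_nodup hnodup, ← hcard,
      ← Finset.card_sdiff_of_subset (Finset.filter_subset _ _)]
    refine Finset.card_le_card fun x hx => ?_
    rw [Multiset.mem_toFinset] at hx
    obtain ⟨A, hA, rfl⟩ := Multiset.mem_map.1 hx
    exact hcm A hA
  have hJle : J.card ≤ n - 1 := hcard ▸ Finset.card_filter_le _ _
  obtain ⟨m, hm⟩ : ∃ m, J.card + Multiset.card F = m + 2 := ⟨J.card + Multiset.card F - 2, by omega⟩
  have h6 : ((2 : ℕ) : ℤ) - ((m + 2 : ℕ) : ℤ) = -(m : ℤ) := by push_cast; ring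
  rw [hm, h6, dvd_neg] at h5
  have h7 := Nat.eq_zero_of_dvd_of_lt (Int.natCast_dvd_natCast.1 h5) (by omega)
  omega

include hn hexp hU hg hg' hgn in
/-- A block with sum `g` and support of size `n - 1` is squarefree and consists of elements of
order `n`. -/
theorem IsBlock.count_eq_one [DecidableEq G] {T : Multiset G} (hT : IsBlock G₀ g T)
    (hs : T.sum = g) (hcard : T.toFinset.card = n - 1) :
    ∀ x ∈ T, T.count x = 1 ∧ addOrderOf x = n := by
  have hn0 : 0 < n := by omega
  have hgT : g ∉ T := fun h => (hT.2.1 g h).2.1 rfl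
  obtain ⟨-, hatom, hlt⟩ := hT.card_support hn hexp hU hg hgn hs
  replace hatom := hatom hcard
  set T' := strips T.toFinset - T with hT'
  have hle : T ≤ strips T.toFinset := by
    rw [Multiset.le_iff_count]
    intro x
    rw [count_strips]
    split_ifs with h
    · exact (hlt x).le
    · rw [Multiset.mem_toFinset] at h
      rw [Multiset.count_eq_zero_of_notMem h]
  have hT's : T'.sum = -g := by rw [hT', sum_sub_eq hle, sum_strips, hs, zero_sub]
  have hcount : ∀ x ∈ T, T'.count x + T.count x = addOrderOf x := by
    intro x hx
    rw [hT', Multiset.count_sub, count_strips, if_pos (Multiset.mem_toFinset.2 hx)]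
    have := hlt x
    omega
  have hT'T : ∀ x ∈ T', x ∈ T := fun x hx => by
    have h1 := Multiset.mem_of_le (Multiset.sub_le_self _ _) hx
    exact Multiset.mem_toFinset.1 (mem_of_mem_strips h1)
  have hsupp : T'.toFinset = T.toFinset := by
    ext x
    rw [Multiset.mem_toFinset, Multiset.mem_toFinset]
    refine ⟨hT'T x, fun hx => ?_⟩
    have h1 := hcount x hx
    have h2 := hlt x
    exact Multiset.count_pos.1 (by omega)
  have hgT' : g ∉ T' := fun h => hgT (hT'T g h)
  obtain ⟨F, hF, hFs⟩ := exists_block_factorization (G₀ := G₀) (g := g) (B := T')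
    (fun x hx => hT.2.1 x (hT'T x hx))
    (by rw [hT's]; exact neg_mem (AddSubgroup.mem_zmultiples g))
  -- Sum zero contradicts that `T' g` is an atom. Sum `-g` makes `T'` itself a block; then `T` and
  -- `T'` are both subject to `card_filter_le_one`, yet every element has at least half its order as
  -- multiplicity in one of them, so `n - 1 ≤ 2`.
  have hall : ∀ V ∈ F, V.sum = g := by
    intro V hV
    have hVT' : V ≤ T' := hFs ▸ mem_sum_of_mem hV
    rcases (hF V hV).sum_eq hn hexp hU hg hg' hgn with h | h | h
    · have h1 := hatom.eq_of_le (hVT'.trans (Multiset.le_add_right _ _)) (hF V hV).1 h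
      have : g ∈ V := by rw [h1]; simp
      exact absurd rfl ((hF V hV).2.1 g this).2.1
    · exact h
    · exfalso
      have h1 := hatom.eq_of_le (add_le_add_left hVT' {g}) (by simp)
        (by rw [Multiset.sum_add, h, Multiset.sum_singleton, neg_add_cancel])
      have h2 : V = T' := add_right_cancel h1
      have hblock : IsBlock G₀ g T' := h2 ▸ hF V hV
      have h3 := hT.card_filter_le_one hn hexp hU hg hg' hgn hs hcard
      have h4 := hblock.neg.card_filter_le_one hn hexp hU hg' (by rwa [neg_neg])
        (by rwa [addOrderOf_neg]) hT's (by rw [hsupp, hcard])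
      rw [hsupp] at h4
      have h5 : T.toFinset ⊆ (T.toFinset.filter fun y => addOrderOf y ≤ 2 * T.count y) ∪
          (T.toFinset.filter fun y => addOrderOf y ≤ 2 * T'.count y) := by
        intro x hx
        have := hcount x (Multiset.mem_toFinset.1 hx)
        rw [Finset.mem_union, Finset.mem_filter, Finset.mem_filter]
        by_cases hc : addOrderOf x ≤ 2 * T.count x
        · exact Or.inl ⟨hx, hc⟩
        · exact Or.inr ⟨hx, by omega⟩
      have h6 := (Finset.card_le_card h5).trans (Finset.card_union_le _ _)
      omega
  -- The blocks sum to `-g` in total and to `g` each. As each has full support, every element occurs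
  -- at least `n - 1` times in `T'`, leaving a single copy for `T`.
  have hcF : n - 1 ≤ Multiset.card F := by
    have h1 : Multiset.card F • g = -g := by
      have h2 : F.map (⇑Multiset.sumAddMonoidHom) = F.map fun _ => g :=
        Multiset.map_congr rfl fun V hV => hall V hV
      rw [← hT's, ← hFs, ← Multiset.coe_sumAddMonoidHom, map_multiset_sum, h2,
        Multiset.map_const', Multiset.sum_replicate]
    have h2 : (Multiset.card F + 1) • g = 0 := by rw [succ_nsmul, h1, neg_add_cancel]
    have h3 := addOrderOf_dvd_of_nsmul_eq_zero h2
    rw [hgn] at h3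
    have := Nat.le_of_dvd (by omega) h3
    omega
  intro x hx
  have h1 := card_mul_le_count_sum (x := x) (k := 1) F fun V hV => by
    have hne : V.sum ≠ 0 := by
      rw [hall V hV]
      rintro rfl
      rw [addOrderOf_zero] at hgn
      omega
    have h2 := (hF V hV).le_card_support hn hexp hU hg hg' hgn hne
    have h3 : V.toFinset ⊆ T.toFinset := fun y hy => by
      rw [Multiset.mem_toFinset] at hy ⊢
      exact hT'T y (hFs ▸ Multiset.mem_of_le (mem_sum_of_mem hV) hy)
    have h4 := Finset.eq_of_subset_of_card_le h3 (by omega)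
    rw [← Multiset.mem_toFinset, ← h4, Multiset.mem_toFinset] at hx
    exact Multiset.count_pos.2 hx
  rw [hFs] at h1
  have h2 := hcount x hx
  have h3 := Multiset.count_pos.2 hx
  have h4 := order_le hn0 hexp x
  omega

end blocks

/-! ### Independent sets of elements of order `n` -/

/-- The elements of `Y` generate a direct sum of cyclic groups of order divisible by `n`. -/
def Indep (n : ℕ) (Y : Finset G) : Prop :=
  ∀ z : G → ℤ, ∑ y ∈ Y, z y • y = 0 → ∀ y ∈ Y, (n : ℤ) ∣ z y

theorem Indep.injective {n : ℕ} {Y : Finset G} (h : Indep n Y) :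
    Function.Injective fun a : Y → Fin n => ∑ y : Y, (a y : ℕ) • (y : G) := by
  classical
  intro a b hab
  have h1 := h (fun y => if hy : y ∈ Y then ((a ⟨y, hy⟩ : ℕ) : ℤ) - ((b ⟨y, hy⟩ : ℕ) : ℤ) else 0) (by
    rw [← Finset.sum_coe_sort]
    simp only [Finset.coe_mem, dif_pos, sub_smul, natCast_zsmul, Finset.sum_sub_distrib]
    exact sub_eq_zero.2 hab)
  funext y
  have h2 := h1 y y.2
  rw [dif_pos y.2] at h2
  have h3 := Int.eq_zero_of_abs_lt_dvd h2 (by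
    have := (a y).2
    have := (b y).2
    rw [abs_lt]
    constructor <;> simp only [Subtype.coe_eta] <;> omega)
  ext
  simp only [Subtype.coe_eta] at h3
  omega

theorem Indep.pow_card_le [Finite G] {n : ℕ} {Y : Finset G} (h : Indep n Y) :
    n ^ Y.card ≤ Nat.card G := by
  classical
  have := Nat.card_le_card_of_injective _ h.injective
  simpa using this

theorem Indep.exists_coords [Finite G] {n : ℕ} (hn : 0 < n) {Y : Finset G} (h : Indep n Y)
    (hc : Nat.card G ≤ n ^ Y.card) (x : G) :
    ∃ b : G → ℕ, (∀ y, b y < n) ∧ ∑ y ∈ Y, b y • y = x := by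
  classical
  obtain ⟨a, ha⟩ := (h.injective.bijective_of_nat_card_le (by simpa using hc)).2 x
  refine ⟨fun y => if hy : y ∈ Y then a ⟨y, hy⟩ else 0, fun y => ?_, ?_⟩
  · dsimp only
    split_ifs
    exacts [Fin.is_lt _, hn]
  · rw [← ha, ← Finset.sum_coe_sort]
    simp only [Finset.coe_mem, dif_pos]

theorem sum_eq_sum_of_subset [DecidableEq G] {Y : Finset G} {B : Multiset G} (h : ∀ x ∈ B, x ∈ Y) :
    B.sum = ∑ y ∈ Y, B.count y • y := by
  rw [Finset.sum_multiset_count]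
  refine Finset.sum_subset (fun x hx => h x (Multiset.mem_toFinset.1 hx)) fun x _ hx => ?_
  rw [Multiset.mem_toFinset] at hx
  rw [Multiset.count_eq_zero_of_notMem hx, zero_smul]

theorem count_sum_replicate [DecidableEq G] (Y : Finset G) (c : G → ℕ) (x : G) :
    (∑ y ∈ Y, Multiset.replicate (c y) y).count x = if x ∈ Y then c x else 0 := by
  rw [Multiset.count_sum']
  simp only [Multiset.count_replicate]
  simp

theorem sum_sum_replicate (Y : Finset G) (c : G → ℕ) :
    (∑ y ∈ Y, Multiset.replicate (c y) y).sum = ∑ y ∈ Y, c y • y := by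
  rw [← Multiset.coe_sumAddMonoidHom, map_sum]
  simp

section blocks

variable {n : ℕ} (hn : 4 ≤ n) (hexp : ∀ x : G, n • x = 0) {G₀ : Set G}
  (hU : UniformLengths (n - 2) G₀) {g : G} (hg : g ∈ G₀) (hg' : -g ∈ G₀) (hgn : addOrderOf g = n)

include hn hexp hU hg hg' hgn in
-- Reduce a relation modulo `n` to coefficients `v` and form `∏ y^(v y₀ - v y)` with `v y₀` maximal.
-- Its sum is `v y₀ • g` and it misses `y₀`, so its blocks have support too small for a nonzero sum;
-- hence `v y₀ = 0`.
theorem IsBlock.indep [DecidableEq G] {T : Multiset G} (hT : IsBlock G₀ g T) (hs : T.sum = g)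
    (hcard : T.toFinset.card = n - 1) : ∑ y ∈ T.toFinset, y = g ∧ Indep n T.toFinset := by
  have hn0 : 0 < n := by omega
  have hone := hT.count_eq_one hn hexp hU hg hg' hgn hs hcard
  set Y := T.toFinset with hY
  have hYT : ∀ y, y ∈ Y ↔ y ∈ T := fun y => Multiset.mem_toFinset
  have hYs : ∑ y ∈ Y, y = g := by
    rw [← hs, sum_eq_sum_of_subset fun x hx => (hYT x).2 hx]
    refine Finset.sum_congr rfl fun y hy => ?_
    rw [(hone y ((hYT y).1 hy)).1, one_smul]
  refine ⟨hYs, fun z hz => ?_⟩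
  obtain ⟨v, hv⟩ : ∃ v : G → ℕ, ∀ y, (v y : ℤ) = z y % n :=
    ⟨fun y => (z y % n).toNat, fun y => Int.toNat_of_nonneg (Int.emod_nonneg _ (by omega))⟩
  have hvs : ∑ y ∈ Y, v y • y = 0 := by
    rw [← hz]
    refine Finset.sum_congr rfl fun y _ => ?_
    rw [← natCast_zsmul, hv]
    conv_rhs => rw [← Int.emod_add_mul_ediv (z y) n, add_smul, mul_comm, mul_smul, natCast_zsmul,
      hexp, smul_zero, add_zero]
  have hYne : Y.Nonempty := Finset.card_pos.1 (by omega)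
  obtain ⟨y₀, hy₀, hmax⟩ := Finset.exists_max_image Y v hYne
  set R : Multiset G := ∑ y ∈ Y, Multiset.replicate (v y₀ - v y) y with hR
  have hRc : ∀ x ∈ R, x ∈ Y ∧ x ≠ y₀ := by
    intro x hx
    have h1 := Multiset.count_pos.2 hx
    rw [hR, count_sum_replicate] at h1
    split_ifs at h1 with h2
    · exact ⟨h2, by rintro rfl; omega⟩
    · omega
  have hRs : R.sum = v y₀ • g := by
    rw [hR, sum_sum_replicate, ← hYs, Finset.smul_sum, ← sub_zero (∑ y ∈ Y, v y₀ • y), ← hvs,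
      ← Finset.sum_sub_distrib]
    refine Finset.sum_congr rfl fun y hy => ?_
    rw [eq_sub_iff_add_eq, ← add_smul, Nat.sub_add_cancel (hmax y hy)]
  obtain ⟨F, hF, hFs⟩ := exists_block_factorization (G₀ := G₀) (g := g) (B := R)
    (fun x hx => hT.2.1 x ((hYT x).1 (hRc x hx).1))
    (by rw [hRs]; exact AddSubgroup.nsmul_mem _ (AddSubgroup.mem_zmultiples g) _)
  have hR0 : R.sum = 0 := by
    rw [← hFs, ← Multiset.coe_sumAddMonoidHom, map_multiset_sum]
    refine Multiset.sum_eq_zero fun y hy => ?_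
    obtain ⟨V, hV, rfl⟩ := Multiset.mem_map.1 hy
    rw [Multiset.coe_sumAddMonoidHom]
    by_contra hne
    have h1 := (hF V hV).le_card_support hn hexp hU hg hg' hgn hne
    have h2 : V.toFinset ⊆ Y.erase y₀ := fun x hx => by
      have := hRc x (hFs ▸ Multiset.mem_of_le (mem_sum_of_mem hV) (Multiset.mem_toFinset.1 hx))
      exact Finset.mem_erase.2 ⟨this.2, this.1⟩
    have h3 := Finset.card_le_card h2
    rw [Finset.card_erase_of_mem hy₀] at h3
    omega
  have hlt : ∀ y, v y < n := fun y => by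
    have := Int.emod_lt_of_pos (z y) (by omega : (0 : ℤ) < n)
    rw [← hv] at this
    omega
  rw [hRs] at hR0
  have h0 := addOrderOf_dvd_of_nsmul_eq_zero hR0
  rw [hgn] at h0
  have h1 := Nat.eq_zero_of_dvd_of_lt h0 (hlt y₀)
  intro y hy
  apply Int.dvd_of_emod_eq_zero
  rw [← hv]
  have := hmax y hy
  omega

include hn hexp hU hg hg' hgn in
-- By cardinality `Y` is a basis, so `x` has coordinates `b`. For `b l ≠ 0`, completing `x` to a
-- multiple of `g` without using `l` yields a block of support `n - 1`, which must be squarefree;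
-- this prescribes all coordinates, and only those of elements of `Y` are consistent.
theorem IsBlock.mem_of_mem [Finite G] [DecidableEq G] {T : Multiset G} (hT : IsBlock G₀ g T)
    (hs : T.sum = g) (hcard : T.toFinset.card = n - 1) (hG : Nat.card G ≤ n ^ (n - 1))
    {x : G} (hx : x ∈ G₀) (hxg : x ≠ g) (hxg' : x ≠ -g) (hx0 : x ≠ 0) : x ∈ T.toFinset := by
  have hn0 : 0 < n := by omega
  obtain ⟨hYs, hind⟩ := hT.indep hn hexp hU hg hg' hgn hs hcard
  set Y := T.toFinset with hY
  by_contra hxY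
  obtain ⟨b, hb, hbx⟩ := hind.exists_coords hn0 (by rwa [hcard]) x
  have hkey : ∀ l ∈ Y, b l = 0 ∨ ((b l = 1 ∨ b l = n - 1) ∧
      ∀ y ∈ Y, y ≠ l → (n : ℤ) ∣ (b l : ℤ) - b y - 1) := by
    intro l hl
    -- The multiplicities `c y ≡ b l - b y` bring all coordinates of `x` up to `b l`, and `c l = 0`.
    obtain ⟨c, hcn, hc⟩ : ∃ c : G → ℕ, (∀ y, c y < n) ∧
        ∀ y, (n : ℤ) ∣ (b l : ℤ) - b y - c y := by
      refine ⟨fun y => (b l + (n - b y)) % n, fun y => Nat.mod_lt _ hn0, fun y => ?_⟩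
      have h1 := hb y
      have h2 : ((b l + (n - b y) : ℕ) : ℤ) = (b l : ℤ) - b y + n := by
        push_cast [Nat.cast_sub h1.le]; ring
      have h3 := Int.emod_add_mul_ediv ((b l : ℤ) - b y + n) n
      rw [← h2] at h3
      refine ⟨((b l + (n - b y) : ℕ) : ℤ) / n - 1, ?_⟩
      push_cast at h3 h2 ⊢
      linarith
    have hcl : c l = 0 := by
      have := hc l
      rw [sub_self, zero_sub, dvd_neg] at this
      exact Nat.eq_zero_of_dvd_of_lt (Int.natCast_dvd_natCast.1 this) (hcn l)
    set V : Multiset G := ∑ y ∈ Y, Multiset.replicate (c y) y with hV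
    have hVc : ∀ y, V.count y = if y ∈ Y then c y else 0 := count_sum_replicate Y c
    have hVY : ∀ y ∈ V, y ∈ Y := by
      intro y hy
      by_contra h
      have := Multiset.count_pos.2 hy
      rw [hVc, if_neg h] at this
      omega
    have hVs : V.sum = ∑ y ∈ Y, c y • y := sum_sum_replicate Y c
    have hTl : (x ::ₘ V).sum = b l • g := by
      rw [Multiset.sum_cons, hVs]
      nth_rewrite 1 [← hbx]
      rw [← Finset.sum_add_distrib, ← hYs, Finset.smul_sum]
      refine Finset.sum_congr rfl fun y _ => ?_
      obtain ⟨k, hk⟩ := hc y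
      rw [← add_smul, ← natCast_zsmul, ← natCast_zsmul,
        show (b l : ℤ) = ((b y + c y : ℕ) : ℤ) + k * n by push_cast; linarith, add_smul,
        mul_smul, natCast_zsmul y n, hexp, smul_zero, add_zero]
    have hdiv : ∀ (V' : Multiset G) (ε : ℕ) (k : ℤ), (∀ y ∈ V', y ∈ Y) → V' ≤ V →
        ε • x + V'.sum = k • g →
        ∀ y ∈ Y, (n : ℤ) ∣ ε * b y + V'.count y - k := by
      intro V' ε k hV'Y hle hsum
      refine hind (fun y => (ε : ℤ) * b y + V'.count y - k) ?_
      simp only [sub_smul, add_smul, mul_smul, Finset.sum_sub_distrib, Finset.sum_add_distrib,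
        natCast_zsmul, ← Finset.smul_sum, hbx]
      rw [← sum_eq_sum_of_subset hV'Y, hsum, ← Finset.smul_sum, hYs, sub_self]
    have hblock : IsBlock G₀ g (x ::ₘ V) := by
      refine ⟨Multiset.cons_ne_zero, fun y hy => ?_, ?_, fun T' hT' hT'0 hT's => ?_⟩
      · rcases Multiset.mem_cons.1 hy with rfl | hy
        · exact ⟨hx, hxg, hxg'⟩
        · exact hT.2.1 y (Multiset.mem_toFinset.1 (hVY y hy))
      · rw [hTl]; exact AddSubgroup.nsmul_mem _ (AddSubgroup.mem_zmultiples g) _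
      · obtain ⟨k, hk⟩ := AddSubgroup.mem_zmultiples_iff.1 hT's
        by_cases hxT : x ∈ T'
        · obtain ⟨V', rfl⟩ := Multiset.exists_cons_of_mem hxT
          have hV'V : V' ≤ V := (Multiset.cons_le_cons_iff x).1 hT'
          rw [Multiset.sum_cons] at hk
          have h1 := hdiv V' 1 k (fun y hy => hVY y (Multiset.mem_of_le hV'V hy)) hV'V
            (by rw [one_smul, hk])
          congr 1
          refine le_antisymm hV'V ?_
          rw [Multiset.le_iff_count]
          intro y
          have h2 := Multiset.count_le_of_le y hV'V
          rw [hVc] at h2 ⊢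
          split_ifs at h2 ⊢ with hy
          · have h3 := h1 l hl
            have h4 := h1 y hy
            have h5 := Multiset.count_le_of_le l hV'V
            rw [hVc, if_pos hl, hcl] at h5
            have h6 : V'.count l = 0 := by omega
            rw [h6] at h3
            have h7 : (n : ℤ) ∣ (c y : ℤ) - V'.count y := by
              have := Int.dvd_sub (Int.dvd_sub h3 h4) (hc y)
              convert this using 1
              push_cast; ring
            have h8 := Int.eq_zero_of_abs_lt_dvd h7 (by
              have := hcn y
              rw [abs_lt]; omega)
            omega
          · exact Nat.zero_le _
        · have hT'V : T' ≤ V := (Multiset.le_cons_of_notMem hxT).1 hT'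
          have h1 := hdiv T' 0 k (fun y hy => hVY y (Multiset.mem_of_le hT'V hy)) hT'V
            (by rw [zero_smul, zero_add, hk])
          exfalso
          apply hT'0
          rw [Multiset.eq_zero_iff_forall_notMem]
          intro y hy
          have hyY := hVY y (Multiset.mem_of_le hT'V hy)
          have h3 := h1 l hl
          have h4 := h1 y hyY
          have h5 := Multiset.count_le_of_le l hT'V
          rw [hVc, if_pos hl, hcl] at h5
          have h6 : T'.count l = 0 := by omega
          rw [h6] at h3
          have h7 : (n : ℤ) ∣ (T'.count y : ℤ) := by
            have := Int.dvd_sub h4 h3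
            convert this using 1
            push_cast; ring
          have h8 := Multiset.count_le_of_le y hT'V
          rw [hVc, if_pos hyY] at h8
          have h9 := Nat.eq_zero_of_dvd_of_lt (Int.natCast_dvd_natCast.1 h7) (h8.trans_lt (hcn y))
          have := Multiset.count_pos.2 hy
          omega
    have hgord : ∀ j : ℕ, j < n → j • g = 0 → j = 0 := fun j hj h => by
      have := addOrderOf_dvd_of_nsmul_eq_zero h
      rw [hgn] at this
      exact Nat.eq_zero_of_dvd_of_lt this hj
    by_cases hbl : b l = 0
    · exact Or.inl hbl
    right
    have hne : (x ::ₘ V).sum ≠ 0 := fun h => hbl (hgord _ (hb l) (hTl ▸ h))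
    have hsub : (x ::ₘ V).toFinset ⊆ insert x (Y.erase l) := by
      intro y hy
      rw [Multiset.mem_toFinset, Multiset.mem_cons] at hy
      rcases hy with rfl | hy
      · exact Finset.mem_insert_self _ _
      · refine Finset.mem_insert_of_mem (Finset.mem_erase.2 ⟨?_, hVY y hy⟩)
        rintro rfl
        have := Multiset.count_pos.2 hy
        rw [hVc, if_pos hl] at this
        omega
    have hcardi : (insert x (Y.erase l)).card = n - 1 := by
      rw [Finset.card_insert_of_notMem fun h => hxY (Finset.mem_of_mem_erase h),
        Finset.card_erase_of_mem hl]
      omega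
    have hle := hblock.le_card_support hn hexp hU hg hg' hgn hne
    have heq : (x ::ₘ V).toFinset = insert x (Y.erase l) :=
      Finset.eq_of_subset_of_card_le hsub (by omega)
    have hc1 : (x ::ₘ V).toFinset.card = n - 1 := by rw [heq, hcardi]
    have hsums := (hblock.sum_eq hn hexp hU hg hg' hgn).resolve_left hne
    have hone : ∀ y ∈ x ::ₘ V, (x ::ₘ V).count y = 1 ∧ addOrderOf y = n := by
      rcases hsums with h | h
      · exact hblock.count_eq_one hn hexp hU hg hg' hgn h hc1
      · exact hblock.neg.count_eq_one hn hexp hU hg' (by rwa [neg_neg]) (by rwa [addOrderOf_neg])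
          h hc1
    refine ⟨?_, fun y hy hyl => ?_⟩
    · rw [hTl] at hsums
      rcases hsums with h | h
      · left
        have h1 : (b l - 1) • g = 0 := by
          have : (b l - 1) • g + 1 • g = 1 • g := by
            rw [← add_smul, Nat.sub_add_cancel (by omega), h, one_smul]
          exact add_eq_right.1 this
        have := hgord _ (by have := hb l; omega) h1
        omega
      · right
        have h1 : (b l + 1) • g = 0 := by rw [succ_nsmul, h, neg_add_cancel]
        have := addOrderOf_dvd_of_nsmul_eq_zero h1
        rw [hgn] at this
        have := Nat.le_of_dvd (by omega) this
        have := hb l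
        omega
    · have h1 : y ∈ x ::ₘ V := by
        rw [← Multiset.mem_toFinset, heq]
        exact Finset.mem_insert_of_mem (Finset.mem_erase.2 ⟨hyl, hy⟩)
      have h2 := (hone y h1).1
      rw [Multiset.count_cons_of_ne (by rintro rfl; exact hxY hy), hVc, if_pos hy] at h2
      have := hc y
      rwa [h2] at this
  -- If `b l = 1`, the other coordinates vanish and `x = l`. If `b l = n - 1`, the others equal `n -
  -- 2`, which for `n ≥ 4` is none of `0`, `1`, `n - 1`.
  have hzero : ∀ l ∈ Y, b l = 0 := by
    intro l hl
    rcases hkey l hl with h | ⟨h1 | h1, h2⟩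
    · exact h
    · exfalso
      apply hxY
      have : x = l := by
        rw [← hbx, Finset.sum_eq_single_of_mem l hl fun y hy hyl => ?_, h1, one_smul]
        have h3 := h2 y hy hyl
        rw [h1, show ((1 : ℕ) : ℤ) - b y - 1 = -(b y : ℤ) by push_cast; ring, dvd_neg] at h3
        rw [Nat.eq_zero_of_dvd_of_lt (Int.natCast_dvd_natCast.1 h3) (hb y), zero_smul]
      rwa [this]
    · exfalso
      obtain ⟨y, hy, hyl⟩ := Finset.exists_mem_ne (s := Y) (by omega) l
      have h3 := h2 y hy hyl
      have h4 : (b y : ℤ) = n - 2 := by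
        have h5 : (n : ℤ) ∣ (n : ℤ) - 2 - b y := by
          convert h3 using 1
          rw [h1]; push_cast [Nat.cast_sub (by omega : 1 ≤ n)]; ring
        have := Int.eq_zero_of_abs_lt_dvd h5 (by
          have := hb y
          rw [abs_lt]; omega)
        omega
      rcases hkey y hy with h5 | ⟨h5 | h5, -⟩ <;> omega
  apply hx0
  rw [← hbx]
  exact Finset.sum_eq_zero fun y hy => by rw [hzero y hy, zero_smul]

include hn hexp hU hg hg' hgn in
/-- If some block has nonzero sum, then `G` is homocyclic and `G₀` is contained in an explicit
set. -/
theorem exists_basis_of_block [Finite G] {r : ℕ} {f : (Fin r → ℤ) →+ G}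
    (hf : Function.Surjective f) (hr : r + 1 = n) (hG : Nat.card G ≤ n ^ (n - 1))
    (h : ∃ T, IsBlock G₀ g T ∧ T.sum ≠ 0) :
    ∃ (Y : Finset G) (h : G), Y.card = n - 1 ∧ Indep n Y ∧ ∑ y ∈ Y, y = h ∧ addOrderOf h = n ∧
      ∀ x ∈ G₀, x = 0 ∨ x = h ∨ x = -h ∨ x ∈ Y := by
  classical
  obtain ⟨T, hT, hs, hc⟩ := exists_block_card_support hn hexp hU hg hg' hgn hf hr h
  rcases (hT.sum_eq hn hexp hU hg hg' hgn).resolve_left hs with h | h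
  · obtain ⟨h1, h2⟩ := hT.indep hn hexp hU hg hg' hgn h hc
    refine ⟨T.toFinset, g, hc, h2, h1, hgn, fun x hx => ?_⟩
    by_contra hcon
    push Not at hcon
    exact hcon.2.2.2 (hT.mem_of_mem hn hexp hU hg hg' hgn h hc hG hx hcon.2.1 hcon.2.2.1 hcon.1)
  · have hgn' : addOrderOf (-g) = n := by rwa [addOrderOf_neg]
    have hg'' : - -g ∈ G₀ := by rwa [neg_neg]
    obtain ⟨h1, h2⟩ := hT.neg.indep hn hexp hU hg' hg'' hgn' h hc
    refine ⟨T.toFinset, -g, hc, h2, h1, hgn', fun x hx => ?_⟩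
    by_contra hcon
    push Not at hcon
    exact hcon.2.2.2 (hT.neg.mem_of_mem hn hexp hU hg' hg'' hgn' h hc hG hx hcon.2.1 hcon.2.2.1
      hcon.1)

end blocks

/-- Modulo `c * d` the weight of a sequence is `c` times the length of any of its factorizations. -/
theorem uniformLengths_of_weight {d : ℕ} {G₀ : Set G} (φ : G → ℤ) {c : ℤ} (hc : c ≠ 0)
    (h : ∀ A, IsAtom G₀ A → c * d ∣ (A.map φ).sum - c) : UniformLengths d G₀ := by
  have key : ∀ F : Multiset (Multiset G), (∀ A ∈ F, IsAtom G₀ A) →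
      c * d ∣ (F.sum.map φ).sum - c * Multiset.card F := by
    intro F hF
    induction F using Multiset.induction with
    | empty => simp
    | cons A F ih =>
      have h1 := h A (hF A (Multiset.mem_cons_self _ _))
      have h2 := ih fun B hB => hF B (Multiset.mem_cons_of_mem hB)
      rw [Multiset.sum_cons, Multiset.map_add, Multiset.sum_add, Multiset.card_cons]
      have h3 := Int.dvd_add h1 h2
      convert h3 using 1
      push_cast; ring
  intro F F' hF hF' hs
  have h1 := Int.dvd_sub (key F' hF') (key F hF)
  rw [hs] at h1
  refine Int.dvd_of_mul_dvd_mul_left hc ?_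
  convert h1 using 1
  ring

/-! ### Elasticity when all blocks have sum zero -/

section no_blocks

variable {n : ℕ} (hn : 4 ≤ n) (hexp : ∀ x : G, n • x = 0) {G₀ : Set G}

include hn hexp in
/-- The elasticity of `G₀` when all blocks have sum zero. -/
theorem elasticity_le_of_block_sum_eq_zero (hU : UniformLengths (n - 2) G₀)
    (h : ∀ g ∈ G₀, -g ∈ G₀ → addOrderOf g = n → ∀ T, IsBlock G₀ g T → T.sum = 0) :
    elasticity G₀ ≤ max (ENNReal.ofReal ((n : ℝ) / 2)) (crossNumber G₀) := by
  classical
  have hn0 : 0 < n := by omega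
  have hn' : (4 : ℝ) ≤ n := by exact_mod_cast hn
  -- If `-x` does not occur in `A`, the part of `A` away from `x` decomposes into blocks, so it has
  -- sum zero and the copies of `x` form a zero-sum sequence on their own.
  have hsym : ∀ A, IsAtom G₀ A → ∀ x ∈ A, -x ∈ G₀ ∧ addOrderOf x = n →
      A = {x, -x} ∨ A = strip x := by
    rintro A hA x hx ⟨hx', hxn⟩
    have hpair := isAtom_pair hn hxn (hA.mem hx) hx'
    by_cases hmx : -x ∈ A
    · left
      refine (hA.eq_of_le ?_ hpair.ne_zero hpair.sum_eq).symm
      obtain ⟨B, rfl⟩ := Multiset.exists_cons_of_mem hx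
      refine Multiset.cons_le_cons _ (Multiset.singleton_le.2 ?_)
      refine (Multiset.mem_cons.1 hmx).resolve_left fun h => ?_
      have h2 : 2 • x = 0 := by
        rw [two_nsmul]; nth_rewrite 1 [← h]; exact neg_add_cancel x
      have := Nat.le_of_dvd two_pos (addOrderOf_dvd_of_nsmul_eq_zero h2)
      omega
    · right
      set A₀ := A.filter fun y => y ≠ x with hA₀
      have hdec : A₀ + Multiset.replicate (A.count x) x = A := by
        rw [← Multiset.filter_eq', add_comm]
        exact Multiset.filter_add_not _ A
      have hsum : A₀.sum + A.count x • x = 0 := by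
        rw [← hA.sum_eq]
        conv_rhs => rw [← hdec]
        rw [Multiset.sum_add, Multiset.sum_replicate]
      obtain ⟨F, hF, hFs⟩ := exists_block_factorization (G₀ := G₀) (g := x) (B := A₀)
        (fun y hy => by
          obtain ⟨h1, h2⟩ := Multiset.mem_filter.1 hy
          exact ⟨hA.mem h1, h2, fun h => hmx (h ▸ h1)⟩) (by
          rw [eq_neg_of_add_eq_zero_left hsum]
          exact neg_mem (AddSubgroup.nsmul_mem _ (AddSubgroup.mem_zmultiples x) _))
      have hA₀s : A₀.sum = 0 := by
        rw [← hFs, ← Multiset.coe_sumAddMonoidHom, map_multiset_sum]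
        refine Multiset.sum_eq_zero fun y hy => ?_
        obtain ⟨V, hV, rfl⟩ := Multiset.mem_map.1 hy
        exact h x (hA.mem hx) hx' hxn V (hF V hV)
      rw [hA₀s, zero_add] at hsum
      have h1 := Nat.le_of_dvd (Multiset.count_pos.2 hx) (addOrderOf_dvd_of_nsmul_eq_zero hsum)
      exact hA.eq_strip hn0 hexp h1
  have hnosym : ∀ A, IsAtom G₀ A → (∀ x ∈ A, ¬ (-x ∈ G₀ ∧ addOrderOf x = n)) → n ≤ wt n A := by
    intro A hA hx
    by_contra hlt
    push Not at hlt
    have h1 := wt_eq_of_wt_lt hn0 hexp (by omega) hU hA hlt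
    have h2 := fun x hx => (count_eq_one_of_wt_lt hn0 hexp (by omega) hU hA hlt (g := x) hx).2
    have h3 : Multiset.card A = 2 := by
      have h4 : Multiset.card A ≤ 2 := (card_le_wt hn0 hexp A).trans (by omega)
      have h5 : 0 < Multiset.card A := Multiset.card_pos.2 hA.ne_zero
      by_contra h6
      obtain ⟨x, rfl⟩ := Multiset.card_eq_one.1 (by omega : Multiset.card A = 1)
      rw [wt_singleton, h2 x (Multiset.mem_singleton_self x), Nat.div_self hn0] at h1
      omega
    obtain ⟨x, y, rfl⟩ := Multiset.card_eq_two.1 h3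
    have h4 := hA.sum_eq
    rw [Multiset.sum_pair] at h4
    have h5 : y = -x := eq_neg_of_add_eq_zero_right h4
    exact hx x (by simp) ⟨h5 ▸ hA.mem (by simp), h2 x (by simp)⟩
  -- Weight `1 / 2` on the symmetric elements of order `n` gives `1` for the pairs, which are the
  -- only light atoms, and `n / 2` for their strips.
  let φ : G → ℝ := fun x => if -x ∈ G₀ ∧ addOrderOf x = n then 1 / 2 else ((addOrderOf x : ℝ))⁻¹
  have hval : ∀ A, IsAtom G₀ A → (A.map φ).sum = 1 ∨ (A.map φ).sum = (n : ℝ) / 2 ∨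
      (n ≤ wt n A ∧ (A.map φ).sum = (wt n A : ℝ) / n) := by
    intro A hA
    by_cases hx : ∃ x ∈ A, -x ∈ G₀ ∧ addOrderOf x = n
    · obtain ⟨x, hxA, hx⟩ := hx
      have hφx : φ x = 1 / 2 := if_pos hx
      rcases hsym A hA x hxA hx with h | h
      · left
        have hφx' : φ (-x) = 1 / 2 := if_pos ⟨by rw [neg_neg]; exact hA.mem hxA, by
          rw [addOrderOf_neg]; exact hx.2⟩
        rw [h, Multiset.insert_eq_cons, Multiset.map_cons, Multiset.map_singleton,
          Multiset.sum_cons, Multiset.sum_singleton, hφx, hφx']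
        norm_num
      · right; left
        rw [h, strip, Multiset.map_replicate, Multiset.sum_replicate, hx.2, hφx, nsmul_eq_mul]
        ring
    · right; right
      push Not at hx
      refine ⟨hnosym A hA fun x hxA hx' => hx x hxA hx'.1 hx'.2, ?_⟩
      rw [← real_weight_eq hn0 hexp]
      refine congrArg _ (Multiset.map_congr rfl fun x hxA => ?_)
      exact if_neg fun hx' => hx x hxA hx'.1 hx'.2
  refine elasticity_le_max hn0 hexp φ _ (by linarith) (fun A hA => ?_) fun A hA => ?_
  · rcases hval A hA with h | h | ⟨h1, h⟩
    · rw [h]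
    · rw [h]; linarith
    · rw [h, le_div_iff₀ (by linarith), one_mul]
      exact_mod_cast h1
  · rcases hval A hA with h | h | ⟨-, h⟩
    · exact le_max_of_le_left (by rw [h]; linarith)
    · exact le_max_of_le_left h.le
    · exact le_max_of_le_right h.le

end no_blocks

/-! ### Atoms and elasticity over a basis `Y` together with plus and minus its sum -/

section homocyclic

variable {n : ℕ} (hn : 4 ≤ n) (hexp : ∀ x : G, n • x = 0) {Y : Finset G} {g : G}
  (hY : Indep n Y) (hYc : Y.card = n - 1) (hYs : ∑ y ∈ Y, y = g) (hgn : addOrderOf g = n)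

include hn hY hYc hYs in
theorem Indep.notMem : g ∉ Y ∧ -g ∉ Y ∧ (0 : G) ∉ Y := by
  classical
  have hex : ∀ y : G, ∃ y' ∈ Y, y' ≠ y := fun y => Finset.exists_mem_ne (by omega) y
  have key : ∀ x ∈ Y, ∀ c : ℤ, x + c • g = 0 → (n : ℤ) ∣ 1 + c ∧ (n : ℤ) ∣ c := by
    intro x hx c h
    have h1 := hY (fun y => (if y = x then 1 else 0) + c) (by
      simp only [add_smul, Finset.sum_add_distrib, ite_smul, one_smul, zero_smul,
        Finset.sum_ite_eq', if_pos hx]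
      rw [← Finset.smul_sum, hYs, h])
    obtain ⟨y', hy', hne⟩ := hex x
    have h2 := h1 y' hy'
    have h3 := h1 x hx
    rw [if_neg hne, zero_add] at h2
    rw [if_pos rfl] at h3
    exact ⟨h3, h2⟩
  have hno : ∀ x ∈ Y, ∀ c : ℤ, x + c • g ≠ 0 := by
    intro x hx c h
    obtain ⟨h1, h2⟩ := key x hx c h
    have h3 := Int.dvd_sub h1 h2
    rw [add_sub_cancel_right] at h3
    have := Int.le_of_dvd one_pos h3
    omega
  refine ⟨fun h => hno g h (-1) (by simp), fun h => hno _ h 1 (by simp), fun h => hno _ h 0 (by simp)⟩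

include hn hY hYc hYs hgn in
theorem Indep.dvd_count [DecidableEq G] {B : Multiset G}
    (hB : ∀ x ∈ B, x = 0 ∨ x = g ∨ x = -g ∨ x ∈ Y) (hs : B.sum = 0) :
    ∀ y ∈ Y, (n : ℤ) ∣ (B.count y : ℤ) + B.count g - B.count (-g) := by
  obtain ⟨h1, h2, h3⟩ := hY.notMem hn hYc hYs
  have hg0 : g ≠ 0 := by
    rintro rfl
    rw [addOrderOf_zero] at hgn
    omega
  have hgg : g ≠ -g := by
    intro h
    have h2 : 2 • g = 0 := by
      rw [two_nsmul]; nth_rewrite 1 [h]; exact neg_add_cancel g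
    have := Nat.le_of_dvd two_pos (addOrderOf_dvd_of_nsmul_eq_zero h2)
    omega
  have hsum := sum_eq_sum_of_subset (Y := insert 0 (insert g (insert (-g) Y))) (B := B)
    fun x hx => by simpa using hB x hx
  rw [Finset.sum_insert (by simp [hg0, hg0.symm, h3, eq_comm]), Finset.sum_insert (by simp [hgg, h1]),
    Finset.sum_insert h2, hs, smul_zero, zero_add] at hsum
  refine hY (fun y => (B.count y : ℤ) + B.count g - B.count (-g)) ?_
  simp only [sub_smul, add_smul, Finset.sum_sub_distrib, Finset.sum_add_distrib, natCast_zsmul]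
  rw [← Finset.smul_sum, ← Finset.smul_sum, hYs]
  rw [smul_neg] at hsum
  rw [hsum]
  abel

include hn hexp hY hYc hYs hgn in
-- The zero-sum condition says that the multiplicity of every `y ∈ Y`, plus that of `g`, minus that
-- of `-g`, is divisible by `n`; the cases are the presence or absence of `0`, `g` and `-g`.
theorem Indep.isAtom_cases {G₀ : Set G} {A : Multiset G} (hA : IsAtom G₀ A)
    (hm : ∀ x ∈ A, x = 0 ∨ x = g ∨ x = -g ∨ x ∈ Y) :
    A = {0} ∨ A = {g, -g} ∨ A = Multiset.replicate n g ∨ A = Multiset.replicate n (-g) ∨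
      (∃ y ∈ Y, A = Multiset.replicate n y) ∨ A = {-g} + Y.val ∨
      ∃ a, 0 < a ∧ a < n ∧ A = Multiset.replicate a g + (n - a) • Y.val := by
  classical
  have hn0 : 0 < n := by omega
  obtain ⟨h1, h2, h3⟩ := hY.notMem hn hYc hYs
  have hdvd := hY.dvd_count hn hYc hYs hgn hm hA.sum_eq
  have hrep : ∀ x, n ≤ A.count x → A = Multiset.replicate n x := fun x hx =>
    (hA.eq_of_le (Multiset.le_count_iff_replicate_le.1 hx) (by
      intro h
      have := congrArg Multiset.card h
      rw [Multiset.card_replicate, Multiset.card_zero] at this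
      omega) (by rw [Multiset.sum_replicate, hexp])).symm
  by_cases h0 : (0 : G) ∈ A
  · left
    exact (hA.eq_of_le (Multiset.singleton_le.2 h0) (by simp) (by simp)).symm
  have hm' : ∀ x ∈ A, x = g ∨ x = -g ∨ x ∈ Y := fun x hx =>
    (hm x hx).resolve_left (by rintro rfl; exact h0 hx)
  have hgg : g ≠ -g := by
    intro h
    have h2 : 2 • g = 0 := by
      rw [two_nsmul]; nth_rewrite 1 [h]; exact neg_add_cancel g
    have := Nat.le_of_dvd two_pos (addOrderOf_dvd_of_nsmul_eq_zero h2)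
    omega
  have hYval : ∀ x, Y.val.count x = if x ∈ Y then 1 else 0 := fun x => by
    rw [Multiset.count_eq_of_nodup Y.nodup]; rfl
  by_cases hag : g ∈ A
  · by_cases hag' : -g ∈ A
    · right; left
      refine (hA.eq_of_le ?_ (by simp) (by simp)).symm
      obtain ⟨B, rfl⟩ := Multiset.exists_cons_of_mem hag
      refine Multiset.cons_le_cons _ (Multiset.singleton_le.2 ?_)
      exact (Multiset.mem_cons.1 hag').resolve_left hgg.symm
    · by_cases hna : n ≤ A.count g
      · right; right; left
        exact hrep g hna
      · right; right; right; right; right; right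
        have hpos := Multiset.count_pos.2 hag
        refine ⟨A.count g, hpos, by omega, ?_⟩
        have hcy : ∀ y ∈ Y, A.count y = n - A.count g := by
          intro y hy
          have hlt : A.count y < n := by
            by_contra hcon
            push Not at hcon
            have := hrep y hcon
            rw [this] at hag
            exact h1 ((Multiset.eq_of_mem_replicate hag) ▸ hy)
          have h4 := hdvd y hy
          rw [Multiset.count_eq_zero_of_notMem hag'] at h4
          have h5 : (n : ℤ) ∣ (A.count y : ℤ) + A.count g - n := by
            have := Int.dvd_sub h4 (dvd_refl (n : ℤ))
            simpa using this
          have h6 := Int.eq_zero_of_abs_lt_dvd h5 (by rw [abs_lt]; omega)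
          omega
        ext x
        rw [Multiset.count_add, Multiset.count_replicate, Multiset.count_nsmul, hYval]
        by_cases hxg : x = g
        · subst hxg
          rw [if_pos rfl, if_neg h1, mul_zero, add_zero]
        · rw [if_neg (Ne.symm hxg), zero_add]
          split_ifs with hx
          · rw [hcy x hx, mul_one]
          · rw [mul_zero, Multiset.count_eq_zero]
            intro hxA
            rcases hm' x hxA with h | h | h
            exacts [hxg h, hag' (h ▸ hxA), hx h]
  · rw [Multiset.count_eq_zero_of_notMem hag] at hdvd
    by_cases hag' : -g ∈ A
    · by_cases hna : n ≤ A.count (-g)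
      · right; right; right; left
        exact hrep _ hna
      · right; right; right; right; right; left
        have hpos := Multiset.count_pos.2 hag'
        refine (hA.eq_of_le ?_ (by simp) ?_).symm
        · rw [Multiset.le_iff_count]
          intro x
          rw [Multiset.count_add, Multiset.count_singleton, hYval]
          by_cases hxg : x = -g
          · subst hxg
            rw [if_pos rfl, if_neg h2]
            exact hpos
          · rw [if_neg hxg, zero_add]
            split_ifs with hx
            · by_contra hcon
              have h4 := hdvd x hx
              rw [(by omega : A.count x = 0)] at h4
              have h5 : (n : ℤ) ∣ (A.count (-g) : ℤ) := by simpa using h4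
              have := Nat.le_of_dvd hpos (Int.natCast_dvd_natCast.1 h5)
              omega
            · exact Nat.zero_le _
        · rw [Multiset.sum_add, Multiset.sum_singleton, ← hYs]
          have : Y.val.sum = ∑ y ∈ Y, y := Finset.sum_val Y
          rw [this, neg_add_cancel]
    · right; right; right; right; left
      rw [Multiset.count_eq_zero_of_notMem hag'] at hdvd
      obtain ⟨y, hy⟩ := Multiset.exists_mem_of_ne_zero hA.ne_zero
      have hyY : y ∈ Y := by
        rcases hm' y hy with h | h | h
        exacts [absurd (h ▸ hy) hag, absurd (h ▸ hy) hag', h]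
      refine ⟨y, hyY, hrep y (Nat.le_of_dvd (Multiset.count_pos.2 hy) ?_)⟩
      have := hdvd y hyY
      rw [Nat.cast_zero, add_zero, sub_zero] at this
      exact Int.natCast_dvd_natCast.1 this

include hn hexp hY hYc hYs hgn in
theorem Indep.weight_cases {R : Type*} [CommRing R] {φ : G → R} {c : R} (hφ : ∀ y ∈ Y, φ y = c)
    {G₀ : Set G} {A : Multiset G} (hA : IsAtom G₀ A)
    (hm : ∀ x ∈ A, x = 0 ∨ x = g ∨ x = -g ∨ x ∈ Y) :
    A = {0} ∨ (A.map φ).sum = φ g + φ (-g) ∨ (A.map φ).sum = n * φ g ∨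
      (A.map φ).sum = n * φ (-g) ∨ (A.map φ).sum = n * c ∨
      (A.map φ).sum = φ (-g) + (n - 1) * c ∨
      ∃ a : ℕ, 0 < a ∧ a < n ∧ (A.map φ).sum = a * φ g + (n - a) * ((n - 1) * c) := by
  have hYv : (Y.val.map φ).sum = (n - 1) * c := by
    rw [Multiset.map_congr (g := fun _ => c) rfl fun y hy => hφ y hy, Multiset.map_const',
      Multiset.sum_replicate, ← Finset.card_def, hYc, nsmul_eq_mul, Nat.cast_sub (by omega),
      Nat.cast_one]
  rcases hY.isAtom_cases hn hexp hYc hYs hgn hA hm with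
    rfl | rfl | rfl | rfl | ⟨y, hy, rfl⟩ | rfl | ⟨a, ha0, han, rfl⟩
  · exact Or.inl rfl
  · right; left; simp
  · right; right; left; simp
  · right; right; right; left; simp
  · right; right; right; right; left
    simp [hφ y hy]
  · right; right; right; right; right; left
    rw [Multiset.map_add, Multiset.sum_add, hYv, Multiset.map_singleton, Multiset.sum_singleton]
  · right; right; right; right; right; right
    refine ⟨a, ha0, han, ?_⟩
    rw [Multiset.map_add, Multiset.sum_add, Multiset.map_nsmul, Multiset.sum_nsmul, hYv,
      Multiset.map_replicate, Multiset.sum_replicate, nsmul_eq_mul, nsmul_eq_mul,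
      Nat.cast_sub han.le]

end homocyclic

section homocyclic

variable {n : ℕ} (hn : 4 ≤ n) (hexp : ∀ x : G, n • x = 0) {Y : Finset G} {g : G}
  (hY : Indep n Y) (hYc : Y.card = n - 1) (hYs : ∑ y ∈ Y, y = g) (hgn : addOrderOf g = n)

include hn hgn in
theorem ne_neg_of_addOrderOf : g ≠ 0 ∧ -g ≠ g := by
  constructor
  · rintro rfl
    rw [addOrderOf_zero] at hgn
    omega
  · intro h
    have h2 : 2 • g = 0 := by
      rw [two_nsmul]; nth_rewrite 1 [← h]; exact neg_add_cancel g
    have := Nat.le_of_dvd two_pos (addOrderOf_dvd_of_nsmul_eq_zero h2)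
    omega

include hn hexp hY hYc hYs hgn in
theorem Indep.elasticity_le {G₀ : Set G} (hG₀ : ∀ x ∈ G₀, x = 0 ∨ x = g ∨ x = -g ∨ x ∈ Y) :
    elasticity G₀ ≤ ENNReal.ofReal (((n : ℝ) ^ 2 - n + 1) / (n + 1)) := by
  classical
  obtain ⟨h1, h2, h3⟩ := hY.notMem hn hYc hYs
  obtain ⟨hg0, hgg⟩ := ne_neg_of_addOrderOf hn hgn
  have hN : (4 : ℝ) ≤ n := by exact_mod_cast hn
  have hN0 : (0 : ℝ) < n := by linarith
  set ρ : ℝ := ((n : ℝ) ^ 2 - n + 1) / (n + 1) with hρ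
  have hρ1 : ρ * (n + 1) = (n : ℝ) ^ 2 - n + 1 := by rw [hρ]; field_simp
  have hρge : 1 ≤ ρ := by nlinarith
  have hρn : (n : ℝ) ≤ 2 * ρ := by nlinarith
  have hρle : ρ ≤ n - 1 := by nlinarith
  -- The weights are chosen so that `g (-g)` and each `y^n` have weight `1`, while `(-g)^n` and `g
  -- Y^(n-1)` both have weight `ρ`; the latter equality is what determines `ρ`.
  let φ : G → ℝ := fun x =>
    if x = g then 1 - ρ / n else if x = -g then ρ / n else if x = 0 then 1 else 1 / n
  have hφg : φ g = 1 - ρ / n := if_pos rfl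
  have hφg' : φ (-g) = ρ / n := by simp [φ, hgg]
  have hφ0 : φ 0 = 1 := by simp [φ, hg0, Ne.symm hg0]
  have hφY : ∀ y ∈ Y, φ y = 1 / n := by
    intro y hy
    have e1 : y ≠ g := by rintro rfl; exact h1 hy
    have e2 : y ≠ -g := by rintro rfl; exact h2 hy
    have e3 : y ≠ 0 := by rintro rfl; exact h3 hy
    simp [φ, e1, e2, e3]
  have key : ∀ A, IsAtom G₀ A → 1 ≤ (A.map φ).sum ∧ (A.map φ).sum ≤ ρ := by
    intro A hA
    rcases hY.weight_cases hn hexp hYc hYs hgn hφY hA fun x hx => hG₀ x (hA.mem hx) with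
      rfl | h | h | h | h | h | ⟨a, ha0, han, h⟩
    · rw [Multiset.map_singleton, Multiset.sum_singleton, hφ0]
      exact ⟨le_rfl, hρge⟩
    · rw [h, hφg, hφg', sub_add_cancel]
      exact ⟨le_rfl, hρge⟩
    · rw [h, hφg, mul_sub, mul_one, mul_div_cancel₀ _ hN0.ne']
      constructor <;> linarith
    · rw [h, hφg', mul_div_cancel₀ _ hN0.ne']
      exact ⟨hρge, le_rfl⟩
    · rw [h, mul_one_div, div_self hN0.ne']
      exact ⟨le_rfl, hρge⟩
    · rw [h, hφg', mul_one_div, ← add_div, le_div_iff₀ hN0, div_le_iff₀ hN0]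
      constructor <;> nlinarith
    · have ha0' : (1 : ℝ) ≤ a := by exact_mod_cast ha0
      have han' : (a : ℝ) ≤ n - 1 := by
        have : (a : ℝ) + 1 ≤ n := by exact_mod_cast han
        linarith
      have : (A.map φ).sum = (n * (n - 1) - a * (ρ - 1)) / n := by
        rw [h, hφg]; field_simp; ring
      rw [this, le_div_iff₀ hN0, div_le_iff₀ hN0]
      constructor <;> nlinarith
  exact elasticity_le_of_weight φ ρ hρge (fun A hA => (key A hA).1) fun A hA => (key A hA).2

include hn hexp hY hYc hYs hgn in
/-- The extremal set for the elasticity: a basis `Y` of a homocyclic group of rank `n - 1`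
together with `g` and `-g`, where `g` is the sum of the basis elements. -/
theorem Indep.admissible_and_le_elasticity :
    Admissible (n - 2) {x | x = g ∨ x = -g ∨ x ∈ Y} ∧
      ENNReal.ofReal (((n : ℝ) ^ 2 - n + 1) / (n + 1)) ≤
        elasticity {x | x = g ∨ x = -g ∨ x ∈ Y} := by
  classical
  have hn0 : 0 < n := by omega
  obtain ⟨h1, h2, h3⟩ := hY.notMem hn hYc hYs
  obtain ⟨hg0, hgg⟩ := ne_neg_of_addOrderOf hn hgn
  set G₀ : Set G := {x | x = g ∨ x = -g ∨ x ∈ Y} with hG₀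
  have hord : ∀ y ∈ Y, addOrderOf y = n := by
    intro y hy
    refine Nat.dvd_antisymm (order_dvd hexp y) ?_
    have := hY (fun x => if x = y then (addOrderOf y : ℤ) else 0) (by
      simp only [ite_smul, zero_smul, Finset.sum_ite_eq', if_pos hy, natCast_zsmul,
        addOrderOf_nsmul_eq_zero]) y hy
    rw [if_pos rfl] at this
    exact Int.natCast_dvd_natCast.1 this
  have hcast : ((n - 2 : ℕ) : ℤ) = n - 2 := by rw [Nat.cast_sub (by omega)]; rfl
  have hU : UniformLengths (n - 2) G₀ := by
    -- With weight `n - 1` for `g` and `1` elsewhere, every atom weighs `n` or `n * (n - 1)`.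
    refine uniformLengths_of_weight (fun x => if x = g then (n : ℤ) - 1 else 1) (c := n)
      (by omega) fun A hA => ?_
    rw [hcast]
    have hne : ∀ y ∈ Y, y ≠ g := by
      rintro y hy rfl; exact h1 hy
    rcases hY.weight_cases hn hexp hYc hYs hgn (φ := fun x => if x = g then (n : ℤ) - 1 else 1)
      (c := (1 : ℤ)) (fun y hy => if_neg (hne y hy)) hA fun x hx => Or.inr (hA.mem hx) with
      rfl | h | h | h | h | h | ⟨a, ha0, han, h⟩
    · exfalso
      rcases hA.mem (Multiset.mem_singleton_self 0) with h | h | h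
      exacts [hg0 h.symm, hg0 (neg_eq_zero.1 h.symm), h3 h]
    · rw [h, if_pos rfl, if_neg hgg]; simp
    · rw [h, if_pos rfl]
      exact ⟨1, by ring⟩
    · rw [h, if_neg hgg]; simp
    · rw [h]; simp
    · rw [h, if_neg hgg]; simp
    · rw [h, if_pos rfl]
      exact ⟨1, by ring⟩
  have hYval : ∀ x, Y.val.count x = if x ∈ Y then 1 else 0 := fun x => by
    rw [Multiset.count_eq_of_nodup Y.nodup]; rfl
  have hYsum : Y.val.sum = g := (Finset.sum_val Y).trans hYs
  set A₁ : Multiset G := {g} + (n - 1) • Y.val with hA₁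
  have hA₁c : ∀ x, A₁.count x = (if x = g then 1 else 0) + (n - 1) * if x ∈ Y then 1 else 0 := by
    intro x
    rw [hA₁, Multiset.count_add, Multiset.count_singleton, Multiset.count_nsmul, hYval]
  have hA₁m : ∀ x ∈ A₁, x = g ∨ x ∈ Y := by
    intro x hx
    rcases Multiset.mem_add.1 hx with h | h
    · exact Or.inl (Multiset.mem_singleton.1 h)
    · exact Or.inr (Multiset.mem_of_mem_nsmul h)
  have hA₁a : IsAtom G₀ A₁ := by
    refine isAtom_of_forall (fun x hx => ?_) ?_ ?_ ?_
    · rcases hA₁m x hx with h | h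
      exacts [Or.inl h, Or.inr (Or.inr h)]
    · rw [hA₁, Multiset.sum_add, Multiset.sum_singleton, Multiset.sum_nsmul, hYsum]
      nth_rewrite 1 [← one_nsmul g]
      rw [← add_nsmul, Nat.add_sub_cancel' (by omega), hexp]
    · rw [hA₁]; simp
    · intro T hT hT0 hTs
      have hTm : ∀ x ∈ T, x = g ∨ x ∈ Y := fun x hx => hA₁m x (Multiset.mem_of_le hT hx)
      have hd := hY.dvd_count hn hYc hYs hgn (B := T)
        (fun x hx => (hTm x hx).elim (fun h => Or.inr (Or.inl h)) fun h => Or.inr (Or.inr (Or.inr h)))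
        hTs
      have hTg : -g ∉ T := fun h => (hTm _ h).elim hgg h2
      rw [Multiset.count_eq_zero_of_notMem hTg] at hd
      have hle : ∀ y ∈ Y, T.count y ≤ n - 1 := fun y hy => by
        have := Multiset.count_le_of_le y hT
        rwa [hA₁c, if_neg (by rintro rfl; exact h1 hy), if_pos hy, zero_add, mul_one] at this
      have hleg : T.count g ≤ 1 := by
        have := Multiset.count_le_of_le g hT
        rwa [hA₁c, if_pos rfl, if_neg h1, mul_zero, add_zero] at this
      rcases (by omega : T.count g = 0 ∨ T.count g = 1) with hc | hc
      · exfalso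
        apply hT0
        rw [Multiset.eq_zero_iff_forall_notMem]
        intro x hx
        rcases hTm x hx with rfl | h
        · exact absurd (Multiset.count_pos.2 hx) (by omega)
        · have h4 := hd x h
          rw [hc, Nat.cast_zero, add_zero, sub_zero] at h4
          have h5 := Nat.eq_zero_of_dvd_of_lt (Int.natCast_dvd_natCast.1 h4)
            (by have := hle x h; omega)
          have := Multiset.count_pos.2 hx
          omega
      · refine le_antisymm hT ?_
        rw [Multiset.le_iff_count]
        intro x
        rw [hA₁c]
        by_cases hxg : x = g
        · subst hxg
          rw [if_pos rfl, if_neg h1, hc, mul_zero, add_zero]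
        · rw [if_neg hxg, zero_add]
          split_ifs with hx
          · have h4 := hd x hx
            rw [hc, Nat.cast_one, Nat.cast_zero, sub_zero] at h4
            have := Nat.le_of_dvd (Nat.succ_pos _) (Int.natCast_dvd_natCast.1
              (by exact_mod_cast h4 : (n : ℤ) ∣ ((T.count x + 1 : ℕ) : ℤ)))
            omega
          · simp
  have hstrip : ∀ x, addOrderOf x = n → x ∈ G₀ → IsAtom G₀ (Multiset.replicate n x) := by
    intro x hx hxG
    have := isAtom_strip hn0 hexp hxG
    rwa [strip, hx] at this
  have hgG : g ∈ G₀ := Or.inl rfl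
  have hgG' : -g ∈ G₀ := Or.inr (Or.inl rfl)
  -- The identity `(g Y^(n-1))^n (-g)^n = (g (-g))^n ∏ (y^n)^(n-1)` has `n + 1` atoms on the left
  -- and `n + (n - 1)²` on the right.
  set F : Multiset (Multiset G) := Multiset.replicate n A₁ + {Multiset.replicate n (-g)} with hF
  set F' : Multiset (Multiset G) := Multiset.replicate n {g, -g} +
    (n - 1) • Y.val.map (fun y => Multiset.replicate n y) with hF'
  have hFa : ∀ A ∈ F, IsAtom G₀ A := by
    refine forall_mem_add (fun A hA => (Multiset.eq_of_mem_replicate hA) ▸ hA₁a) fun A hA => ?_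
    rw [Multiset.mem_singleton.1 hA]
    exact hstrip _ (by rw [addOrderOf_neg, hgn]) hgG'
  have hFa' : ∀ A ∈ F', IsAtom G₀ A := by
    refine forall_mem_add (fun A hA => (Multiset.eq_of_mem_replicate hA) ▸
      isAtom_pair hn hgn hgG hgG') (forall_mem_nsmul (fun A hA => ?_) _)
    obtain ⟨y, hy, rfl⟩ := Multiset.mem_map.1 hA
    exact hstrip _ (hord y hy) (Or.inr (Or.inr hy))
  have hs : F.sum = F'.sum := by
    have e1 : ({g, -g} : Multiset G) = {g} + {-g} := rfl
    have e2 : (Y.val.map fun y => Multiset.replicate n y).sum = n • Y.val := by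
      conv_rhs => rw [← Multiset.sum_map_singleton Y.val]
      rw [← Multiset.sum_map_nsmul]
      simp only [Multiset.nsmul_singleton]
    rw [hF, hF', Multiset.sum_add, Multiset.sum_add, Multiset.sum_nsmul, e2, hA₁,
      Multiset.sum_replicate, Multiset.sum_replicate, Multiset.sum_singleton, e1, nsmul_add,
      nsmul_add, Multiset.nsmul_singleton (-g), smul_comm n (n - 1) Y.val]
    abel
  have hcF : Multiset.card F = n + 1 := by
    rw [hF, Multiset.card_add, Multiset.card_replicate, Multiset.card_singleton]
  have hcF' : Multiset.card F' = n + (n - 1) * (n - 1) := by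
    rw [hF', Multiset.card_add, Multiset.card_replicate, Multiset.card_nsmul, Multiset.card_map,
      ← Finset.card_def, hYc]
  refine ⟨admissible_of_uniformLengths hU fun hh => ?_, ?_⟩
  · have := hh F F' hFa hFa' hs
    rw [hcF, hcF'] at this
    have : 3 * (n - 1) ≤ (n - 1) * (n - 1) := Nat.mul_le_mul_right _ (by omega)
    omega
  · have h4 := le_elasticity hFa hFa' hs (by
      intro h
      rw [h, Multiset.card_zero] at hcF
      omega)
    refine le_trans (le_of_eq ?_) h4
    rw [hcF, hcF', ← ENNReal.ofReal_natCast, ← ENNReal.ofReal_natCast,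
      ← ENNReal.ofReal_div_of_pos (by positivity)]
    congr 1
    push_cast [Nat.cast_sub (by omega : 1 ≤ n)]
    ring

end homocyclic

/-! ### Sets consisting of independent elements and their sum -/

section pattern

variable {ι : Type*} [Fintype ι] {n : ℕ} (hn : 0 < n) (hexp : ∀ x : G, n • x = 0)
  {e : ι → G} {o : ι → ℕ} (ho : ∀ i, 1 < o i) (hon : ∀ i, o i ∣ n) (hoe : ∀ i, o i • e i = 0)
  (hind : ∀ z : ι → ℤ, ∑ i, z i • e i = 0 → ∀ i, (o i : ℤ) ∣ z i)

/-- A family of elements together with their sum. -/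
def patternSet (e : ι → G) : Set G := {x | x = ∑ i, e i ∨ ∃ i, x = e i}

include ho hind in
theorem injective_of_independent : Function.Injective e := by
  classical
  intro i j hij
  by_contra hne
  have h := hind (Pi.single i 1 - Pi.single j 1) (by
    simp only [Pi.sub_apply, sub_smul, Finset.sum_sub_distrib, Pi.single_apply, ite_smul, one_smul,
      zero_smul, Finset.sum_ite_eq', Finset.mem_univ, if_true, hij, sub_self]) i
  simp only [Pi.sub_apply, Pi.single_eq_same, Pi.single_eq_of_ne hne, sub_zero] at h
  have := Int.le_of_dvd one_pos h
  have := ho i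
  omega

include ho hind in
theorem sum_ne_of_independent [Nontrivial ι] (i : ι) : e i ≠ ∑ j, e j := by
  classical
  intro h
  obtain ⟨j, hj⟩ := exists_ne i
  have h1 := hind (1 - Pi.single i 1) (by
    simp only [Pi.sub_apply, Pi.one_apply, sub_smul, Finset.sum_sub_distrib, Pi.single_apply,
      ite_smul, one_smul, zero_smul, Finset.sum_ite_eq', Finset.mem_univ, if_true, ← h, sub_self]) j
  simp only [Pi.sub_apply, Pi.one_apply, Pi.single_eq_of_ne hj, sub_zero] at h1
  have := Int.le_of_dvd one_pos h1
  have := ho j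
  omega

include hoe hind in
theorem addOrderOf_of_independent (i : ι) : addOrderOf (e i) = o i := by
  classical
  refine Nat.dvd_antisymm (addOrderOf_dvd_of_nsmul_eq_zero (hoe i)) ?_
  have := hind (Pi.single i (addOrderOf (e i) : ℤ)) (by
    simp only [Pi.single_apply, ite_smul, zero_smul, Finset.sum_ite_eq', Finset.mem_univ, if_true,
      natCast_zsmul, addOrderOf_nsmul_eq_zero]) i
  rw [Pi.single_eq_same] at this
  exact Int.natCast_dvd_natCast.1 this

include ho hind in
theorem map_sum_patternSet [DecidableEq G] [Nontrivial ι] {M : Type*} [AddCommMonoid M] (φ : G → M)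
    {B : Multiset G} (hB : ∀ x ∈ B, x ∈ patternSet e) :
    (B.map φ).sum = B.count (∑ i, e i) • φ (∑ i, e i) + ∑ i, B.count (e i) • φ (e i) := by
  classical
  have hinj := injective_of_independent ho hind
  have hne := sum_ne_of_independent ho hind
  rw [Finset.sum_multiset_map_count,
    Finset.sum_subset (s₂ := insert (∑ i, e i) (Finset.univ.image e)), Finset.sum_insert,
    Finset.sum_image fun i _ j _ h => hinj h]
  · intro h
    obtain ⟨i, -, hi⟩ := Finset.mem_image.1 h
    exact hne i hi
  · intro x hx
    rcases hB x (Multiset.mem_toFinset.1 hx) with h | ⟨i, h⟩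
    · exact h ▸ Finset.mem_insert_self _ _
    · exact Finset.mem_insert_of_mem (Finset.mem_image.2 ⟨i, Finset.mem_univ i, h.symm⟩)
  · intro x _ hx
    rw [Multiset.mem_toFinset] at hx
    rw [Multiset.count_eq_zero_of_notMem hx, zero_smul]

include ho hind in
theorem dvd_count_patternSet [DecidableEq G] [Nontrivial ι] {B : Multiset G}
    (hB : ∀ x ∈ B, x ∈ patternSet e) (hs : B.sum = 0) (i : ι) :
    o i ∣ B.count (e i) + B.count (∑ i, e i) := by
  have h := map_sum_patternSet ho hind (fun x => x) hB
  rw [Multiset.map_id', hs, Finset.smul_sum, ← Finset.sum_add_distrib] at h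
  have h1 := hind (fun i => ((B.count (e i) + B.count (∑ i, e i) : ℕ) : ℤ)) (by
    rw [h]
    refine Finset.sum_congr rfl fun i _ => ?_
    rw [natCast_zsmul, add_smul, add_comm]) i
  exact Int.natCast_dvd_natCast.1 h1

include hn hexp ho hon hoe hind in
-- Apart from the strips of the `e i`, an atom has the form `e₀^j ∏ (e i)^(o i * ⌈j / o i⌉ - j)`.
-- Giving `e₀` the weight `∑ n / o i` and `e i` the weight `n / o i`, it weighs `n * ∑ ⌈j / o i⌉`.
theorem uniformLengths_patternSet [Nontrivial ι] {d : ℕ}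
    (hd : ∀ j, 0 < j → j ≤ n → (d : ℤ) ∣ ((∑ i, (j + o i - 1) / o i : ℕ) : ℤ) - 1) :
    UniformLengths d (patternSet e) := by
  classical
  have hne := sum_ne_of_independent ho hind
  have hord := addOrderOf_of_independent hoe hind
  set e₀ := ∑ i, e i with he₀
  refine uniformLengths_of_weight
    (fun x => if x = e₀ then ((∑ i, n / o i : ℕ) : ℤ) else ((n / addOrderOf x : ℕ) : ℤ)) (c := n)
    (by omega) fun A hA => ?_
  have hdvd := dvd_count_patternSet ho hind (fun x hx => hA.mem hx) hA.sum_eq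
  rw [map_sum_patternSet ho hind _ fun x hx => hA.mem hx]
  simp only [← he₀, if_true, if_neg (hne _), hord, nsmul_eq_mul]
  by_cases hc : ∃ i, o i ≤ A.count (e i)
  · obtain ⟨i, hi⟩ := hc
    rw [← hord i] at hi
    have hA' := hA.eq_strip hn hexp hi
    have h0 : A.count e₀ = 0 := by
      rw [Multiset.count_eq_zero, hA', strip]
      exact fun h => hne i (Multiset.eq_of_mem_replicate h).symm
    rw [h0, Nat.cast_zero, zero_mul, zero_add, Finset.sum_eq_single_of_mem i (Finset.mem_univ i)]
    · rw [hA', strip, Multiset.count_replicate_self, hord, ← Nat.cast_mul (o i),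
        Nat.mul_div_cancel' (hon i), sub_self]
      exact dvd_zero _
    · intro j _ hj
      have : A.count (e j) = 0 := by
        rw [Multiset.count_eq_zero, hA', strip]
        exact fun h => hj (injective_of_independent ho hind (Multiset.eq_of_mem_replicate h))
      rw [this, Nat.cast_zero, zero_mul]
  · push Not at hc
    set j := A.count e₀ with hj
    have hj0 : 0 < j := by
      rw [Nat.pos_iff_ne_zero]
      intro h0
      apply hA.ne_zero
      rw [Multiset.eq_zero_iff_forall_notMem]
      intro x hx
      have hpos := Multiset.count_pos.2 hx
      rcases hA.mem hx with rfl | ⟨i, rfl⟩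
      · exact absurd h0 hpos.ne'
      · have := hdvd i
        rw [h0, add_zero] at this
        have := Nat.eq_zero_of_dvd_of_lt this (hc i)
        omega
    have hjn : j ≤ n := (hA.count_le hn hexp e₀).trans (order_le hn hexp e₀)
    have key : ∀ i, A.count (e i) + j = o i * ((j + o i - 1) / o i) := by
      intro i
      obtain ⟨m, hm⟩ := hdvd i
      rw [hm]
      congr 1
      have h1 := hc i
      have h2 := ho i
      symm
      rw [Nat.div_eq_iff (by omega)]
      constructor
      · rw [mul_comm]; omega
      · rw [mul_comm, ← hm]; omega
    have h1 : (j : ℤ) * ((∑ i, n / o i : ℕ) : ℤ) + ∑ i, (A.count (e i) : ℤ) * ((n / o i : ℕ) : ℤ) - n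
        = n * (((∑ i, (j + o i - 1) / o i : ℕ) : ℤ) - 1) := by
      rw [Nat.cast_sum, Finset.mul_sum, ← Finset.sum_add_distrib, mul_sub, mul_one, Nat.cast_sum,
        Finset.mul_sum]
      congr 1
      refine Finset.sum_congr rfl fun i _ => ?_
      have h2 : (j + A.count (e i)) * (n / o i) = n * ((j + o i - 1) / o i) := by
        rw [add_comm, key i, mul_right_comm, Nat.mul_div_cancel' (hon i)]
      rw [← add_mul]
      exact_mod_cast h2
    rw [h1]
    exact mul_dvd_mul_left _ (hd j hj0 hjn)

include hn hexp ho hon hoe hind in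
-- The atom is `e₀ ∏ (e i)^(o i - 1)`; the summand `1` is a lower bound for the contribution of
-- `e₀`.
theorem exists_isAtom_patternSet [Nontrivial ι] :
    ∃ A, IsAtom (patternSet e) A ∧ 1 + ∑ i, (o i - 1) * (n / o i) ≤ wt n A := by
  classical
  have hne := sum_ne_of_independent ho hind
  have hinj := injective_of_independent ho hind
  have hord := addOrderOf_of_independent hoe hind
  set A : Multiset G := {∑ i, e i} + ∑ i, Multiset.replicate (o i - 1) (e i) with hA
  have hcount : ∀ i, A.count (e i) = o i - 1 := by
    intro i
    rw [hA, Multiset.count_add, Multiset.count_singleton, if_neg (hne i), zero_add,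
      Multiset.count_sum', Finset.sum_eq_single_of_mem i (Finset.mem_univ i),
      Multiset.count_replicate_self]
    intro j _ hj
    rw [Multiset.count_replicate, if_neg fun h => hj (hinj h)]
  have hcount0 : A.count (∑ i, e i) = 1 := by
    rw [hA, Multiset.count_add, Multiset.count_singleton, if_pos rfl, Multiset.count_sum',
      Finset.sum_eq_zero fun j _ => ?_, add_zero]
    rw [Multiset.count_replicate, if_neg (hne j)]
  have hmem : ∀ x ∈ A, x ∈ patternSet e := by
    intro x hx
    rcases Multiset.mem_add.1 hx with h | h
    · exact Or.inl (Multiset.mem_singleton.1 h)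
    · obtain ⟨i, -, hi⟩ := Multiset.mem_sum.1 h
      exact Or.inr ⟨i, Multiset.eq_of_mem_replicate hi⟩
  refine ⟨A, isAtom_of_forall hmem ?_ ?_ ?_, ?_⟩
  · rw [hA, Multiset.sum_add, Multiset.sum_singleton, ← Multiset.coe_sumAddMonoidHom, map_sum,
      ← Finset.sum_add_distrib]
    refine Finset.sum_eq_zero fun i _ => ?_
    rw [Multiset.coe_sumAddMonoidHom, Multiset.sum_replicate]
    nth_rewrite 1 [← one_nsmul (e i)]
    rw [← add_nsmul, Nat.add_sub_cancel' (ho i).le, hoe]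
  · rw [hA]; simp
  · intro T hT hT0 hTs
    have hTm : ∀ x ∈ T, x ∈ patternSet e := fun x hx => hmem x (Multiset.mem_of_le hT hx)
    have hdvd := dvd_count_patternSet ho hind hTm hTs
    have hle := fun i => Multiset.count_le_of_le (e i) hT
    have hle0 := Multiset.count_le_of_le (∑ i, e i) hT
    rw [hcount0] at hle0
    refine le_antisymm hT ?_
    have hc1 : T.count (∑ i, e i) = 1 := by
      by_contra hc
      apply hT0
      rw [Multiset.eq_zero_iff_forall_notMem]
      intro x hx
      have hpos := Multiset.count_pos.2 hx
      rcases hTm x hx with rfl | ⟨i, rfl⟩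
      · omega
      · have h1 := hdvd i
        have h2 := hle i
        rw [hcount] at h2
        rw [(by omega : T.count (∑ i, e i) = 0), add_zero] at h1
        have h3 := ho i
        have := Nat.eq_zero_of_dvd_of_lt h1 (by omega)
        omega
    rw [Multiset.le_iff_count]
    intro x
    by_cases hx : x ∈ A
    · rcases hmem x hx with rfl | ⟨i, rfl⟩
      · rw [hcount0, hc1]
      · have := Nat.le_of_dvd (Nat.succ_pos _) (hc1 ▸ hdvd i)
        rw [hcount]
        omega
    · rw [Multiset.count_eq_zero_of_notMem hx]
      exact Nat.zero_le _
  · rw [hA, wt_add, wt_singleton]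
    have h1 : wt n (∑ i, Multiset.replicate (o i - 1) (e i)) = ∑ i, (o i - 1) * (n / o i) := by
      have hsum : ∀ s : Finset ι, wt n (∑ i ∈ s, Multiset.replicate (o i - 1) (e i)) =
          ∑ i ∈ s, (o i - 1) * (n / o i) := by
        intro s
        induction s using Finset.induction_on with
        | empty => simp
        | insert a s ha ih =>
          rw [Finset.sum_insert ha, Finset.sum_insert ha, wt_add, ih, wt_replicate, hord]
      exact hsum _
    rw [h1]
    have := Nat.div_pos (order_le hn hexp (∑ i, e i)) (order_pos hn hexp (∑ i, e i))
    omega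

include hn hexp ho hon hoe hind in
theorem admissible_patternSet [Nontrivial ι] {d : ℕ}
    (hd : ∀ j, 0 < j → j ≤ n → (d : ℤ) ∣ ((∑ i, (j + o i - 1) / o i : ℕ) : ℤ) - 1)
    (hlt : n < 1 + ∑ i, (o i - 1) * (n / o i)) :
    Admissible d (patternSet e) ∧
      ENNReal.ofReal (((1 + ∑ i, (o i - 1) * (n / o i) : ℕ) : ℝ) / n) ≤ crossK G d := by
  obtain ⟨A, hA, hw⟩ := exists_isAtom_patternSet hn hexp ho hon hoe hind
  have h : Admissible d (patternSet e) := admissible_of_uniformLengths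
    (uniformLengths_patternSet hn hexp ho hon hoe hind hd) fun hh => by
      have := hh.wt_eq hn hexp hA
      omega
  refine ⟨h, le_trans ?_ ((le_crossNumber hA).trans (le_crossK h))⟩
  rw [seqCrossNumber_eq_ofReal hn hexp]
  refine ENNReal.ofReal_le_ofReal ?_
  gcongr

end pattern

/-! ### Group algebras and the cross number of homocyclic `p`-groups -/

theorem span_pow_eq_zero {R ι : Type*} [CommRing R] {n : ℕ} (hn : 0 < n) {y : ι → R}
    (hy : ∀ i, y i ^ n = 0) (s : Finset ι) :
    Ideal.span (y '' (s : Set ι)) ^ (s.card * (n - 1) + 1) = 0 := by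
  classical
  induction s using Finset.induction_on with
  | empty => simp
  | insert a s ha ih =>
    rw [Finset.coe_insert, Set.image_insert_eq, Ideal.span_insert, Finset.card_insert_of_notMem ha,
      ← Ideal.add_eq_sup]
    refine (Commute.all _ _).add_pow_eq_zero_of_add_le_succ_of_pow_eq_zero (m := n) ?_ ih ?_
    · rw [Ideal.span_singleton_pow, hy, Ideal.span_singleton_zero]
      rfl
    · rw [add_mul]
      omega

section group_algebra

variable (k : Type*) [CommRing k]

/-- The element `X ^ x - 1` of the group algebra. -/
noncomputable def augm (x : G) : AddMonoidAlgebra k G := AddMonoidAlgebra.single x 1 - 1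

theorem augm_add (x y : G) :
    augm k (x + y) = AddMonoidAlgebra.single x 1 * augm k y + augm k x := by
  simp only [augm, mul_sub, mul_one, AddMonoidAlgebra.single_mul_single]
  ring

theorem coeff_augm_mul (x c : G) (P : AddMonoidAlgebra k G) :
    (augm k x * P).coeff c = P.coeff (c - x) - P.coeff c := by
  rw [augm, sub_mul, one_mul, AddMonoidAlgebra.coeff_sub, Finsupp.sub_apply,
    AddMonoidAlgebra.coeff_single_mul_apply, one_mul, neg_add_eq_sub]

theorem coeff_prod_augm_eq_zero {B : Multiset G} {c : G} (h : ∀ T ≤ B, T.sum ≠ c) :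
    ((B.map (augm k)).prod).coeff c = 0 := by
  classical
  induction B using Multiset.induction generalizing c with
  | empty =>
    have h0 : (0 : G) ≠ c := by simpa using h 0 le_rfl
    rw [Multiset.map_zero, Multiset.prod_zero, AddMonoidAlgebra.one_def,
      AddMonoidAlgebra.coeff_single, Finsupp.single_apply, if_neg h0]
  | cons x B ih =>
    rw [Multiset.map_cons, Multiset.prod_cons, coeff_augm_mul, ih fun T hT hs => ?_,
      ih fun T hT hs => h T (hT.trans (Multiset.le_cons_self _ _)) hs, sub_zero]
    refine h (x ::ₘ T) (Multiset.cons_le_cons _ hT) ?_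
    rw [Multiset.sum_cons, hs, add_sub_cancel]

/-- Expanding the product, only the full sequence contributes to the coefficient at `B.sum`. This
makes the product nonzero when `B` is an atom with one term removed. -/
theorem coeff_prod_augm_sum {B : Multiset G} (h : ∀ T ≤ B, T.sum = B.sum → T = B) :
    ((B.map (augm k)).prod).coeff B.sum = 1 := by
  classical
  induction B using Multiset.induction with
  | empty =>
    rw [Multiset.map_zero, Multiset.prod_zero, AddMonoidAlgebra.one_def, Multiset.sum_zero,
      AddMonoidAlgebra.coeff_single, Finsupp.single_apply, if_pos rfl]
  | cons x B ih =>
    rw [Multiset.map_cons, Multiset.prod_cons, coeff_augm_mul, Multiset.sum_cons,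
      add_sub_cancel_left, ih fun T hT hs => ?_, coeff_prod_augm_eq_zero k fun T hT hs => ?_,
      sub_zero]
    · have h1 := h T (hT.trans (Multiset.le_cons_self _ _)) (by rw [hs, Multiset.sum_cons])
      have h2 := Multiset.card_le_card hT
      rw [h1, Multiset.card_cons] at h2
      omega
    · exact (Multiset.cons_inj_right x).1 (h (x ::ₘ T) (Multiset.cons_le_cons _ hT)
        (by rw [Multiset.sum_cons, hs, Multiset.sum_cons]))

end group_algebra

section homocyclic

variable {ι : Type*} [Fintype ι] {p m n : ℕ} (hp : p.Prime) (hpn : n = p ^ m)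
  (hexp : ∀ x : G, n • x = 0) {e : ι → G}
  (hspan : ∀ x : G, ∃ b : ι → ℤ, ∑ i, b i • e i = x)
  (hind : ∀ z : ι → ℤ, ∑ i, z i • e i = 0 → ∀ i, (n : ℤ) ∣ z i)

include hspan in
theorem augm_mem_span (k : Type*) [CommRing k] (x : G) :
    augm k x ∈ Ideal.span ((fun i => augm k (e i)) '' (Finset.univ : Finset ι)) := by
  set I := Ideal.span ((fun i => augm k (e i)) '' ((Finset.univ : Finset ι) : Set ι)) with hI
  let H : AddSubgroup G :=
    { carrier := {x | augm k x ∈ I}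
      zero_mem' := by
        show augm k (0 : G) ∈ I
        rw [augm, AddMonoidAlgebra.one_def, sub_self]
        exact I.zero_mem
      add_mem' := by
        intro a b ha hb
        show augm k (a + b) ∈ I
        rw [augm_add]
        exact I.add_mem (I.mul_mem_left _ hb) ha
      neg_mem' := by
        intro a ha
        show augm k (-a) ∈ I
        have h := augm_add k (-a) a
        rw [neg_add_cancel, augm, ← AddMonoidAlgebra.one_def, sub_self] at h
        rw [eq_neg_of_add_eq_zero_right h.symm]
        exact I.neg_mem (I.mul_mem_left _ ha) }
  obtain ⟨b, rfl⟩ := hspan x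
  refine H.sum_mem fun i _ => H.zsmul_mem ?_ _
  exact Ideal.subset_span ⟨i, by simp, rfl⟩

include hp hpn hexp hspan hind in
/-- Olson's bound for homocyclic `p`-groups, in terms of cross numbers. -/
theorem wt_cons_le_of_isPrimePow {G₀ : Set G} {g : G} {B : Multiset G}
    (hA : IsAtom G₀ (g ::ₘ B)) : wt n B ≤ Fintype.card ι * (n - 1) := by
  classical
  have := Fact.mk hp
  have hn : 0 < n := hpn ▸ pow_pos hp.pos m
  have hchar : CharP (AddMonoidAlgebra (ZMod p) G) p :=
    charP_of_injective_algebraMap (FaithfulSMul.algebraMap_injective (ZMod p) _) p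
  have hpow : ∀ (x : G) (j : ℕ), augm (ZMod p) x ^ p ^ j = augm (ZMod p) (p ^ j • x) := by
    intro x j
    rw [augm, sub_pow_char_pow, one_pow, AddMonoidAlgebra.single_pow, one_pow, augm]
  set I := Ideal.span ((fun i => augm (ZMod p) (e i)) '' ((Finset.univ : Finset ι) : Set ι)) with hI
  have hI0 : I ^ (Fintype.card ι * (n - 1) + 1) = 0 := by
    refine span_pow_eq_zero hn (fun i => ?_) _
    rw [hpn, hpow, ← hpn, hexp, augm, ← AddMonoidAlgebra.one_def, sub_self]
  -- An element of order `p^j` is `p^(m-j)` times another element, so by Frobenius its augmentation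
  -- is a `p^(m-j)`-th power of an element of `I`. Thus the product over `B` lies in `I ^ wt n B`.
  have hmem : ∀ x : G, augm (ZMod p) x ∈ I ^ (n / addOrderOf x) := by
    intro x
    obtain ⟨j, hj, hjo⟩ := (Nat.dvd_prime_pow hp).1 (hpn ▸ order_dvd hexp x)
    have hdiv : n / addOrderOf x = p ^ (m - j) := by
      rw [hjo, hpn, Nat.pow_div hj hp.pos]
    have hmul : n = p ^ j * p ^ (m - j) := by rw [← pow_add, Nat.add_sub_cancel' hj, hpn]
    obtain ⟨b, hb⟩ := hspan x
    have h1 := hind (fun i => (p ^ j : ℕ) * b i) (by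
      simp only [mul_smul, ← Finset.smul_sum, hb, natCast_zsmul]
      rw [← hjo, addOrderOf_nsmul_eq_zero])
    have h2 : ∀ i, ∃ c : ℤ, b i = (p ^ (m - j) : ℕ) * c := by
      intro i
      have h3 := h1 i
      rw [hmul, Nat.cast_mul] at h3
      exact Int.dvd_of_mul_dvd_mul_left (by exact_mod_cast (pow_pos hp.pos j).ne') h3
    choose c hc using h2
    have h4 : x = p ^ (m - j) • ∑ i, c i • e i := by
      rw [← hb, Finset.smul_sum]
      refine Finset.sum_congr rfl fun i _ => ?_
      rw [hc i, mul_smul, natCast_zsmul]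
    rw [hdiv, h4, ← hpow]
    exact Ideal.pow_mem_pow (augm_mem_span hspan _ _) _
  by_contra hcon
  push Not at hcon
  have hprod : (B.map (augm (ZMod p))).prod ∈ I ^ wt n B := by
    clear hcon hA
    induction B using Multiset.induction with
    | empty => simp
    | cons x B ih =>
      rw [Multiset.map_cons, Multiset.prod_cons, ← Multiset.singleton_add, wt_add, wt_singleton,
        pow_add]
      exact Ideal.mul_mem_mul (hmem x) ih
  have h0 : (B.map (augm (ZMod p))).prod = 0 := by
    have := Ideal.pow_le_pow_right (Nat.succ_le_of_lt hcon) hprod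
    rw [Nat.succ_eq_add_one, hI0] at this
    simpa using this
  have h1 := coeff_prod_augm_sum (ZMod p) (B := B) fun T hT hs => by
    by_contra hne
    have hne' : B - T ≠ 0 := fun h =>
      hne (le_antisymm hT (tsub_eq_zero_iff_le.1 h))
    have h2 := hA.eq_of_le ((Multiset.sub_le_self B T).trans (Multiset.le_cons_self _ _)) hne'
      (by rw [sum_sub_eq hT, hs, sub_self])
    have h3 := congrArg Multiset.card h2
    rw [Multiset.card_cons] at h3
    have := Multiset.card_le_card (Multiset.sub_le_self B T)
    omega
  rw [h0] at h1
  simp at h1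

include hp hpn hexp hspan hind in
-- Removing one nonzero term `g` gives `wt n A ≤ n / 2 + (n - 1)²`. The largest value in this range
-- congruent to `n` modulo `n - 2` is `n + (n - 1) * (n - 2) = (n - 1)² + 1`.
theorem crossNumber_le_of_isPrimePow (hn : 4 ≤ n) (hι : Fintype.card ι = n - 1) {G₀ : Set G}
    (hU : UniformLengths (n - 2) G₀) :
    crossNumber G₀ ≤ ENNReal.ofReal (1 + ((n : ℝ) - 1) * (n - 2) / n) := by
  have hn0 : 0 < n := by omega
  refine iSup₂_le fun A hA => ?_
  rw [seqCrossNumber_eq_ofReal hn0 hexp]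
  refine ENNReal.ofReal_le_ofReal ?_
  have hle : wt n A ≤ n + (n - 1) * (n - 2) := by
    by_cases hz : ∃ g ∈ A, g ≠ 0
    · obtain ⟨g, hg, hg0⟩ := hz
      obtain ⟨B, rfl⟩ := Multiset.exists_cons_of_mem hg
      have h1 := wt_cons_le_of_isPrimePow hp hpn hexp hspan hind hA
      rw [hι] at h1
      have h2 : n / addOrderOf g ≤ n / 2 := by
        refine Nat.div_le_div_left ?_ two_pos
        have h3 := order_pos hn0 hexp g
        have h4 : addOrderOf g ≠ 1 := fun h => hg0 (AddMonoid.addOrderOf_eq_one_iff.1 h)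
        omega
      have h5 : wt n (g ::ₘ B) = n / addOrderOf g + wt n B := by
        rw [← Multiset.singleton_add, wt_add, wt_singleton]
      obtain ⟨k, hk⟩ := hU.dvd_wt_sub hn0 hexp hA
      by_contra hcon
      push Not at hcon
      obtain ⟨q, rfl⟩ : ∃ q, n = q + 2 := ⟨n - 2, by omega⟩
      simp only [show q + 2 - 2 = q by omega, show q + 2 - 1 = q + 1 by omega] at *
      have h6 : ((q + 1 : ℕ) : ℤ) < k := by
        have : (q : ℤ) * (q + 1 : ℕ) < q * k := by
          rw [← hk]; zify at hcon; push_cast at hcon ⊢; linarith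
        exact lt_of_mul_lt_mul_left this (by positivity)
      have h7 : (q : ℤ) * (q + 2) ≤ q * k := by
        refine mul_le_mul_of_nonneg_left ?_ (by positivity)
        push_cast at h6; linarith
      have h8 : 2 * wt (q + 2) (g ::ₘ B) ≤ (q + 2) + 2 * ((q + 1) * (q + 1)) := by omega
      zify at h8
      rw [← hk] at h7
      push_cast at h7
      nlinarith
    · push Not at hz
      have : A = {0} := by
        obtain ⟨g, hg⟩ := Multiset.exists_mem_of_ne_zero hA.ne_zero
        have hg0 := hz g hg
        subst hg0
        exact (hA.eq_of_le (Multiset.singleton_le.2 hg) (by simp) (by simp)).symm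
      rw [this, wt_singleton, addOrderOf_zero, Nat.div_one]
      exact Nat.le_add_right _ _
  have hle' : (wt n A : ℝ) ≤ n + (n - 1) * (n - 2) := by
    have : (wt n A : ℝ) ≤ ((n + (n - 1) * (n - 2) : ℕ) : ℝ) := by exact_mod_cast hle
    push_cast [Nat.cast_sub (by omega : 1 ≤ n), Nat.cast_sub (by omega : 2 ≤ n)] at this
    exact this
  have hN : (0 : ℝ) < n := by exact_mod_cast hn0
  rw [div_le_iff₀ hN, add_mul, div_mul_cancel₀ _ hN.ne']
  linarith

end homocyclic

/-! ### Direct sums of cyclic groups -/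

/-- The elements `e i` form a basis of `G` with `e i` of order `n i`. -/
structure IsBasis {ι : Type*} [Fintype ι] (n : ι → ℕ) (e : ι → G) : Prop where
  span : ∀ x : G, ∃ b : ι → ℤ, ∑ i, b i • e i = x
  rel : ∀ z : ι → ℤ, ∑ i, z i • e i = 0 ↔ ∀ i, (n i : ℤ) ∣ z i

theorem exists_isBasis {ι : Type*} [Fintype ι] {n : ι → ℕ} (E : G ≃+ ((i : ι) → ZMod (n i))) :
    ∃ e : ι → G, IsBasis n e := by
  classical
  have key : ∀ z : ι → ℤ, E (∑ i, z i • E.symm (Pi.single i 1)) = fun i => (z i : ZMod (n i)) := by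
    intro z
    rw [map_sum]
    simp only [map_zsmul, AddEquiv.apply_symm_apply]
    funext j
    rw [Finset.sum_apply, Finset.sum_eq_single_of_mem j (Finset.mem_univ j) fun i _ hij => by
      rw [Pi.smul_apply, Pi.single_eq_of_ne hij.symm, smul_zero], Pi.smul_apply, Pi.single_eq_same,
      zsmul_one]
  refine ⟨fun i => E.symm (Pi.single i 1), fun x => ?_, fun z => ?_⟩
  · choose b hb using fun i => ZMod.intCast_surjective (E x i)
    refine ⟨b, E.injective ?_⟩
    rw [key]
    exact funext hb
  · rw [← E.map_eq_zero_iff, key]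
    constructor
    · intro h i
      exact (ZMod.intCast_zmod_eq_zero_iff_dvd _ _).1 (congrFun h i)
    · intro h
      exact funext fun i => (ZMod.intCast_zmod_eq_zero_iff_dvd _ _).2 (h i)

namespace IsBasis

variable {ι : Type*} [Fintype ι] {n : ι → ℕ} {e : ι → G} (h : IsBasis n e)

include h

theorem nsmul_eq_zero {N : ℕ} (hN : ∀ i, n i ∣ N) (x : G) : N • x = 0 := by
  obtain ⟨b, rfl⟩ := h.span x
  rw [Finset.smul_sum, ← (h.rel fun i => N * b i).2 fun i =>
    (Int.natCast_dvd_natCast.2 (hN i)).mul_right _]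
  refine Finset.sum_congr rfl fun i _ => ?_
  rw [mul_smul, natCast_zsmul]

theorem exists_surjective : ∃ f : (ι → ℤ) →+ G, Function.Surjective f :=
  ⟨{ toFun := fun z => ∑ i, z i • e i
     map_zero' := by simp
     map_add' := fun a b => by simp [add_smul, Finset.sum_add_distrib] }, h.span⟩

theorem indep_image [DecidableEq G] {N : ℕ} (hN : 1 < N) (hn : ∀ i, n i = N) :
    Indep N (Finset.univ.image e) ∧ (Finset.univ.image e).card = Fintype.card ι := by
  have hinj : Function.Injective e := injective_of_independent (o := fun _ => N) (fun _ => hN)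
    fun z hz i => hn i ▸ (h.rel z).1 hz i
  refine ⟨fun z hz y hy => ?_, by rw [Finset.card_image_of_injective _ hinj, Finset.card_univ]⟩
  rw [Finset.sum_image fun i _ j _ hij => hinj hij] at hz
  obtain ⟨i, -, rfl⟩ := Finset.mem_image.1 hy
  exact hn i ▸ (h.rel fun i => z (e i)).1 hz i

/-- Elements of smaller orders in the cyclic summands are independent. -/
theorem independent_smul {o : ι → ℕ} (hn : ∀ i, 0 < n i) (ho : ∀ i, o i ∣ n i) :
    (∀ i, o i • ((n i / o i) • e i) = 0) ∧
      ∀ z : ι → ℤ, ∑ i, z i • ((n i / o i) • e i) = 0 → ∀ i, (o i : ℤ) ∣ z i := by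
  classical
  refine ⟨fun i => ?_, fun z hz i => ?_⟩
  · rw [smul_smul, Nat.mul_div_cancel' (ho i)]
    rw [← (h.rel (Pi.single i (n i : ℤ))).2 fun j => by
      by_cases hij : j = i
      · subst hij; simp
      · rw [Pi.single_eq_of_ne hij]; exact dvd_zero _]
    rw [Finset.sum_eq_single_of_mem i (Finset.mem_univ i) fun j _ hj => by
      rw [Pi.single_eq_of_ne hj, zero_smul], Pi.single_eq_same, natCast_zsmul]
  · have h1 := (h.rel fun i => z i * (n i / o i : ℕ)).1 (by
      rw [← hz]
      refine Finset.sum_congr rfl fun i _ => ?_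
      rw [mul_smul, natCast_zsmul]) i
    obtain ⟨c, hc⟩ := ho i
    have ho0 : 0 < o i := Nat.pos_of_dvd_of_pos (ho i) (hn i)
    have hc0 : c ≠ 0 := by
      rintro rfl
      have := hn i
      omega
    have h2 : n i / o i = c := by rw [hc, Nat.mul_div_cancel_left _ ho0]
    rw [h2, hc, Nat.cast_mul] at h1
    exact Int.dvd_of_mul_dvd_mul_right (by exact_mod_cast hc0) h1

end IsBasis

/-! ### Lower bounds for the maximal cross number -/

theorem sum_comp_ite {ι : Type*} [Fintype ι] [DecidableEq ι] (i₀ : ι) (F : ℕ → ℕ) (a b : ℕ) :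
    ∑ i, F (if i = i₀ then a else b) = F a + (Fintype.card ι - 1) * F b := by
  rw [← Finset.add_sum_erase _ _ (Finset.mem_univ i₀), if_pos rfl,
    Finset.sum_congr rfl (g := fun _ => F b) fun i hi => by rw [if_neg (Finset.ne_of_mem_erase hi)],
    Finset.sum_const, Finset.card_erase_of_mem (Finset.mem_univ i₀), Finset.card_univ, smul_eq_mul]

theorem ceil_div_self {j N : ℕ} (hj : 0 < j) (hjN : j ≤ N) : (j + N - 1) / N = 1 := by
  rw [Nat.div_eq_iff (by omega)]
  omega

/-- Use one element of order `N` and `N - 2` of order `c`. For `1 ≤ j ≤ N` the sum of the ceilings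
is `1 + (N - 2) * ⌈j / c⌉`, so `uniformLengths_patternSet` applies with `d = N - 2`. -/
theorem IsBasis.exists_admissible {ι : Type*} [Fintype ι] {n : ι → ℕ} {e : ι → G}
    (h : IsBasis n e) {N c : ℕ} (hι : Fintype.card ι + 1 = N) (hN : 4 ≤ N) (hn : ∀ i, n i ∣ N)
    (hc : 1 < c) (hcn : ∀ i, c ∣ n i) {i₀ : ι} (hi₀ : n i₀ = N) :
    (∃ G₀ : Set G, Admissible (N - 2) G₀) ∧ ENNReal.ofReal ((N : ℝ) / 2) ≤ crossK G (N - 2) := by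
  classical
  have hN0 : 0 < N := by omega
  have hcN : c ∣ N := hi₀ ▸ hcn i₀
  have hexp := h.nsmul_eq_zero hn
  let o : ι → ℕ := fun i => if i = i₀ then N else c
  have ho : ∀ i, o i ∣ n i := by
    intro i
    by_cases hi : i = i₀
    · simp only [o, hi, if_true, hi₀, dvd_refl]
    · simp only [o, hi, if_false, hcn i]
  have ho1 : ∀ i, 1 < o i := by
    intro i
    simp only [o]
    split_ifs <;> omega
  obtain ⟨h1, h2⟩ := h.independent_smul (o := o) (fun i => Nat.pos_of_dvd_of_pos (hn i) hN0) ho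
  have : Nontrivial ι := by
    rw [← Fintype.one_lt_card_iff_nontrivial]; omega
  obtain ⟨q, hq⟩ := hcN
  have hqc : N / c = q := by rw [hq, Nat.mul_div_cancel_left _ (by omega)]
  have hsum : ∑ i, (o i - 1) * (N / o i) = (N - 1) + (N - 2) * ((c - 1) * q) := by
    have := sum_comp_ite i₀ (fun x => (x - 1) * (N / x)) N c
    simp only [o]
    rw [this, Nat.div_self hN0, mul_one, hqc]
    congr 2
    omega
  have hq0 : 0 < q := by
    rw [Nat.pos_iff_ne_zero]
    rintro rfl
    omega
  have hcq : N ≤ 2 * ((c - 1) * q) := by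
    rw [hq, ← mul_assoc]
    exact Nat.mul_le_mul_right _ (by omega)
  obtain ⟨hadm, hK⟩ := admissible_patternSet (d := N - 2) hN0 hexp ho1
    (fun i => (ho i).trans (hn i)) h1 h2 (fun j hj hjN => by
      have h3 := sum_comp_ite i₀ (fun x => (j + x - 1) / x) N c
      simp only [o]
      rw [h3, ceil_div_self hj hjN, (by omega : Fintype.card ι - 1 = N - 2), Nat.cast_add,
        Nat.cast_one, add_sub_cancel_left, Nat.cast_mul]
      exact dvd_mul_right _ _) (by
      rw [hsum]
      have : 0 < (N - 2) * ((c - 1) * q) := by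
        refine Nat.mul_pos (by omega) (by omega)
      omega)
  refine ⟨⟨_, hadm⟩, le_trans (ENNReal.ofReal_le_ofReal ?_) hK⟩
  have hN' : (4 : ℝ) ≤ N := by exact_mod_cast hN
  rw [hsum, le_div_iff₀ (by linarith)]
  have h5 : ((1 + (N - 1 + (N - 2) * ((c - 1) * q)) : ℕ) : ℝ) =
      N + (N - 2) * (((c - 1) * q : ℕ) : ℝ) := by
    rw [← Nat.add_assoc, Nat.add_sub_cancel' (by omega : 1 ≤ N), Nat.cast_add,
      Nat.cast_mul, Nat.cast_sub (by omega : 2 ≤ N)]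
    push_cast
    ring
  rw [h5]
  have h6 : (N : ℝ) ≤ 2 * (((c - 1) * q : ℕ) : ℝ) := by exact_mod_cast hcq
  nlinarith

/-- All but one of the cyclic summands split as `C_u ⊕ C_v`. The ceilings then sum to `1 + (N - 2) *
(⌈j / u⌉ + ⌈j / v⌉)`, and `(u - 1) * v + (v - 1) * u ≥ N` makes the cross number at least `N - 1`.
-/
theorem IsBasis.le_crossK_of_coprime {ι : Type*} [Fintype ι] {n : ι → ℕ} {e : ι → G}
    (h : IsBasis n e) {N u v : ℕ} (hι : Fintype.card ι + 1 = N) (hN : 4 ≤ N) (hn : ∀ i, n i = N)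
    (huv : N = u * v) (hcop : u.Coprime v) (hu : 1 < u) (hv : 1 < v) (i₀ : ι) :
    ENNReal.ofReal ((N : ℝ) - 1) ≤ crossK G (N - 2) := by
  classical
  have hN0 : 0 < N := by omega
  have hexp := h.nsmul_eq_zero (N := N) fun i => by rw [hn i]
  have hexp' : ∀ x : G, (v * u) • x = 0 := fun x => by rw [mul_comm, ← huv, hexp]
  let J := {i : ι // i ≠ i₀}
  have hJ : Fintype.card J = N - 2 := by
    have h1 : Fintype.card J = Fintype.card ι - 1 := by
      rw [Fintype.card_subtype_compl, Fintype.card_subtype_eq]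
    omega
  let e' : Option (J ⊕ J) → G := fun o =>
    o.elim (e i₀) (Sum.elim (fun i => v • e i) fun i => u • e i)
  let o' : Option (J ⊕ J) → ℕ := fun o => o.elim N (Sum.elim (fun _ => u) fun _ => v)
  have hind : ∀ z : Option (J ⊕ J) → ℤ, ∑ i, z i • e' i = 0 → ∀ i, (o' i : ℤ) ∣ z i := by
    intro z hz
    let w : ι → ℤ := fun i => if hi : i = i₀ then z none else
      z (some (Sum.inl ⟨i, hi⟩)) * v + z (some (Sum.inr ⟨i, hi⟩)) * u
    have hwi : ∀ i : J, w i = z (some (Sum.inl i)) * v + z (some (Sum.inr i)) * u := fun i =>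
      dif_neg i.2
    have hw0 : w i₀ = z none := dif_pos rfl
    have hw := (h.rel w).1 (by
      rw [← hz, Fintype.sum_eq_add_sum_subtype_ne _ i₀, Fintype.sum_option, Fintype.sum_sum_type,
        ← Finset.sum_add_distrib, hw0]
      congr 1
      refine Finset.sum_congr rfl fun i _ => ?_
      simp only [e', Option.elim, Sum.elim_inl, Sum.elim_inr]
      rw [hwi, add_smul, mul_smul, mul_smul, natCast_zsmul, natCast_zsmul])
    have hcopz : IsCoprime (u : ℤ) (v : ℤ) := Nat.isCoprime_iff_coprime.2 hcop
    rintro (_ | i | i)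
    · have := hw i₀
      rwa [hw0, hn] at this
    · have h1 := hw i
      rw [hwi, hn, huv, Nat.cast_mul] at h1
      have h2 : (u : ℤ) ∣ z (some (Sum.inl i)) * v + z (some (Sum.inr i)) * u :=
        (dvd_mul_right _ _).trans h1
      exact hcopz.dvd_of_dvd_mul_right ((dvd_add_left (dvd_mul_left _ _)).1 h2)
    · have h1 := hw i
      rw [hwi, hn, huv, Nat.cast_mul] at h1
      have h2 : (v : ℤ) ∣ z (some (Sum.inl i)) * v + z (some (Sum.inr i)) * u :=
        (dvd_mul_left _ _).trans h1
      exact hcopz.symm.dvd_of_dvd_mul_right ((dvd_add_right (dvd_mul_left _ _)).1 h2)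
  have hoe : ∀ i, o' i • e' i = 0 := by
    rintro (_ | i | i)
    · exact hexp _
    · show u • v • e i = 0
      rw [smul_smul, mul_comm, hexp']
    · show v • u • e i = 0
      rw [smul_smul, hexp']
  have ho1 : ∀ i, 1 < o' i := by
    rintro (_ | i | i)
    exacts [by show 1 < N; omega, hu, hv]
  have hoN : ∀ i, o' i ∣ N := by
    rintro (_ | i | i)
    · exact dvd_refl N
    · show u ∣ N
      exact huv ▸ dvd_mul_right u v
    · show v ∣ N
      exact huv ▸ dvd_mul_left v u
  have hsum : ∀ F : ℕ → ℕ, ∑ i, F (o' i) = F N + (N - 2) * (F u + F v) := by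
    intro F
    rw [Fintype.sum_option, Fintype.sum_sum_type]
    simp only [o', Option.elim, Sum.elim_inl, Sum.elim_inr, Finset.sum_const, Finset.card_univ, hJ,
      smul_eq_mul]
    ring
  have : Nontrivial (Option (J ⊕ J)) := by
    rw [← Fintype.one_lt_card_iff_nontrivial, Fintype.card_option, Fintype.card_sum, hJ]
    omega
  have hNu : N / u = v := by rw [huv, Nat.mul_div_cancel_left _ (by omega)]
  have hNv : N / v = u := by rw [huv, Nat.mul_div_cancel _ (by omega)]
  have hval : ∑ i, (o' i - 1) * (N / o' i) = (N - 1) + (N - 2) * ((u - 1) * v + (v - 1) * u) := by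
    rw [hsum fun x => (x - 1) * (N / x), Nat.div_self hN0, mul_one, hNu, hNv]
  have hge : N ≤ (u - 1) * v + (v - 1) * u := by
    obtain ⟨a, rfl⟩ : ∃ a, u = a + 2 := ⟨u - 2, by omega⟩
    obtain ⟨b, rfl⟩ : ∃ b, v = b + 2 := ⟨v - 2, by omega⟩
    rw [huv, show a + 2 - 1 = a + 1 by omega, show b + 2 - 1 = b + 1 by omega]
    nlinarith
  obtain ⟨-, hK⟩ := admissible_patternSet (d := N - 2) hN0 hexp ho1 hoN hoe hind
    (fun j hj hjN => by
      rw [hsum fun x => (j + x - 1) / x, ceil_div_self hj hjN, Nat.cast_add,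
        Nat.cast_one, add_sub_cancel_left, Nat.cast_mul]
      exact dvd_mul_right _ _) (by
      rw [hval]
      have : 0 < (N - 2) * ((u - 1) * v + (v - 1) * u) := Nat.mul_pos (by omega) (by omega)
      omega)
  refine le_trans (ENNReal.ofReal_le_ofReal ?_) hK
  have hN' : (4 : ℝ) ≤ N := by exact_mod_cast hN
  rw [hval, le_div_iff₀ (by linarith)]
  have h5 : ((1 + (N - 1 + (N - 2) * ((u - 1) * v + (v - 1) * u)) : ℕ) : ℝ) =
      N + (N - 2) * (((u - 1) * v + (v - 1) * u : ℕ) : ℝ) := by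
    rw [← Nat.add_assoc, Nat.add_sub_cancel' (by omega : 1 ≤ N), Nat.cast_add,
      Nat.cast_mul, Nat.cast_sub (by omega : 2 ≤ N), Nat.cast_two]
  rw [h5]
  have h6 : (N : ℝ) ≤ (((u - 1) * v + (v - 1) * u : ℕ) : ℝ) := by exact_mod_cast hge
  nlinarith

/-! ### Rank one less than the exponent, and the final assembly -/

theorem elasticity_dichotomy [Finite G] {n : ℕ} (hn : 4 ≤ n) (hexp : ∀ x : G, n • x = 0) {r : ℕ}
    {f : (Fin r → ℤ) →+ G} (hf : Function.Surjective f) (hr : r + 1 = n)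
    (hG : Nat.card G ≤ n ^ (n - 1)) {G₀ : Set G} (hU : UniformLengths (n - 2) G₀) :
    elasticity G₀ ≤ max (ENNReal.ofReal ((n : ℝ) / 2)) (crossNumber G₀) ∨
      (n ^ (n - 1) ≤ Nat.card G ∧
        elasticity G₀ ≤ ENNReal.ofReal (((n : ℝ) ^ 2 - n + 1) / (n + 1))) := by
  by_cases h : ∀ g ∈ G₀, -g ∈ G₀ → addOrderOf g = n → ∀ T, IsBlock G₀ g T → T.sum = 0
  · exact Or.inl (elasticity_le_of_block_sum_eq_zero hn hexp hU h)
  · right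
    push Not at h
    obtain ⟨g, hg, hg', hgn, hT⟩ := h
    obtain ⟨Y, x, hYc, hY, hYs, hx, hsub⟩ :=
      exists_basis_of_block hn hexp hU hg hg' hgn hf hr hG hT
    exact ⟨hYc ▸ hY.pow_card_le, hY.elasticity_le hn hexp hYc hYs hx hsub⟩

theorem exists_coprime_factors {n : ℕ} (hn : 1 < n) (h : ¬ IsPrimePow n) :
    ∃ u v, n = u * v ∧ u.Coprime v ∧ 1 < u ∧ 1 < v := by
  have hp := Nat.minFac_prime hn.ne'
  set p := n.minFac with hpdef
  have hpn : p ∣ n := Nat.minFac_dvd n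
  have hk : 0 < n.factorization p := hp.factorization_pos_of_dvd (by omega) hpn
  have hmul := Nat.ordProj_mul_ordCompl_eq_self n p
  refine ⟨p ^ n.factorization p, n / p ^ n.factorization p, hmul.symm,
    Nat.Coprime.pow_left _ (Nat.coprime_ordCompl hp (by omega)), Nat.one_lt_pow hk.ne' hp.one_lt, ?_⟩
  by_contra hcon
  have hpos : 0 < n / p ^ n.factorization p := Nat.ordCompl_pos p (by omega)
  rw [(by omega : n / p ^ n.factorization p = 1), mul_one] at hmul
  exact h ((isPrimePow_nat_iff n).2 ⟨p, _, hp, hk, hmul⟩)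

namespace IsBasis

variable [Finite G] {r : ℕ} {n : Fin r → ℕ} {e : Fin r → G} (h : IsBasis n e) {N : ℕ}
  (hr : r + 1 = N) (hN : 4 ≤ N)

include h hr hN

/-- The bound `1 + (N - 1) * (N - 2) / N` for `K` lies below `ρ` by `(N - 2) / (N * (N + 1))`, and
`N / 2 ≤ ρ`; so both alternatives of the dichotomy give at most `ρ`. -/
theorem rhoStar_of_isPrimePow (hn : ∀ i, n i = N) (hpp : IsPrimePow N) :
    crossK G (N - 2) < rhoStar G (N - 2) ∧
      rhoStar G (N - 2) = ENNReal.ofReal (((N : ℝ) ^ 2 - N + 1) / (N + 1)) := by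
  classical
  have hN' : (4 : ℝ) ≤ N := by exact_mod_cast hN
  have hexp := h.nsmul_eq_zero (N := N) fun i => by rw [hn i]
  have hind : ∀ z : Fin r → ℤ, ∑ i, z i • e i = 0 → ∀ i, (N : ℤ) ∣ z i := fun z hz i =>
    hn i ▸ (h.rel z).1 hz i
  obtain ⟨f, hf⟩ := h.exists_surjective
  obtain ⟨hY, hYc⟩ := h.indep_image (by omega) hn
  rw [Fintype.card_fin] at hYc
  replace hYc : (Finset.univ.image e).card = N - 1 := hYc.trans (by omega)
  set Y := Finset.univ.image e
  have hG : Nat.card G ≤ N ^ (N - 1) := by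
    have hsurj : Function.Surjective fun b : Fin r → Fin N => ∑ i, (b i : ℕ) • e i := by
      intro x
      obtain ⟨b, hb⟩ := h.span x
      have hpos : (0 : ℤ) < N := by omega
      have hnn := fun i => Int.emod_nonneg (b i) hpos.ne'
      refine ⟨fun i => ⟨(b i % N).toNat, by
        have := Int.emod_lt_of_pos (b i) hpos
        have := hnn i
        omega⟩, ?_⟩
      rw [← hb]
      refine Finset.sum_congr rfl fun i _ => ?_
      rw [← natCast_zsmul, Int.toNat_of_nonneg (hnn i)]
      conv_rhs => rw [← Int.emod_add_mul_ediv (b i) N, add_smul, mul_comm, mul_smul, natCast_zsmul,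
        hexp, smul_zero, add_zero]
    have := Nat.card_le_card_of_surjective _ hsurj
    rw [Nat.card_fun, Nat.card_fin, Nat.card_fin] at this
    rwa [(by omega : N - 1 = r)]
  obtain ⟨p, m, hp, -, hpm⟩ := (isPrimePow_nat_iff N).1 hpp
  obtain ⟨ρ, hρ⟩ : ∃ ρ : ℝ, ρ = ((N : ℝ) ^ 2 - N + 1) / (N + 1) := ⟨_, rfl⟩
  have hρ1 : ρ * (N + 1) = (N : ℝ) ^ 2 - N + 1 := by rw [hρ]; field_simp
  have hρpos : 0 < ρ := by nlinarith
  have hK : crossK G (N - 2) ≤ ENNReal.ofReal (1 + ((N : ℝ) - 1) * (N - 2) / N) :=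
    crossK_le fun G₀ hG₀ => crossNumber_le_of_isPrimePow hp hpm.symm hexp h.span hind hN
      (by rw [Fintype.card_fin]; omega) hG₀.uniformLengths
  have hlt : 1 + ((N : ℝ) - 1) * (N - 2) / N < ρ := by
    rw [hρ, ← sub_pos]
    have : ((N : ℝ) ^ 2 - N + 1) / (N + 1) - (1 + ((N : ℝ) - 1) * (N - 2) / N) =
        (N - 2) / (N * (N + 1)) := by
      field_simp; ring
    rw [this]
    apply div_pos <;> nlinarith
  have hKlt : crossK G (N - 2) < ENNReal.ofReal ρ :=
    hK.trans_lt ((ENNReal.ofReal_lt_ofReal_iff hρpos).2 hlt)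
  have hgn : addOrderOf (∑ y ∈ Y, y) = N := by
    refine Nat.dvd_antisymm (order_dvd hexp _) ?_
    obtain ⟨y, hy⟩ : Y.Nonempty := Finset.card_pos.1 (by omega)
    have := hY (fun _ => (addOrderOf (∑ y ∈ Y, y) : ℤ)) (by
      rw [← Finset.smul_sum, natCast_zsmul, addOrderOf_nsmul_eq_zero]) y hy
    exact Int.natCast_dvd_natCast.1 this
  obtain ⟨hadm, hle⟩ := hY.admissible_and_le_elasticity hN hexp hYc rfl hgn
  have heq : rhoStar G (N - 2) = ENNReal.ofReal ρ := by
    refine le_antisymm (rhoStar_le fun G₀ hG₀ => ?_) ((hρ ▸ hle).trans (le_rhoStar hadm))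
    rcases elasticity_dichotomy hN hexp hf hr hG hG₀.uniformLengths with h1 | ⟨-, h1⟩
    · refine h1.trans (max_le (ENNReal.ofReal_le_ofReal ?_) ((le_crossK hG₀).trans hKlt.le))
      nlinarith
    · rwa [hρ]
  exact ⟨heq ▸ hKlt, by rw [heq, hρ]⟩

/-- The exceptional alternative of the dichotomy forces `G` to be homocyclic, so `N` is not a prime
power. Then `K(G, N - 2) ≥ N - 1`, which exceeds `(N² - N + 1) / (N + 1)`. -/
theorem rhoStar_eq_crossK_of_not (hn : ∀ i, n i ∣ N) (hG : Nat.card G ≤ N ^ (N - 1))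
    (hhom : N ^ (N - 1) ≤ Nat.card G → ∀ i, n i = N) (i₀ : Fin r)
    (hpp : ¬ ((∀ i, n i = N) ∧ IsPrimePow N))
    (hhalf : ENNReal.ofReal ((N : ℝ) / 2) ≤ crossK G (N - 2)) :
    crossK G (N - 2) = rhoStar G (N - 2) := by
  have hN' : (4 : ℝ) ≤ N := by exact_mod_cast hN
  have hexp := h.nsmul_eq_zero hn
  obtain ⟨f, hf⟩ := h.exists_surjective
  refine le_antisymm (crossK_le fun G₀ hG₀ =>
    (crossNumber_le_elasticity (by omega) hexp G₀).trans (le_rhoStar hG₀)) (rhoStar_le fun G₀ hG₀ => ?_)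
  rcases elasticity_dichotomy hN hexp hf hr hG hG₀.uniformLengths with h1 | ⟨h2, h1⟩
  · exact h1.trans (max_le hhalf (le_crossK hG₀))
  · have hnN := hhom h2
    obtain ⟨u, v, huv, hcop, hu, hv⟩ := exists_coprime_factors (by omega) fun h => hpp ⟨hnN, h⟩
    refine h1.trans (le_trans (ENNReal.ofReal_le_ofReal ?_)
      (h.le_crossK_of_coprime (by rw [Fintype.card_fin, hr]) hN hnN huv hcop hu hv i₀))
    rw [div_le_iff₀ (by linarith)]
    nlinarith

end IsBasis

end ZeroSum
theorem proposition3p8 {G : Type*} [AddCommGroup G] [Finite G]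
    (r : ℕ) (hr : 0 < r) (n : Fin r → ℕ)
    (hn : ∀ i, 1 < n i) (hdvd : ∀ i j, i ≤ j → n i ∣ n j)
    (hG : Nonempty (G ≃+ ((i : Fin r) → ZMod (n i))))
    (hD : 4 ≤ ZeroSum.davenport (Set.univ : Set G))
    (n₁ nᵣ : ℕ) (hn₁ : n₁ = n ⟨0, hr⟩) (hnᵣ : nᵣ = n ⟨r - 1, Nat.sub_lt hr one_pos⟩) :
    (∀ d ∈ ZeroSum.DeltaOne G, max (nᵣ / 2) ((r + 1) / 2) ≤ d →
      (∃ G₀ : Set G, ZeroSum.Admissible d G₀) ∧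
      (r ≤ d → d < nᵣ ∧
        ZeroSum.rhoStar G d = ENNReal.ofReal ((nᵣ : ℝ) / ((nᵣ : ℝ) - (d : ℝ)))) ∧
      (nᵣ ≤ d + 1 → ZeroSum.rhoStar G d = ZeroSum.crossK G d)) ∧
    (r + 1 = nᵣ → 3 ≤ r →
      (∃ G₀ : Set G, ZeroSum.Admissible (r - 1) G₀) ∧
      ((n₁ = nᵣ ∧ IsPrimePow nᵣ) →
        ZeroSum.crossK G (r - 1) < ZeroSum.rhoStar G (r - 1) ∧
        ZeroSum.rhoStar G (r - 1) =
          ENNReal.ofReal (1 + ((r : ℝ) + 1) * ((r : ℝ) - 1) / ((r : ℝ) + 2)) ∧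
        ZeroSum.rhoStar G (r - 1) < (r : ℝ≥0∞)) ∧
      (¬ (n₁ = nᵣ ∧ IsPrimePow nᵣ) →
        ZeroSum.crossK G (r - 1) = ZeroSum.rhoStar G (r - 1))) := by
  obtain ⟨E⟩ := hG
  obtain ⟨e, he⟩ := ZeroSum.exists_isBasis E
  have hdvdN : ∀ i, n i ∣ nᵣ := fun i => hnᵣ ▸ hdvd i _ (Fin.mk_le_mk.2 (by omega) :
    (⟨i, i.2⟩ : Fin r) ≤ ⟨r - 1, Nat.sub_lt hr one_pos⟩)
  have hdvd1 : ∀ i, n₁ ∣ n i := fun i => hn₁ ▸ hdvd _ i (Fin.mk_le_mk.2 (Nat.zero_le _) :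
    (⟨0, hr⟩ : Fin r) ≤ ⟨i, i.2⟩)
  have hN1 : 1 < nᵣ := hnᵣ ▸ hn _
  have hexp := he.nsmul_eq_zero hdvdN
  refine ⟨fun d hd hmax => ?_, fun hrN hr3 => ?_⟩
  · have hadm := ZeroSum.exists_admissible_of_mem_deltaOne hd
    have hd2 : nᵣ ≤ 2 * d + 1 := by
      have := (le_max_left _ _).trans hmax
      omega
    obtain ⟨f, hf⟩ := he.exists_surjective
    exact ⟨hadm, fun hrd => ZeroSum.rhoStar_eq_of_rank_le (by omega) hexp hd2 hadm hf hrd,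
      fun h => ZeroSum.rhoStar_eq_crossK (by omega) hexp h⟩
  · have hN4 : 4 ≤ nᵣ := by omega
    have hd : r - 1 = nᵣ - 2 := by omega
    have hr1 : nᵣ - 1 = r := by omega
    have hrR : (nᵣ : ℝ) = r + 1 := by rw [← hrN]; push_cast; ring
    have hcard : Nat.card G = ∏ i, n i := by
      rw [Nat.card_congr E.toEquiv, Nat.card_pi]
      simp only [Nat.card_zmod]
    have hprod : ∏ _i : Fin r, nᵣ = nᵣ ^ (nᵣ - 1) := by
      rw [Finset.prod_const, Finset.card_univ, Fintype.card_fin, hr1]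
    have hle : ∀ i, n i ≤ nᵣ := fun i => Nat.le_of_dvd (by omega) (hdvdN i)
    have hhom : (∀ i, n i = nᵣ) ↔ n₁ = nᵣ :=
      ⟨fun h => by rw [hn₁, h], fun h i => Nat.dvd_antisymm (hdvdN i) (h ▸ hdvd1 i)⟩
    rw [hd]
    obtain ⟨hex, hhalf⟩ := he.exists_admissible (by rw [Fintype.card_fin, hrN]) hN4 hdvdN
      (hn₁ ▸ hn _) hdvd1 hnᵣ.symm
    refine ⟨hex, fun ⟨h1, h2⟩ => ?_, fun h => ?_⟩
    · obtain ⟨h3, h4⟩ := he.rhoStar_of_isPrimePow hrN hN4 (hhom.2 h1) h2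
      have h5 : ((nᵣ : ℝ) ^ 2 - nᵣ + 1) / (nᵣ + 1) =
          1 + ((r : ℝ) + 1) * ((r : ℝ) - 1) / ((r : ℝ) + 2) := by
        rw [hrR]; field_simp; ring
      refine ⟨h3, by rw [h4, h5], ?_⟩
      have hr3' : (3 : ℝ) ≤ r := by exact_mod_cast hr3
      rw [h4, ← ENNReal.ofReal_natCast r, ENNReal.ofReal_lt_ofReal_iff (by linarith), hrR,
        div_lt_iff₀ (by linarith)]
      nlinarith
    · refine he.rhoStar_eq_crossK_of_not hrN hN4 hdvdN ?_ (fun hge => ?_) ⟨0, hr⟩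
        (fun h' => h ⟨hhom.1 h'.1, h'.2⟩) hhalf
      · rw [hcard, ← hprod]
        exact Finset.prod_le_prod' fun i _ => hle i
      -- A summand of order below `nᵣ` would make the order of `G` smaller than `nᵣ ^ (nᵣ - 1)`.
      · by_contra hcon
        push Not at hcon
        obtain ⟨i, hi⟩ := hcon
        have := Finset.prod_lt_prod (s := Finset.univ) (f := n) (g := fun _ => nᵣ)
          (fun i _ => by have := hn i; omega) (fun i _ => hle i)
          ⟨i, Finset.mem_univ i, lt_of_le_of_ne (hle i) hi⟩
        rw [hprod, ← hcard] at this
        omega
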